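/- Let $\mathbb{S}^3$ be the group of unit quaternions with its canonical metric, and let $E_1=i$, $E_2=j$, $E_3=k$ at the identity, extended to a left invariant orthonormal frame (so $[E_1,E_2]=2E_3$ and cyclically); this frame orients $\mathbb{S}^3$. Let $\Sigma$ be a simply connected Riemann surface. For a smooth immersion $\psi:\Sigma\to\mathbb{S}^3$ (isometric for the induced metric on $\Sigma$), let $N$ be the unit normal field for which $(\psi_x,\psi_y,N)$ is a positive basis for every local holomorphic coordinate $z=x+iy$ of $\Sigma$. The Gauss map of $\psi$ is $g=\frac{N_1+iN_2}{1-N_3}:\Sigma\to\mathbb{C}\cup\{\infty\}$, where $\psi^{-1}N=N_1E_1+N_2E_2+N_3E_3$ (and $g=\infty$ where $N_3=1$). The second fundamental form is $II=\langle -\nabla N,d\psi\rangle$, and the extrinsic curvature is the determinant of the shape operator $v\mapsto-\nabla_vN$. We say that $II$ induces the conformal structure of $\Sigma$ if $II=2\rho\,|dz|^2$ with $\rho>0$ for every local holomorphic coordinate $z$ of $\Sigma$. Let $g:\Sigma\to\mathbb{C}\cup\{\infty\}$ be a smooth map. For a smooth function $K:\Sigma\to(0,\infty)$ consider, in local holomorphic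 coordinates $z$, $$|g_{\bar z}|^2-|g_z|^2>0,\qquad(1)$$ $$\left(\log\frac{1-K-2i\sqrt K}{\sqrt K}\right)_z=\frac{2}{|g_{\bar z}|^2-|g_z|^2}\left(\bar g_z\,g_{z\bar z}-g_z\,\bar g_{z\bar z}+2g_z\bar g_z\,\frac{g\,\bar g_{\bar z}-\bar g\,g_{\bar z}}{1+|g|^2}\right),\qquad(2)$$ where $\bar g_z=(\bar g)_z$ etc., and $g$ is replaced by $1/g$ at the points where $g=\infty$. Then: 1. There is an immersion $\psi:\Sigma\to\mathbb{S}^3$ with Gauss map $g$ whose second fundamental form induces the conformal structure of $\Sigma$ if and only if (1) holds on $\Sigma$ and there is a smooth positive function $K$ on $\Sigma$ solving (2). 2. More precisely, for a function $K:\Sigma\to\mathbb{R}$, there is such an immersion with extrinsic curvature $K$ if and only if (1) holds and $K$ is smooth, positive and solves (2). 3. Such an immersion with given Gauss map $g$ and given extrinsic curvature $K$ is unique up to left translations of $\mathbb{S}^3$. -/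

import Mathlib

open scoped Manifold ContDiff Quaternion Matrix

noncomputable section

/-- The sphere `S³`, as the Lie group of unit quaternions. Its canonical metric is the one
induced by the Euclidean metric of `ℍ = ℝ⁴`; the quaternions `i, j, k` at the identity give the
left invariant orthonormal frame `E₁, E₂, E₃`, with `[E₁, E₂] = 2 E₃` and its cyclic
permutations, and `S³` is oriented by this frame. -/
abbrev UnitQuaternions : Type := Metric.sphere (0 : ℍ[ℝ]) 1

section Sphere

/-- The standard coordinate `w` on `ℂ ∪ {∞}` minus `∞` (the value at `∞` is irrelevant). -/
def finiteCoord (x : OnePoint ℂ) : ℂ :=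
  match x with
  | none => 0
  | some w => w

/-- The standard coordinate `1 / w` on `ℂ ∪ {∞}` minus `0`, with value `0` at `∞`
(the value at `0` is irrelevant). -/
def infiniteCoord (x : OnePoint ℂ) : ℂ :=
  match x with
  | none => 0
  | some w => w⁻¹

/-- The stereographic projection from the north pole of a unit imaginary quaternion
`n = n₁ i + n₂ j + n₃ k`, namely `(n₁ + i n₂) / (1 - n₃)`, and `∞` at the north pole. -/
def stereoNorth (n : ℍ[ℝ]) : OnePoint ℂ :=
  open Classical in
  if n.imK = 1 then OnePoint.infty
  else (((⟨n.imI, n.imJ⟩ : ℂ) / ((1 - n.imK : ℝ) : ℂ) : ℂ) : OnePoint ℂ)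

/-- The coordinates `(q₁, q₂, q₃)` of the imaginary part of `q` with respect to `i, j, k`. -/
def imVec (q : ℍ[ℝ]) : Fin 3 → ℝ := ![q.imI, q.imJ, q.imK]

end Sphere

section Coordinates

variable {X : Type*} [TopologicalSpace X]
variable {F : Type*} [NormedAddCommGroup F] [NormedSpace ℝ F]

/-- The real differential at `p` of `f : X → F`, read in the local coordinate `e` of `X`.
With `z = x + i y` the coordinate, its value at `1` is `∂f/∂x` and its value at `I` is
`∂f/∂y`. -/
def coordD (e : OpenPartialHomeomorph X ℂ) (f : X → F) (p : X) : ℂ →L[ℝ] F :=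
  fderiv ℝ (fun w : ℂ => f (e.symm w)) (e p)

/-- `∂f/∂z = (∂f/∂x - i ∂f/∂y) / 2` in the local coordinate `e`. -/
def dZ (e : OpenPartialHomeomorph X ℂ) (f : X → ℂ) (p : X) : ℂ :=
  (coordD e f p 1 - Complex.I * coordD e f p Complex.I) / 2

/-- `∂f/∂z̄ = (∂f/∂x + i ∂f/∂y) / 2` in the local coordinate `e`. -/
def dZbar (e : OpenPartialHomeomorph X ℂ) (f : X → ℂ) (p : X) : ℂ :=
  (coordD e f p 1 + Complex.I * coordD e f p Complex.I) / 2

/-- The complex conjugate of a function. -/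
def conjFun (f : X → ℂ) : X → ℂ := fun p => (starRingEnd ℂ) (f p)

/-- `|f_z̄|² - |f_z|²` in the local coordinate `e`. -/
def negJacobian (e : OpenPartialHomeomorph X ℂ) (f : X → ℂ) (p : X) : ℝ :=
  ‖dZbar e f p‖ ^ 2 - ‖dZ e f p‖ ^ 2

/-- The function `log ((1 - K - 2 i √K) / √K)`. For `K > 0` the argument has negative imaginary
part, so the principal branch is smooth there. -/
def logTerm (K : X → ℝ) (p : X) : ℂ :=
  Complex.log ((1 - (K p : ℂ) - 2 * Complex.I * (Real.sqrt (K p) : ℂ)) / (Real.sqrt (K p) : ℂ))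

/-- The equation
`(log ((1 - K - 2i√K)/√K))_z = 2 / (|g_z̄|² - |g_z|²) *
  (ḡ_z g_{zz̄} - g_z ḡ_{zz̄} + 2 g_z ḡ_z (g ḡ_z̄ - ḡ g_z̄) / (1 + |g|²))`
at the point `p`, in the local coordinate `e`, for a complex valued function `g`. -/
def GaussEquationAt (e : OpenPartialHomeomorph X ℂ) (g : X → ℂ) (K : X → ℝ) (p : X) : Prop :=
  dZ e (logTerm K) p =
    2 / (negJacobian e g p : ℂ) *
      (dZ e (conjFun g) p * dZ e (dZbar e g) p
        - dZ e g p * dZ e (dZbar e (conjFun g)) p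
        + 2 * dZ e g p * dZ e (conjFun g) p *
          ((g p * dZbar e (conjFun g) p - conjFun g p * dZbar e g p)
            / (1 + (‖g p‖ ^ 2 : ℝ) : ℂ)))

/-- The map `g : X → ℂ ∪ {∞}` read near `p` in a standard coordinate of `ℂ ∪ {∞}` around
`g p`: it is `g` if `g p ≠ ∞` and `1 / g` if `g p = ∞`. -/
def sphereRep (g : X → OnePoint ℂ) (p : X) : X → ℂ :=
  open Classical in
  if g p = OnePoint.infty then fun q => infiniteCoord (g q) else fun q => finiteCoord (g q)

end Coordinates

section RiemannSurface

variable {X : Type*} [TopologicalSpace X] [ChartedSpace ℂ X]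

/-- `e` is a holomorphic local coordinate of the Riemann surface `X`. -/
def IsHolCoord (e : OpenPartialHomeomorph X ℂ) : Prop :=
  e ∈ IsManifold.maximalAtlas 𝓘(ℂ) ω X

/-- `g` is a smooth (in the real sense) map from `X` to the Riemann sphere `ℂ ∪ {∞}`. -/
def SmoothToSphere (g : X → OnePoint ℂ) : Prop :=
  Continuous g ∧ ∀ p : X, ContMDiffAt 𝓘(ℝ, ℂ) 𝓘(ℝ, ℂ) ∞ (sphereRep g p) p

/-- The condition `|g_z̄|² - |g_z|² > 0` everywhere on `X`
(with `1 / g` in place of `g` where `g = ∞`). -/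
def NegJacobianPos (g : X → OnePoint ℂ) : Prop :=
  ∀ e : OpenPartialHomeomorph X ℂ, IsHolCoord e → ∀ p ∈ e.source,
    0 < negJacobian e (sphereRep g p) p

/-- `K` is a smooth positive function on `X` solving the Gauss map equation of `g` everywhere on
`X` (with `1 / g` in place of `g` where `g = ∞`). -/
structure SolvesGaussEquation (g : X → OnePoint ℂ) (K : X → ℝ) : Prop where
  smooth : ContMDiff 𝓘(ℝ, ℂ) 𝓘(ℝ, ℝ) ∞ K
  pos : ∀ p, 0 < K p
  eqn : ∀ e : OpenPartialHomeomorph X ℂ, IsHolCoord e → ∀ p ∈ e.source,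
    GaussEquationAt e (sphereRep g p) K p

/-- `ψ : X → S³` is a smooth immersion. -/
structure IsSmoothImmersion (ψ : X → UnitQuaternions) : Prop where
  smooth : ContMDiff 𝓘(ℝ, ℂ) 𝓘(ℝ, ℍ[ℝ]) ∞ (fun p => (ψ p : ℍ[ℝ]))
  injective : ∀ e : OpenPartialHomeomorph X ℂ, IsHolCoord e → ∀ p ∈ e.source,
    Function.Injective (coordD e (fun q => (ψ q : ℍ[ℝ])) p)

/-- `N` is the smooth unit normal field of `ψ : X → S³` that is compatible with the orientation
of the Riemann surface `X`: `N p` is a unit vector tangent to `S³` at `ψ p`, orthogonal to the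
surface, and `(ψ_x, ψ_y, N)` is a positive basis for every holomorphic coordinate `z = x + i y`
(orientation being tested after left translation to the identity). -/
structure IsOrientedUnitNormal (ψ : X → UnitQuaternions) (N : X → ℍ[ℝ]) : Prop where
  smooth : ContMDiff 𝓘(ℝ, ℂ) 𝓘(ℝ, ℍ[ℝ]) ∞ N
  unit : ∀ p, ‖N p‖ = 1
  tangent : ∀ p, inner ℝ (N p) (ψ p : ℍ[ℝ]) = 0
  normal : ∀ e : OpenPartialHomeomorph X ℂ, IsHolCoord e → ∀ p ∈ e.source, ∀ v : ℂ,
    inner ℝ (N p) (coordD e (fun q => (ψ q : ℍ[ℝ])) p v) = 0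
  oriented : ∀ e : OpenPartialHomeomorph X ℂ, IsHolCoord e → ∀ p ∈ e.source,
    0 < crossProduct
          (imVec ((ψ p : ℍ[ℝ])⁻¹ * coordD e (fun q => (ψ q : ℍ[ℝ])) p 1))
          (imVec ((ψ p : ℍ[ℝ])⁻¹ * coordD e (fun q => (ψ q : ℍ[ℝ])) p Complex.I))
        ⬝ᵥ imVec ((ψ p : ℍ[ℝ])⁻¹ * N p)

/-- The second fundamental form `II(v, w) = ⟨-∇_v N, dψ(w)⟩` in the coordinate `e`. The covariant
derivative of `S³` is the tangential part of the derivative in `ℍ = ℝ⁴`, and `dψ(w)` is tangent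
to `S³`, so that `∇_v N` may be replaced by the derivative of `N` as an `ℍ`-valued map. -/
def secondFundamentalForm (ψ : X → UnitQuaternions) (N : X → ℍ[ℝ])
    (e : OpenPartialHomeomorph X ℂ) (p : X) (v w : ℂ) : ℝ :=
  inner ℝ (-(coordD e N p v)) (coordD e (fun q => (ψ q : ℍ[ℝ])) p w)

/-- The conformal structure induced by the second fundamental form is that of `X`: one has
`II = 2 ρ |dz|²` with `ρ > 0` in every holomorphic coordinate `z`. -/
def SecondFormConformal (ψ : X → UnitQuaternions) (N : X → ℍ[ℝ]) : Prop :=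
  ∀ e : OpenPartialHomeomorph X ℂ, IsHolCoord e → ∀ p ∈ e.source,
    ∃ ρ : ℝ, 0 < ρ ∧ ∀ v w : ℂ, secondFundamentalForm ψ N e p v w = 2 * ρ * inner ℝ v w

/-- `g` is the Gauss map of `ψ` with unit normal `N`: the left translate to the identity
`ψ⁻¹ N = N₁ i + N₂ j + N₃ k`, followed by stereographic projection. -/
def IsGaussMap (ψ : X → UnitQuaternions) (N : X → ℍ[ℝ]) (g : X → OnePoint ℂ) : Prop :=
  ∀ p, g p = stereoNorth ((ψ p : ℍ[ℝ])⁻¹ * N p)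

/-- `K` is the extrinsic curvature of `ψ`, the determinant of the shape operator
`A : v ↦ -∇_v N`. (The derivative of `N` has no component along `ψ`, since `N` is orthogonal to
`ψ` and to `dψ`, so that `∇_v N` is the derivative of `N` as an `ℍ`-valued map.) -/
def IsExtrinsicCurvature (ψ : X → UnitQuaternions) (N : X → ℍ[ℝ]) (K : X → ℝ) : Prop :=
  ∀ e : OpenPartialHomeomorph X ℂ, IsHolCoord e → ∀ p ∈ e.source,
    ∃ A : ℂ →ₗ[ℝ] ℂ,
      (∀ v : ℂ, coordD e (fun q => (ψ q : ℍ[ℝ])) p (A v) = -(coordD e N p v)) ∧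
      K p = LinearMap.det A

/-- `ψ : X → S³` is an immersion, with oriented unit normal `N`, whose Gauss map is `g` and whose
second fundamental form induces the conformal structure of `X`. -/
structure HasGaussMapAndConformalStructure (ψ : X → UnitQuaternions) (N : X → ℍ[ℝ])
    (g : X → OnePoint ℂ) : Prop where
  immersion : IsSmoothImmersion ψ
  unitNormal : IsOrientedUnitNormal ψ N
  gaussMap : IsGaussMap ψ N g
  conformal : SecondFormConformal ψ N

end RiemannSurface

end

/-! Write `n = ψ⁻¹N`, the inverse stereographic image of `g`, and `α = ψ⁻¹dψ`, with values in the
imaginary quaternions orthogonal to `n`. Let `J` be multiplication by `i` on `ℂ`. Then `N = ψn` and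
`dN = ψ(dn + αn)`, where `αn = -nα`. The form `II` equals `2ρ|dz|²` exactly when `dn = n(α + s α∘J)`
with `s = 2ρ/det(ψ_x, ψ_y, N) > 0`. In that case `dN = s ψ n (α∘J)`. Left multiplication by `n` and
`J` are both of determinant one, so the extrinsic curvature is `K = s²`.

The structure equation can be solved for the form: `α = n(a dn + b dn∘J)` with `a = -1/(1+s²)` and
`b = s/(1+s²)`. Hence `g` and `K` determine `ψ⁻¹dψ`, which gives uniqueness up to left translation.
An immersion exists exactly when this explicit `α` integrates to `ψ` with `dψ = ψα`. On a simply
connected surface that is the flatness of `α` (`exists_local_frame`,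
`exists_glue_of_locally_constant_quotients`).

By `curvature_frameForm` the curvature is `-n` times `flatDefect`, a combination of `n_x`, `n_y` and
the tension field of `n` as a map to the 2-sphere. In a stereographic coordinate `w` it becomes one
complex number `E` (`flatDefect_eq_dSigma`). Since `(1 - K - 2i√K)/√K = (1 - is)²/s`, the two sides
of (2) differ by a nonzero multiple of `w̄_z E - w_z Ē`. Together with its conjugate this is a
linear system in `E, Ē` whose determinant is a multiple of the Jacobian, so under (1) it says `E =
0` (`gaussEquationAt_iff`). Condition (1) itself expresses the orientation of `(ψ_x, ψ_y, N)`,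
because `(n_x, n_y)` has `1 + s²` times the oriented area of `(ψ_x, ψ_y)` and stereographic
projection from the north pole reverses orientation. -/

noncomputable section

/-! ### Linear differential equations on the unit interval -/

section LinearODE

open Set Metric Filter Topology

variable {H : Type*} [NormedRing H] [NormOneClass H] [NormedAlgebra ℝ H] [CompleteSpace H]

/-- The bound `1/2` lets one Picard–Lindelöf step cover the whole interval: on the unit ball around
`1` the speed is at most `2 · 1/2 = 1`, so the solution stays in the ball up to time `1`. The
Gronwall bound by `e` is uniform in `β`, so that the constants in the next proof do not depend on
the chosen ray. -/
theorem exists_linearODE_solution (β : ℝ → H) (hβ : ContinuousOn β (Icc 0 1))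
    (hb : ∀ t ∈ Icc (0 : ℝ) 1, ‖β t‖ ≤ 1 / 2) :
    ∃ f : ℝ → H, f 0 = 1 ∧
      (∀ t ∈ Icc (0 : ℝ) 1, HasDerivWithinAt f (f t * β t) (Icc 0 1) t) ∧
      ∀ t ∈ Icc (0 : ℝ) 1, ‖f t‖ ≤ Real.exp 1 := by
  have hP : IsPicardLindelof (fun t x => x * β t) (tmin := 0) (tmax := 1)
      ⟨0, by simp⟩ (1 : H) 1 0 1 (1 / 2) := by
    refine ⟨fun t ht => ?_, fun x _ => continuousOn_const.mul hβ, fun t ht x hx => ?_, by simp⟩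
    · refine LipschitzWith.lipschitzOnWith (LipschitzWith.of_dist_le_mul fun x y => ?_)
      rw [dist_eq_norm, dist_eq_norm, ← sub_mul]
      refine (norm_mul_le _ _).trans ?_
      rw [mul_comm]
      have := hb t ht
      gcongr
      simpa using this
    · have h1 : ‖x‖ ≤ 2 := by
        have h2 : ‖x - 1‖ ≤ 1 := by simpa [dist_eq_norm] using hx
        calc ‖x‖ = ‖(x - 1) + 1‖ := by simp
          _ ≤ ‖x - 1‖ + ‖(1 : H)‖ := norm_add_le _ _
          _ ≤ 2 := by rw [norm_one]; linarith
      refine (norm_mul_le _ _).trans ?_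
      have := hb t ht
      calc ‖x‖ * ‖β t‖ ≤ 2 * (1 / 2) := by gcongr
        _ = _ := by simp
  obtain ⟨f, hf0, hf⟩ := hP.exists_eq_forall_mem_Icc_hasDerivWithinAt₀
  refine ⟨f, hf0, hf, fun t ht => ?_⟩
  have := norm_le_gronwallBound_of_norm_deriv_right_le (f := f) (f' := fun t => f t * β t)
    (δ := 1) (K := 1) (ε := 0) (a := 0) (b := 1)
    (fun t ht => (hf t ht).continuousWithinAt)
    (fun t ht => (hf t ⟨ht.1, ht.2.le⟩).mono_of_mem_nhdsWithin (Icc_mem_nhdsGE_of_mem ht))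
    (by simp at hf0; simp [hf0]) (fun t ht => by
      refine (norm_mul_le _ _).trans ?_
      have := hb t ⟨ht.1, ht.2.le⟩
      nlinarith [norm_nonneg (f t)]) t ht
  rw [gronwallBound_ε0] at this
  refine this.trans ?_
  simp only [one_mul, sub_zero]
  exact Real.exp_le_exp.2 ht.2

end LinearODE

/-! ### Local integration of flat connection forms -/

section Frobenius

open Set Metric Filter Topology

variable {H : Type*} [NormedRing H] [NormOneClass H] [NormedAlgebra ℝ H] [CompleteSpace H]
variable {V : Type*} [NormedAddCommGroup V] [NormedSpace ℝ V]

/-- A flat connection form `α` has, locally, a frame `F` with `dF = F α`. -/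
theorem exists_local_frame (α : V → V →L[ℝ] H) (z₀ : V) (hα : ContDiffAt ℝ 2 α z₀)
    (hflat : ∀ᶠ z in 𝓝 z₀, ∀ u v : V,
      fderiv ℝ α z u v + α z u * α z v = fderiv ℝ α z v u + α z v * α z u) :
    ∃ r > 0, ∃ F : V → H, F z₀ = 1 ∧
      ∀ z ∈ ball z₀ r, HasFDerivAt F ((ContinuousLinearMap.mul ℝ H (F z)) ∘L α z) z := by
  -- One constant `B` bounds `α`, `dα` and the Lipschitz constant of `dα` near `z₀`; the last exists
  -- because `α` is of class C².
  obtain ⟨B, hB0, r₀, hr₀, hd, hb, hdb, hlip, hfl⟩ : ∃ B : ℝ, 0 ≤ B ∧ ∃ r₀ > 0,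
      (∀ z ∈ ball z₀ r₀, DifferentiableAt ℝ α z) ∧
      (∀ z ∈ ball z₀ r₀, ‖α z‖ ≤ B) ∧ (∀ z ∈ ball z₀ r₀, ‖fderiv ℝ α z‖ ≤ B) ∧
      (∀ z ∈ ball z₀ r₀, ∀ z' ∈ ball z₀ r₀, ‖fderiv ℝ α z' - fderiv ℝ α z‖ ≤ B * ‖z' - z‖) ∧
      (∀ z ∈ ball z₀ r₀, ∀ u v : V,
        fderiv ℝ α z u v + α z u * α z v = fderiv ℝ α z v u + α z v * α z u) := by
    have h1 : ∀ᶠ z in 𝓝 z₀, DifferentiableAt ℝ α z :=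
      (hα.eventually (by simp)).mono fun z hz => hz.differentiableAt (by simp)
    have h2 : ∀ᶠ z in 𝓝 z₀, ‖α z‖ < ‖α z₀‖ + 1 :=
      hα.continuousAt.norm.eventually (gt_mem_nhds (lt_add_one _))
    have hα' : ContDiffAt ℝ 1 (fderiv ℝ α) z₀ := hα.fderiv_right (by norm_num)
    obtain ⟨K, t, ht, hK⟩ := hα'.exists_lipschitzOnWith
    have h3 : ∀ᶠ z in 𝓝 z₀, z ∈ ball z₀ 1 := ball_mem_nhds _ one_pos
    obtain ⟨r₀, hr₀, h⟩ := Metric.eventually_nhds_iff_ball.1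
      (((h1.and h2).and h3).and ((eventually_mem_set.2 ht).and hflat))
    refine ⟨max (max (‖α z₀‖ + 1) (‖fderiv ℝ α z₀‖ + K)) K, ?_, r₀, hr₀, fun z hz => (h z hz).1.1.1,
      fun z hz => (h z hz).1.1.2.le.trans ?_, fun z hz => ?_,
      fun z hz z' hz' => ?_, fun z hz => (h z hz).2.2⟩
    · exact le_max_of_le_right K.2
    · exact (le_max_left _ _).trans (le_max_left _ _)
    · refine le_trans ?_ ((le_max_right _ _).trans (le_max_left _ _))
      have h4 := hK.dist_le_mul z (h z hz).2.1 z₀ (mem_of_mem_nhds ht)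
      rw [dist_eq_norm] at h4
      have h5 : (K : ℝ) * dist z z₀ ≤ K :=
        mul_le_of_le_one_right K.2 (mem_ball.1 (h z hz).1.2).le
      have h6 := norm_le_insert' (fderiv ℝ α z) (fderiv ℝ α z₀)
      linarith
    · have := hK.dist_le_mul z' (h z' hz').2.1 z (h z hz).2.1
      rw [dist_eq_norm, dist_eq_norm] at this
      exact this.trans (by gcongr; exact le_max_right _ _)
  have hlipα : ∀ z ∈ ball z₀ r₀, ∀ z' ∈ ball z₀ r₀, ‖α z' - α z‖ ≤ B * ‖z' - z‖ :=
    fun z hz z' hz' => (convex_ball z₀ r₀).norm_image_sub_le_of_norm_fderiv_le hd hdb hz hz'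
  have htaylor : ∀ z ∈ ball z₀ r₀, ∀ z' ∈ ball z₀ r₀,
      ‖α z' - α z - fderiv ℝ α z (z' - z)‖ ≤ B * ‖z' - z‖ * ‖z' - z‖ := by
    intro z hz z' hz'
    have hseg : segment ℝ z z' ⊆ ball z₀ r₀ := (convex_ball z₀ r₀).segment_subset hz hz'
    refine (convex_segment z z').norm_image_sub_le_of_norm_fderiv_le'
      (fun x hx => hd x (hseg hx)) (fun x hx => ?_) (left_mem_segment _ _ _)
      (right_mem_segment _ _ _)
    refine (hlip z hz x (hseg hx)).trans ?_
    gcongr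
    exact norm_sub_le_of_mem_segment hx
  -- `B r ≤ 1/2` is the smallness needed for the equation along rays. `(B + 1) r ≤ 1/2` will give
  -- `‖D‖ ≤ 1`, as two points of the ball differ by at most `2r`.
  obtain ⟨r, hr, hrr₀, hr1, hBr⟩ : ∃ r > 0, r ≤ r₀ ∧ r ≤ 1 / 2 ∧ B * r ≤ 1 / 2 ∧
      (B + 1) * r ≤ 1 / 2 := by
    have hB1 : 0 < B + 1 := by linarith
    refine ⟨min r₀ (1 / (2 * (B + 1))), by positivity, min_le_left _ _,
      (min_le_right _ _).trans ?_, ?_, ?_⟩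
    · rw [div_le_div_iff₀ (by positivity) (by norm_num)]; linarith
    · calc B * min r₀ (1 / (2 * (B + 1))) ≤ (B + 1) * (1 / (2 * (B + 1))) := by
            gcongr
            · linarith
            · exact min_le_right _ _
        _ = 1 / 2 := by field_simp
    · calc (B + 1) * min r₀ (1 / (2 * (B + 1))) ≤ (B + 1) * (1 / (2 * (B + 1))) := by
            gcongr
            exact min_le_right _ _
        _ = 1 / 2 := by field_simp
  obtain ⟨hBr, hBr'⟩ := hBr
  have hmem : ∀ w : V, ‖w‖ < r → ∀ t ∈ Icc (0 : ℝ) 1, z₀ + t • w ∈ ball z₀ r₀ := by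
    intro w hw t ht
    rw [mem_ball, dist_eq_norm, add_sub_cancel_left, norm_smul, Real.norm_of_nonneg ht.1]
    nlinarith [norm_nonneg w, ht.2]
  have hcurve : ∀ w : V, ∀ t : ℝ, HasDerivAt (fun t : ℝ => z₀ + t • w) w t := fun w t => by
    simpa using ((hasDerivAt_id t).smul_const w).const_add z₀
  have hsol : ∀ w : V, ∃ f : ℝ → H, ‖w‖ < r → f 0 = 1 ∧
      (∀ t ∈ Icc (0 : ℝ) 1,
        HasDerivWithinAt f (f t * α (z₀ + t • w) w) (Icc 0 1) t) ∧
      ∀ t ∈ Icc (0 : ℝ) 1, ‖f t‖ ≤ Real.exp 1 := by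
    intro w
    by_cases hw : ‖w‖ < r
    · obtain ⟨f, hf⟩ := exists_linearODE_solution (fun t => α (z₀ + t • w) w)
        (fun t ht => by
          have h := ((hd _ (hmem w hw t ht)).hasFDerivAt.comp_hasDerivAt t (hcurve w t)).continuousAt
          exact (h.clm_apply continuousAt_const).continuousWithinAt)
        (fun t ht => by
          refine ((α _).le_opNorm w).trans ?_
          calc _ ≤ B * r := mul_le_mul (hb _ (hmem w hw t ht)) hw.le (norm_nonneg _) hB0
            _ ≤ 1 / 2 := hBr)
      exact ⟨f, fun _ => hf⟩
    · exact ⟨0, fun h => absurd h hw⟩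
  choose f hf using hsol
  set M : ℝ := Real.exp 1 with hM
  have hM0 : 0 ≤ M := (Real.exp_pos 1).le
  set C : ℝ := M * B * (B + 1) + M * (1 / 2) + M * B with hC
  -- The frame will be `F(z₀ + w) = f w 1`, so this quadratic estimate is its differentiability with
  -- derivative `F α`.
  have key : ∀ w h : V, ‖w‖ < r → ‖w + h‖ < r →
      ‖f (w + h) 1 - f w 1 - f w 1 * α (z₀ + w) h‖ ≤
        gronwallBound 0 (3 / 2) 1 1 * C * ‖h‖ ^ 2 := by
    intro w h hw hwh
    obtain ⟨f0, fd, fM⟩ := hf w hw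
    obtain ⟨g0, gd, gM⟩ := hf (w + h) hwh
    have hh : ‖h‖ ≤ 2 * r := by
      calc ‖h‖ = ‖(w + h) - w‖ := by simp
        _ ≤ ‖w + h‖ + ‖w‖ := norm_sub_le _ _
        _ ≤ 2 * r := by linarith
    -- If `dF = F α` held, the first variation of the ray solution in direction `h` at time `t`
    -- would be `f w t * α (t h)`. `E` is the error of this guess; it vanishes at `t = 0`.
    set E : ℝ → H := fun t => f (w + h) t - f w t - f w t * α (z₀ + t • w) (t • h) with hE
    have hEd : ∀ t ∈ Icc (0 : ℝ) 1, HasDerivWithinAt E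
        (f (w + h) t * α (z₀ + t • (w + h)) (w + h) - f w t * α (z₀ + t • w) w -
          (f w t * α (z₀ + t • w) w * α (z₀ + t • w) (t • h) +
            f w t * (fderiv ℝ α (z₀ + t • w) w (t • h) + α (z₀ + t • w) h))) (Icc 0 1) t := by
      intro t ht
      refine ((gd t ht).sub (fd t ht)).sub ((fd t ht).mul ?_)
      have h1 : HasDerivAt (fun t : ℝ => α (z₀ + t • w)) (fderiv ℝ α (z₀ + t • w) w) t :=
        (hd _ (hmem w hw t ht)).hasFDerivAt.comp_hasDerivAt t (hcurve w t)
      have h2 : HasDerivAt (fun t : ℝ => t • h) h t := by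
        simpa using (hasDerivAt_id t).smul_const h
      exact (h1.clm_apply h2).hasDerivWithinAt
    have hbound : ∀ t ∈ Icc (0 : ℝ) 1,
        ‖f (w + h) t * α (z₀ + t • (w + h)) (w + h) - f w t * α (z₀ + t • w) w -
          (f w t * α (z₀ + t • w) w * α (z₀ + t • w) (t • h) +
            f w t * (fderiv ℝ α (z₀ + t • w) w (t • h) + α (z₀ + t • w) h))‖ ≤
          3 / 2 * ‖E t‖ + C * ‖h‖ ^ 2 := by
      intro t ht
      set a := z₀ + t • w with ha
      set a' := z₀ + t • (w + h) with ha'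
      set k := t • h with hk
      have haa : a' - a = k := by rw [ha, ha', hk, smul_add]; abel
      have hma : a ∈ ball z₀ r₀ := hmem w hw t ht
      have hma' : a' ∈ ball z₀ r₀ := hmem (w + h) hwh t ht
      have hkh : ‖k‖ ≤ ‖h‖ := by
        rw [hk, norm_smul, Real.norm_of_nonneg ht.1]
        nlinarith [norm_nonneg h, ht.2]
      set D : H := α a' (w + h) - α a w with hD
      set R : H := (α a' - α a - fderiv ℝ α a k) w + (α a' - α a) h with hR
      have hsplit : f (w + h) t * α a' (w + h) - f w t * α a w -
          (f w t * α a w * α a k + f w t * (fderiv ℝ α a w k + α a h)) =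
          E t * α a w + E t * D + f w t * α a k * D + f w t * R := by
        have hfl' := hfl a hma w k
        -- This is where flatness enters: the derivative of `α` along the ray is traded for its
        -- derivative in direction `k`, which is then absorbed in the Taylor remainder `R`.
        have h3 : f w t * fderiv ℝ α a w k = f w t * (fderiv ℝ α a k w + α a k * α a w) -
            f w t * (α a w * α a k) := by rw [← hfl']; noncomm_ring
        have h4 : R = D - fderiv ℝ α a k w - α a h := by
          simp only [hR, hD, sub_apply, map_add]; abel
        have h5 : f (w + h) t = E t + f w t + f w t * α a k := by simp only [hE]; abel
        rw [h4, h5]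
        rw [mul_add (f w t) (fderiv ℝ α a w k), h3]
        simp only [hD]
        noncomm_ring
      rw [hsplit]
      have hβ : ‖α a w‖ ≤ 1 / 2 := ((α a).le_opNorm w).trans
        ((mul_le_mul (hb a hma) hw.le (norm_nonneg _) hB0).trans hBr)
      have hdiff : ‖α a' - α a‖ ≤ B * ‖h‖ := by
        refine (hlipα a hma a' hma').trans ?_
        rw [haa]; gcongr
      have hDn : ‖D‖ ≤ (B + 1) * ‖h‖ := by
        have h1 : D = (α a' - α a) (w + h) + α a h := by
          simp only [hD, sub_apply, map_add]; abel
        rw [h1]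
        refine (norm_add_le _ _).trans ?_
        have h2 : ‖(α a' - α a) (w + h)‖ ≤ B * ‖h‖ * r := ((α a' - α a).le_opNorm _).trans
          (mul_le_mul hdiff hwh.le (norm_nonneg _) (by positivity))
        have h3 : ‖α a h‖ ≤ B * ‖h‖ := ((α a).le_opNorm _).trans
          (mul_le_mul_of_nonneg_right (hb a hma) (norm_nonneg _))
        nlinarith [norm_nonneg h]
      have hD1 : ‖D‖ ≤ 1 := by
        refine hDn.trans ?_
        nlinarith [norm_nonneg h]
      have hRn : ‖R‖ ≤ (1 / 2 + B) * ‖h‖ ^ 2 := by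
        refine (norm_add_le _ _).trans ?_
        have h2 : ‖(α a' - α a - fderiv ℝ α a k) w‖ ≤ (B * ‖h‖ * ‖h‖) * r := by
          refine ((α a' - α a - fderiv ℝ α a k).le_opNorm _).trans
            (mul_le_mul ?_ hw.le (norm_nonneg _) (by positivity))
          have := htaylor a hma a' hma'
          rw [haa] at this
          exact this.trans (by gcongr)
        have h3 : ‖(α a' - α a) h‖ ≤ B * ‖h‖ * ‖h‖ := ((α a' - α a).le_opNorm _).trans
          (mul_le_mul_of_nonneg_right hdiff (norm_nonneg _))
        have h4 : (B * ‖h‖ * ‖h‖) * r = (B * r) * ‖h‖ ^ 2 := by ring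
        have h5 : (B * r) * ‖h‖ ^ 2 ≤ 1 / 2 * ‖h‖ ^ 2 := by gcongr
        nlinarith
      have e1 : ‖E t * α a w‖ ≤ ‖E t‖ * (1 / 2) := (norm_mul_le _ _).trans (by gcongr)
      have e2 : ‖E t * D‖ ≤ ‖E t‖ * 1 := (norm_mul_le _ _).trans (by gcongr)
      have e3 : ‖f w t * α a k * D‖ ≤ M * (B * ‖h‖) * ((B + 1) * ‖h‖) := by
        refine (norm_mul_le _ _).trans (mul_le_mul ((norm_mul_le _ _).trans ?_) hDn
          (norm_nonneg _) (by positivity))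
        refine mul_le_mul (fM t ht) (((α a).le_opNorm _).trans ?_) (norm_nonneg _) hM0
        exact mul_le_mul (hb a hma) hkh (norm_nonneg _) hB0
      have e4 : ‖f w t * R‖ ≤ M * ((1 / 2 + B) * ‖h‖ ^ 2) :=
        (norm_mul_le _ _).trans (mul_le_mul (fM t ht) hRn (norm_nonneg _) hM0)
      calc _ ≤ ‖E t * α a w‖ + ‖E t * D‖ + ‖f w t * α a k * D‖ + ‖f w t * R‖ :=
            norm_add₄_le
        _ ≤ ‖E t‖ * (1 / 2) + ‖E t‖ * 1 + M * (B * ‖h‖) * ((B + 1) * ‖h‖) +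
            M * ((1 / 2 + B) * ‖h‖ ^ 2) := by gcongr
        _ = _ := by rw [hC]; ring
    -- The rate `3/2` is `1/2` from `α w` plus `1` from `D`; the other two terms are quadratic in
    -- `h`.
    have hgron := norm_le_gronwallBound_of_norm_deriv_right_le (f := E) (δ := 0) (K := 3 / 2)
      (ε := C * ‖h‖ ^ 2) (a := 0) (b := 1) (fun t ht => (hEd t ht).continuousWithinAt)
      (fun t ht => (hEd t ⟨ht.1, ht.2.le⟩).mono_of_mem_nhdsWithin (Icc_mem_nhdsGE_of_mem ht))
      (by simp [hE, f0, g0]) (fun t ht => hbound t ⟨ht.1, ht.2.le⟩) 1 (by simp)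
    have hEone : E 1 = f (w + h) 1 - f w 1 - f w 1 * α (z₀ + w) h := by simp [hE]
    rw [hEone] at hgron
    refine hgron.trans (le_of_eq ?_)
    rw [gronwallBound_of_K_ne_0 (by norm_num), gronwallBound_of_K_ne_0 (by norm_num)]
    ring_nf
  refine ⟨r, hr, fun z => f (z - z₀) 1, ?_, fun z hz => ?_⟩
  · obtain ⟨f0, fd, fM⟩ := hf 0 (by simpa using hr)
    have : ∀ t ∈ Icc (0 : ℝ) 1, f 0 t = f 0 0 := by
      refine constant_of_has_deriv_right_zero (fun t ht => (fd t ht).continuousWithinAt)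
        fun t ht => ?_
      have := (fd t ⟨ht.1, ht.2.le⟩).mono_of_mem_nhdsWithin (Icc_mem_nhdsGE_of_mem ht)
      simpa using this
    simpa [f0] using this 1 (by simp)
  · rw [hasFDerivAt_iff_isLittleO_nhds_zero]
    have hO : (fun h => f (z + h - z₀) 1 - f (z - z₀) 1 -
        ((ContinuousLinearMap.mul ℝ H (f (z - z₀) 1)) ∘L α z) h) =O[𝓝 0]
        fun h : V => ‖h‖ ^ 2 := by
      refine Asymptotics.IsBigO.of_bound (gronwallBound 0 (3 / 2) 1 1 * C) ?_
      have : ∀ᶠ h in 𝓝 (0 : V), z + h ∈ ball z₀ r := by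
        refine (continuous_const.add continuous_id).continuousAt.eventually_mem ?_
        exact isOpen_ball.mem_nhds (by simpa using hz)
      filter_upwards [this] with h hh
      have h1 := key (z - z₀) h (by simpa [dist_eq_norm] using hz) (by
        have h2 : z - z₀ + h = z + h - z₀ := by abel
        rw [h2, ← dist_eq_norm]
        exact hh)
      have h2 : z - z₀ + h = z + h - z₀ := by abel
      rw [h2, add_sub_cancel] at h1
      rw [norm_pow, norm_norm]
      exact h1
    refine hO.trans_isLittleO ?_
    have := Asymptotics.isLittleO_norm_pow_id (E' := V) (n := 2) (by norm_num)
    simpa using this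

end Frobenius

/-! ### Gluing over a simply connected space -/

section Monodromy

open Topology Filter Set

/-- On a simply connected space, local maps into a group whose quotients are locally constant can
be glued to a global map, up to left multiplication by constants. -/
theorem exists_glue_of_locally_constant_quotients {X G : Type*} [TopologicalSpace X]
    [SimplyConnectedSpace X] [LocallyPathConnectedSpace X] [Group G]
    (U : X → Set X) (hU : ∀ i, IsOpen (U i)) (hmem : ∀ x, x ∈ U x) (ψ : X → X → G)
    (hψ : ∀ i j, ∀ x ∈ U i ∩ U j,
      ∀ᶠ y in 𝓝 x, ψ i y * (ψ j y)⁻¹ = ψ i x * (ψ j x)⁻¹) :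
    ∃ Ψ : X → G, ∀ x, ∃ g : G, ∀ᶠ y in 𝓝 x, Ψ y = g * ψ x y := by
  -- With the discrete topology on `G`, locally constant quotients are continuous transition
  -- functions, and the bundle they define is a covering.
  let tG : TopologicalSpace G := ⊥
  have dG : DiscreteTopology G := ⟨rfl⟩
  let Z : FiberBundleCore X X G :=
    { baseSet := U
      isOpen_baseSet := hU
      indexAt := id
      mem_baseSet_at := hmem
      coordChange := fun i j x g => g * (ψ i x * (ψ j x)⁻¹)
      coordChange_self := fun i x _ v => by simp
      continuousOn_coordChange := by
        rintro i j ⟨x, g⟩ ⟨hx, -⟩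
        refine ContinuousAt.continuousWithinAt ?_
        have h1 : ∀ᶠ p : X × G in 𝓝 (x, g), p.2 = g :=
          (continuous_snd.continuousAt (x := (x, g))).eventually_mem
            ((isOpen_discrete {g}).mem_nhds rfl)
        have h2 : ∀ᶠ p : X × G in 𝓝 (x, g), ψ i p.1 * (ψ j p.1)⁻¹ = ψ i x * (ψ j x)⁻¹ :=
          (continuous_fst.continuousAt (x := (x, g))).eventually (hψ i j x hx)
        refine (continuousAt_const (y := g * (ψ i x * (ψ j x)⁻¹))).congr ?_
        filter_upwards [h1, h2] with p h1 h2
        rw [h1, h2]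
      coordChange_comp := fun i j k x _ v => by simp [mul_assoc] }
  have cov : IsCoveringMap Z.proj := FiberBundle.isCoveringMap (F := G) (E := Z.Fiber)
  obtain ⟨x₀⟩ : Nonempty X := inferInstance
  -- Simple connectedness lifts the identity map to the covering, that is, gives a global section.
  obtain ⟨S, ⟨-, hS⟩, -⟩ := cov.existsUnique_continuousMap_lifts (ContinuousMap.id X) x₀
    (⟨x₀, (1 : G)⟩ : Z.TotalSpace) rfl
  have hproj : ∀ x, (S x).proj = x := fun x => congr_fun hS x
  let σ : X → G := fun x => (S x).snd
  refine ⟨fun x => σ x * ψ x x, fun x => ?_⟩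
  have hsrc : S x ∈ (Z.localTriv x).source := by
    rw [Bundle.Trivialization.mem_source]
    change (S x).proj ∈ U x
    rw [hproj]; exact hmem x
  have hcont : ContinuousAt (fun y => (Z.localTriv x (S y)).2) x :=
    continuous_snd.continuousAt.comp
      (((Z.localTriv x).continuousAt hsrc).comp S.continuous.continuousAt)
  have hev := hcont.eventually_mem ((isOpen_discrete {(Z.localTriv x (S x)).2}).mem_nhds rfl)
  refine ⟨(Z.localTriv x (S x)).2, ?_⟩
  filter_upwards [hev] with y hy
  -- In the trivialization at `x` the section reads `Ψ y * (ψ x y)⁻¹`; being continuous into a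
  -- discrete space, it is constant near `x`.
  have h1 : (Z.localTriv x (S y)).2 = σ y * (ψ y y * (ψ x y)⁻¹) := by
    rw [Z.localTriv_apply]
    change (id (S y).snd : G) * (ψ (S y).proj (S y).proj * (ψ x (S y).proj)⁻¹) = _
    rw [hproj]
    rfl
  rw [← mem_singleton_iff.1 hy, h1]
  group

end Monodromy

/-! ### The real smooth structure of a Riemann surface -/

section RealStructure

open Topology Filter Set

variable {X : Type*} [TopologicalSpace X] [ChartedSpace ℂ X]

theorem contDiffGroupoid_complex_le_real :
    contDiffGroupoid ω 𝓘(ℂ) ≤ contDiffGroupoid ∞ 𝓘(ℝ, ℂ) := by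
  intro e he
  replace he := mem_groupoid_of_pregroupoid.1 he
  refine mem_groupoid_of_pregroupoid.2 ?_
  simp only [contDiffPregroupoid, modelWithCornersSelf_coe, modelWithCornersSelf_coe_symm,
    Function.id_comp, Function.comp_id, preimage_id, range_id, inter_univ] at he ⊢
  exact ⟨(he.1.restrict_scalars ℝ).of_le le_top, (he.2.restrict_scalars ℝ).of_le le_top⟩

theorem isManifold_real [IsManifold 𝓘(ℂ) ω X] : IsManifold 𝓘(ℝ, ℂ) ∞ X :=
  { toHasGroupoid := hasGroupoid_of_le
      (inferInstance : HasGroupoid X (contDiffGroupoid ω 𝓘(ℂ))) contDiffGroupoid_complex_le_real }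

theorem IsHolCoord.mem_real {e : OpenPartialHomeomorph X ℂ} (he : IsHolCoord e) :
    e ∈ IsManifold.maximalAtlas 𝓘(ℝ, ℂ) ∞ X := by
  have h : e ∈ (contDiffGroupoid ω 𝓘(ℂ)).maximalAtlas X := he
  change e ∈ (contDiffGroupoid ∞ 𝓘(ℝ, ℂ)).maximalAtlas X
  rw [mem_maximalAtlas_iff] at h ⊢
  exact fun e' he' => ⟨contDiffGroupoid_complex_le_real (h e' he').1,
    contDiffGroupoid_complex_le_real (h e' he').2⟩

theorem isHolCoord_chartAt [IsManifold 𝓘(ℂ) ω X] (p : X) : IsHolCoord (chartAt ℂ p) :=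
  IsManifold.chart_mem_maximalAtlas p

variable {F : Type*} [NormedAddCommGroup F] [NormedSpace ℝ F]

theorem IsHolCoord.contDiffAt_comp_symm [IsManifold 𝓘(ℂ) ω X]
    {e : OpenPartialHomeomorph X ℂ} (he : IsHolCoord e)
    {f : X → F} {p : X} (hp : p ∈ e.source) (hf : ContMDiffAt 𝓘(ℝ, ℂ) 𝓘(ℝ, F) ∞ f p) :
    ContDiffAt ℝ ∞ (fun z => f (e.symm z)) (e p) := by
  have := isManifold_real (X := X)
  have h1 : ContMDiffAt 𝓘(ℝ, ℂ) 𝓘(ℝ, ℂ) ∞ e.symm (e p) :=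
    contMDiffAt_symm_of_mem_maximalAtlas he.mem_real (e.map_source hp)
  have h2 : ContMDiffAt 𝓘(ℝ, ℂ) 𝓘(ℝ, F) ∞ (f ∘ e.symm) (e p) := by
    refine ContMDiffAt.comp (e p) ?_ h1
    rwa [e.left_inv hp]
  exact h2.contDiffAt

theorem IsHolCoord.contMDiffAt_of_comp_symm [IsManifold 𝓘(ℂ) ω X]
    {e : OpenPartialHomeomorph X ℂ} (he : IsHolCoord e)
    {f : X → F} {p : X} (hp : p ∈ e.source)
    (hf : ContDiffAt ℝ ∞ (fun z => f (e.symm z)) (e p)) :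
    ContMDiffAt 𝓘(ℝ, ℂ) 𝓘(ℝ, F) ∞ f p := by
  have := isManifold_real (X := X)
  have h1 : ContMDiffAt 𝓘(ℝ, ℂ) 𝓘(ℝ, ℂ) ∞ e p :=
    contMDiffAt_of_mem_maximalAtlas he.mem_real hp
  have h2 : ContMDiffAt 𝓘(ℝ, ℂ) 𝓘(ℝ, F) ∞ ((fun z => f (e.symm z)) ∘ e) p :=
    ContMDiffAt.comp p hf.contMDiffAt h1
  refine h2.congr_of_eventuallyEq ?_
  filter_upwards [e.open_source.mem_nhds hp] with q hq
  simp [e.left_inv hq]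

theorem eventually_nhds_coord {Y : Type*} [TopologicalSpace Y] {e : OpenPartialHomeomorph Y ℂ}
    {p : Y} (hp : p ∈ e.source) {P : Y → Prop} (h : ∀ᶠ q in 𝓝 p, P q) :
    ∀ᶠ z in 𝓝 (e p), z ∈ e.target ∧ P (e.symm z) := by
  refine Filter.Eventually.and (e.open_target.mem_nhds (e.map_source hp)) ?_
  have := e.continuousAt_symm (e.map_source hp)
  rw [ContinuousAt, e.left_inv hp] at this
  exact this.eventually h

/-- Two holomorphic coordinates differ by a transition map whose derivative is the multiplication
by a complex number. -/
theorem IsHolCoord.exists_transition {e e' : OpenPartialHomeomorph X ℂ} (he : IsHolCoord e)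
    (he' : IsHolCoord e') {p : X} (hp : p ∈ e.source) (hp' : p ∈ e'.source) :
    ∃ c : ℂ, ∀ {F : Type} [NormedAddCommGroup F] [NormedSpace ℝ F] (f : X → F) (L : ℂ →L[ℝ] F),
      HasFDerivAt (fun z => f (e'.symm z)) L (e' p) →
      HasFDerivAt (fun z => f (e.symm z)) (L ∘L ContinuousLinearMap.mul ℝ ℂ c) (e p) := by
  have h1 : e.symm.trans e' ∈ contDiffGroupoid ω 𝓘(ℂ) :=
    StructureGroupoid.compatible_of_mem_maximalAtlas he he'
  have h2 : ContDiffOn ℂ ω (e.symm.trans e') (e.symm.trans e').source := by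
    simpa [contDiffPregroupoid] using (mem_groupoid_of_pregroupoid.1 h1).1
  have hmem : e p ∈ (e.symm.trans e').source := by
    simp [hp, hp']
  have h3 : HasDerivAt (e.symm.trans e') (deriv (e.symm.trans e') (e p)) (e p) :=
    ((h2.contDiffAt ((e.symm.trans e').open_source.mem_nhds hmem)).differentiableAt
      (by simp)).hasDerivAt
  refine ⟨deriv (e.symm.trans e') (e p), fun {F} _ _ f L hf => ?_⟩
  have h4 : HasFDerivAt (e.symm.trans e')
      (ContinuousLinearMap.mul ℝ ℂ (deriv (e.symm.trans e') (e p))) (e p) := by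
    have := h3.hasFDerivAt.restrictScalars ℝ
    refine this.congr_fderiv ?_
    ext x
    simp [mul_comm x]
  have h5 : (e.symm.trans e') (e p) = e' p := by simp [hp]
  rw [← h5] at hf
  refine (hf.comp (e p) h4).congr_of_eventuallyEq ?_
  filter_upwards [(e.symm.trans e').open_source.mem_nhds hmem] with z hz
  simp only [OpenPartialHomeomorph.trans_source, OpenPartialHomeomorph.symm_source, mem_inter_iff,
    mem_preimage] at hz
  simp [e'.left_inv hz.2]

end RealStructure

/-! ### Quaternions and oriented triples -/

section QuaternionAlgebra

/-- The determinant of the imaginary parts of three quaternions. -/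
def imTriple (P Q n : ℍ[ℝ]) : ℝ := crossProduct (imVec P) (imVec Q) ⬝ᵥ imVec n

theorem imTriple_eq (P Q n : ℍ[ℝ]) :
    imTriple P Q n = (P.imJ * Q.imK - P.imK * Q.imJ) * n.imI +
      (P.imK * Q.imI - P.imI * Q.imK) * n.imJ + (P.imI * Q.imJ - P.imJ * Q.imI) * n.imK := by
  simp [imTriple, imVec, crossProduct, dotProduct, Fin.sum_univ_three]

theorem Quaternion.inner_eq_sum (a b : ℍ[ℝ]) :
    inner ℝ a b = a.re * b.re + a.imI * b.imI + a.imJ * b.imJ + a.imK * b.imK := by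
  rw [Quaternion.inner_def]
  simp

theorem Quaternion.sum_sq_eq_one {n : ℍ[ℝ]} (hn : ‖n‖ = 1) :
    n.re ^ 2 + n.imI ^ 2 + n.imJ ^ 2 + n.imK ^ 2 = 1 := by
  have := Quaternion.normSq_eq_norm_mul_self n
  rw [hn, Quaternion.normSq_def'] at this
  linarith

theorem Quaternion.norm_eq_one_of_sum_sq {n : ℍ[ℝ]}
    (hn : n.re ^ 2 + n.imI ^ 2 + n.imJ ^ 2 + n.imK ^ 2 = 1) : ‖n‖ = 1 := by
  have := Quaternion.normSq_eq_norm_mul_self n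
  rw [Quaternion.normSq_def', hn] at this
  nlinarith [norm_nonneg n]

theorem mul_self_eq_neg_one {n : ℍ[ℝ]} (hn : ‖n‖ = 1) (h0 : n.re = 0) : n * n = -1 := by
  have := Quaternion.sum_sq_eq_one hn
  rw [h0] at this
  ext <;> simp [h0] <;> linarith

theorem star_mul_self_of_norm {q : ℍ[ℝ]} (h : ‖q‖ = 1) : star q * q = 1 := by
  rw [Quaternion.star_mul_self, Quaternion.normSq_eq_norm_mul_self, h]; simp

theorem mul_star_self_of_norm {q : ℍ[ℝ]} (h : ‖q‖ = 1) : q * star q = 1 := by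
  rw [Quaternion.self_mul_star, Quaternion.normSq_eq_norm_mul_self, h]; simp

theorem inv_eq_star_of_norm {q : ℍ[ℝ]} (h : ‖q‖ = 1) : q⁻¹ = star q :=
  inv_eq_of_mul_eq_one_left (star_mul_self_of_norm h)

/-- For imaginary quaternions, `Pn + nP = -2⟨n, P⟩`. -/
theorem anticommute_of_inner {n P : ℍ[ℝ]} (hn : n.re = 0) (hP : P.re = 0)
    (h : inner ℝ n P = 0) : P * n = -(n * P) := by
  rw [Quaternion.inner_eq_sum, hn, hP] at h
  ext <;> simp [hn, hP] <;> linarith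

theorem inner_mul_left_of_norm {q : ℍ[ℝ]} (hq : ‖q‖ = 1) (a b : ℍ[ℝ]) :
    inner ℝ (q * a) (q * b) = inner ℝ a b := by
  have := Quaternion.sum_sq_eq_one hq
  simp only [Quaternion.inner_eq_sum, Quaternion.re_mul, Quaternion.imI_mul, Quaternion.imJ_mul,
    Quaternion.imK_mul]
  linear_combination (a.re * b.re + a.imI * b.imI + a.imJ * b.imJ + a.imK * b.imK) * this

theorem re_star_mul (a b : ℍ[ℝ]) : (star a * b).re = inner ℝ a b := by
  simp only [Quaternion.inner_eq_sum, Quaternion.re_mul,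
    Quaternion.re_star, Quaternion.imI_star, Quaternion.imJ_star, Quaternion.imK_star]
  ring

/-- The data of a surface at a point, after left translation to the identity: unit normal `n`,
tangent vectors `P, Q`, spanning the orthogonal complement of `n` positively. -/
structure OrientedTriple (n P Q : ℍ[ℝ]) : Prop where
  n_re : n.re = 0
  n_norm : ‖n‖ = 1
  P_re : P.re = 0
  Q_re : Q.re = 0
  nP : inner ℝ n P = 0
  nQ : inner ℝ n Q = 0
  pos : 0 < imTriple P Q n

/-- Positivity of the determinant makes `n, P, Q` a basis of the imaginary quaternions. The
multipliers below are the cross products of Cramer's rule. -/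
theorem eq_zero_of_inner_eq_zero {n P Q X : ℍ[ℝ]} (h : OrientedTriple n P Q) (hX : X.re = 0)
    (h1 : inner ℝ n X = 0) (h2 : inner ℝ P X = 0) (h3 : inner ℝ Q X = 0) : X = 0 := by
  have hpos := h.pos
  rw [Quaternion.inner_eq_sum, hX] at h1 h2 h3
  rw [imTriple_eq] at hpos
  have hne := hpos.ne'
  ext
  · exact hX
  · refine mul_left_cancel₀ hne ?_
    simp only [Quaternion.imI_zero]
    linear_combination (Q.imJ * n.imK - Q.imK * n.imJ) * h2 +
      (n.imJ * P.imK - n.imK * P.imJ) * h3 + (P.imJ * Q.imK - P.imK * Q.imJ) * h1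
  · refine mul_left_cancel₀ hne ?_
    simp only [Quaternion.imJ_zero]
    linear_combination (Q.imK * n.imI - Q.imI * n.imK) * h2 +
      (n.imK * P.imI - n.imI * P.imK) * h3 + (P.imK * Q.imI - P.imI * Q.imK) * h1
  · refine mul_left_cancel₀ hne ?_
    simp only [Quaternion.imK_zero]
    linear_combination (Q.imI * n.imJ - Q.imJ * n.imI) * h2 +
      (n.imI * P.imJ - n.imJ * P.imI) * h3 + (P.imI * Q.imJ - P.imJ * Q.imI) * h1

theorem re_mul_of_inner {n P : ℍ[ℝ]} (hn : n.re = 0) (h : inner ℝ n P = 0) : (n * P).re = 0 := by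
  rw [Quaternion.inner_eq_sum, hn] at h
  rw [Quaternion.re_mul, hn]; linarith

theorem inner_self_mul {n : ℍ[ℝ]} (P : ℍ[ℝ]) (hn : n.re = 0) (hP : P.re = 0) :
    inner ℝ n (n * P) = 0 := by
  simp only [Quaternion.inner_eq_sum, Quaternion.re_mul, Quaternion.imI_mul, Quaternion.imJ_mul,
    Quaternion.imK_mul, hn, hP]
  ring

theorem inner_mul_self {n : ℍ[ℝ]} (P : ℍ[ℝ]) (hn : n.re = 0) (hP : P.re = 0) :
    inner ℝ P (n * P) = 0 := by
  simp only [Quaternion.inner_eq_sum, Quaternion.re_mul, Quaternion.imI_mul, Quaternion.imJ_mul,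
    Quaternion.imK_mul, hn, hP]
  ring

/-- The imaginary part of a product of imaginary quaternions is their cross product, so this is the
scalar triple product up to a cyclic permutation. -/
theorem inner_mul_eq_imTriple {n P Q : ℍ[ℝ]} (hn : n.re = 0) (hP : P.re = 0) (hQ : Q.re = 0) :
    inner ℝ Q (n * P) = imTriple P Q n := by
  simp only [Quaternion.inner_eq_sum, Quaternion.re_mul, Quaternion.imI_mul, Quaternion.imJ_mul,
    Quaternion.imK_mul, hn, hP, hQ, imTriple_eq]
  ring

theorem inner_mul_eq_neg_imTriple {n P Q : ℍ[ℝ]} (hn : n.re = 0) (hP : P.re = 0)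
    (hQ : Q.re = 0) : inner ℝ P (n * Q) = -imTriple P Q n := by
  simp only [Quaternion.inner_eq_sum, Quaternion.re_mul, Quaternion.imI_mul, Quaternion.imJ_mul,
    Quaternion.imK_mul, hn, hP, hQ, imTriple_eq]
  ring

/-- If the second fundamental form is conformal, the derivative of the Gauss map is determined by
the tangent vectors and a positive number `s`. -/
theorem structure_eq_of_conformal {n P Q u v : ℍ[ℝ]} {ρ : ℝ} (h : OrientedTriple n P Q)
    (hu : u.re = 0) (hv : v.re = 0) (hnu : inner ℝ n u = 0) (hnv : inner ℝ n v = 0)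
    (h11 : inner ℝ (-(u + P * n)) P = 2 * ρ) (h12 : inner ℝ (-(u + P * n)) Q = 0)
    (h21 : inner ℝ (-(v + Q * n)) P = 0) (h22 : inner ℝ (-(v + Q * n)) Q = 2 * ρ) :
    u = n * (P + (2 * ρ / imTriple P Q n) • Q) ∧ v = n * (Q - (2 * ρ / imTriple P Q n) • P) := by
  have hδ := h.pos.ne'
  -- The value is forced: `n P` is orthogonal to `P`, and `n Q` pairs with `P` to minus the
  -- determinant.
  set s := 2 * ρ / imTriple P Q n with hs
  have hsδ : s * imTriple P Q n = 2 * ρ := by rw [hs]; field_simp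
  have hP := anticommute_of_inner h.n_re h.P_re h.nP
  have hQ := anticommute_of_inner h.n_re h.Q_re h.nQ
  rw [hP, inner_neg_left, real_inner_comm, inner_add_right, inner_neg_right] at h11 h12
  rw [hQ, inner_neg_left, real_inner_comm, inner_add_right, inner_neg_right] at h21 h22
  rw [inner_mul_self P h.n_re h.P_re] at h11
  rw [inner_mul_self Q h.n_re h.Q_re] at h22
  rw [inner_mul_eq_imTriple h.n_re h.P_re h.Q_re] at h12
  rw [inner_mul_eq_neg_imTriple h.n_re h.P_re h.Q_re] at h21
  constructor
  · rw [← sub_eq_zero]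
    refine eq_zero_of_inner_eq_zero h ?_ ?_ ?_ ?_
    · rw [Quaternion.re_sub, hu, mul_add, Quaternion.re_add, mul_smul_comm, Quaternion.re_smul,
        re_mul_of_inner h.n_re h.nP, re_mul_of_inner h.n_re h.nQ]
      simp
    · rw [inner_sub_right, hnu, inner_self_mul _ h.n_re (by simp [h.P_re, h.Q_re]), sub_zero]
    · rw [inner_sub_right, mul_add, inner_add_right, mul_smul_comm, inner_smul_right,
        inner_mul_self P h.n_re h.P_re, inner_mul_eq_neg_imTriple h.n_re h.P_re h.Q_re]
      linarith
    · rw [inner_sub_right, mul_add, inner_add_right, mul_smul_comm, inner_smul_right,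
        inner_mul_self Q h.n_re h.Q_re, inner_mul_eq_imTriple h.n_re h.P_re h.Q_re]
      linarith
  · rw [← sub_eq_zero]
    refine eq_zero_of_inner_eq_zero h ?_ ?_ ?_ ?_
    · rw [Quaternion.re_sub, hv, mul_sub, Quaternion.re_sub, mul_smul_comm, Quaternion.re_smul,
        re_mul_of_inner h.n_re h.nP, re_mul_of_inner h.n_re h.nQ]
      simp
    · rw [inner_sub_right, hnv, inner_self_mul _ h.n_re (by simp [h.P_re, h.Q_re]), sub_zero]
    · rw [inner_sub_right, mul_sub, inner_sub_right, mul_smul_comm, inner_smul_right,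
        inner_mul_self P h.n_re h.P_re, inner_mul_eq_neg_imTriple h.n_re h.P_re h.Q_re]
      linarith
    · rw [inner_sub_right, mul_sub, inner_sub_right, mul_smul_comm, inner_smul_right,
        inner_mul_self Q h.n_re h.Q_re, inner_mul_eq_imTriple h.n_re h.P_re h.Q_re]
      linarith

/-- Multiplication by `n` acts as a rotation about `n` on the part of a vector orthogonal to `n`,
the only part that counts here, and `(P + sQ, Q - sP)` has determinant `1 + s²` relative to `(P,
Q)`. This links the orientation of the surface to that of its Gauss map. -/
theorem imTriple_rotate {n P Q : ℍ[ℝ]} (s : ℝ) (hn0 : n.re = 0) (hn : ‖n‖ = 1) (hP : P.re = 0)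
    (hQ : Q.re = 0) :
    imTriple n (n * (P + s • Q)) (n * (Q - s • P)) = (1 + s ^ 2) * imTriple P Q n := by
  have h1 := Quaternion.sum_sq_eq_one hn
  simp only [imTriple_eq, Quaternion.imI_mul, Quaternion.imJ_mul,
    Quaternion.imK_mul, Quaternion.re_add, Quaternion.imI_add, Quaternion.imJ_add,
    Quaternion.imK_add, Quaternion.re_sub, Quaternion.imI_sub, Quaternion.imJ_sub,
    Quaternion.imK_sub, Quaternion.re_smul, Quaternion.imI_smul, Quaternion.imJ_smul,
    Quaternion.imK_smul, hn0, hP, hQ, smul_eq_mul] at *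
  linear_combination ((1 + s ^ 2) * ((P.imJ * Q.imK - P.imK * Q.imJ) * n.imI +
      (P.imK * Q.imI - P.imI * Q.imK) * n.imJ + (P.imI * Q.imJ - P.imJ * Q.imI) * n.imK)) * h1

end QuaternionAlgebra

/-! ### Solving the structure equation for the connection form -/

section Coefficients

/-- The coefficients of the connection form of a surface in terms of `s = √K`. -/
def connA (s : ℝ) : ℝ := -1 / (1 + s ^ 2)

/-- The coefficients of the connection form of a surface in terms of `s = √K`. -/
def connB (s : ℝ) : ℝ := s / (1 + s ^ 2)

/-- With `connB_add`, this says `(a + bJ)(1 + sJ) = -1` when `J² = -1`; the sign is that of `n² =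
-1`. -/
theorem connA_sub (s : ℝ) : connA s - s * connB s = -1 := by
  have : (1 + s ^ 2) ≠ 0 := by positivity
  rw [connA, connB]; field_simp; ring

theorem connB_add (s : ℝ) : connB s + s * connA s = 0 := by
  rw [connA, connB]; ring

/-- This relation makes the commutator of `n_x` and `n_y` drop out of the curvature. -/
theorem connA_sq_add (s : ℝ) : connA s ^ 2 + connB s ^ 2 = -connA s := by
  have : (1 + s ^ 2) ≠ 0 := by positivity
  rw [connA, connB]; field_simp

theorem hasDerivAt_connA (s : ℝ) : HasDerivAt connA (2 * s / (1 + s ^ 2) ^ 2) s := by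
  have h : (1 + s ^ 2) ≠ 0 := by positivity
  refine ((hasDerivAt_const s (-1 : ℝ)).div (((hasDerivAt_id s).pow 2).const_add 1) h).congr_deriv ?_
  simp

theorem hasDerivAt_connB (s : ℝ) : HasDerivAt connB ((1 - s ^ 2) / (1 + s ^ 2) ^ 2) s := by
  have h : (1 + s ^ 2) ≠ 0 := by positivity
  refine ((hasDerivAt_id s).div (((hasDerivAt_id s).pow 2).const_add 1) h).congr_deriv ?_
  simp; ring

theorem contDiff_connA {n : WithTop ℕ∞} : ContDiff ℝ n connA :=
  contDiff_const.div (contDiff_const.add (contDiff_id.pow 2)) fun s => by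
    have : (0 : ℝ) < 1 + s ^ 2 := by positivity
    exact this.ne'

theorem contDiff_connB {n : WithTop ℕ∞} : ContDiff ℝ n connB :=
  contDiff_id.div (contDiff_const.add (contDiff_id.pow 2)) fun s => by
    have : (0 : ℝ) < 1 + s ^ 2 := by positivity
    exact this.ne'

/-- This and `structure_eq_of_conn` are the two directions of the inversion between `dn = n(α + s
α∘J)` and `α = n(a dn + b dn∘J)`. -/
theorem mul_conn_eq {n P Q : ℍ[ℝ]} (hn : n * n = -1) (s : ℝ) :
    n * (connA s • (n * (P + s • Q)) + connB s • (n * (Q - s • P))) = P ∧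
      n * (connA s • (n * (Q - s • P)) - connB s • (n * (P + s • Q))) = Q := by
  have h1 := connA_sub s
  have h2 := connB_add s
  constructor
  · have : n * (connA s • (n * (P + s • Q)) + connB s • (n * (Q - s • P))) =
        (n * n) * ((connA s - s * connB s) • P + (connB s + s * connA s) • Q) := by
      simp only [← mul_smul_comm, ← mul_add, mul_assoc]
      congr 2; module
    rw [this, h1, h2, hn]; simp
  · have : n * (connA s • (n * (Q - s • P)) - connB s • (n * (P + s • Q))) =
        (n * n) * ((connA s - s * connB s) • Q - (connB s + s * connA s) • P) := by
      simp only [← mul_smul_comm, ← mul_sub, mul_assoc]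
      congr 2; module
    rw [this, h1, h2, hn]; simp

theorem structure_eq_of_conn {n u v : ℍ[ℝ]} (hn : n * n = -1) (s : ℝ) :
    u = n * (n * (connA s • u + connB s • v) + s • (n * (connA s • v - connB s • u))) ∧
      v = n * (n * (connA s • v - connB s • u) - s • (n * (connA s • u + connB s • v))) := by
  have h1 := connA_sub s
  have h2 := connB_add s
  constructor
  · have : n * (n * (connA s • u + connB s • v) + s • (n * (connA s • v - connB s • u))) =
        (n * n) * ((connA s - s * connB s) • u + (connB s + s * connA s) • v) := by
      simp only [← mul_smul_comm, ← mul_add, mul_assoc]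
      congr 2; module
    rw [this, h1, h2, hn]; simp
  · have : n * (n * (connA s • v - connB s • u) - s • (n * (connA s • u + connB s • v))) =
        (n * n) * ((connA s - s * connB s) • v - (connB s + s * connA s) • u) := by
      simp only [← mul_smul_comm, ← mul_sub, mul_assoc]
      congr 2; module
    rw [this, h1, h2, hn]; simp

end Coefficients

/-! ### Curvature of the connection form -/

section Curvature

theorem contDiffAt_mul_comp_comb {V H : Type*} [NormedAddCommGroup V] [NormedSpace ℝ V]
    [NormedRing H] [NormedAlgebra ℝ H] {n : WithTop ℕ∞} {m : V → H} {a b : V → ℝ}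
    {L : V → V →L[ℝ] H} {J : V →L[ℝ] V} {z : V} (hm : ContDiffAt ℝ n m z)
    (ha : ContDiffAt ℝ n a z) (hb : ContDiffAt ℝ n b z) (hL : ContDiffAt ℝ n L z) :
    ContDiffAt ℝ n
      (fun z => ContinuousLinearMap.mul ℝ H (m z) ∘L (a z • L z + b z • (L z ∘L J))) z := by
  have hM : ContDiffAt ℝ n (fun z => ContinuousLinearMap.mul ℝ H (m z)) z :=
    (ContinuousLinearMap.mul ℝ H).contDiff.contDiffAt.comp z hm
  exact hM.clm_comp ((ha.smul hL).add (hb.smul (hL.clm_comp contDiffAt_const)))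

open Complex (I)

variable (m : ℂ → ℍ[ℝ]) (s : ℂ → ℝ)

/-- The connection form `n (a dn + b dn ∘ J)` determined by the Gauss map and `s = √K`. -/
def frameForm (z : ℂ) : ℂ →L[ℝ] ℍ[ℝ] :=
  ContinuousLinearMap.mul ℝ ℍ[ℝ] (m z) ∘L
    (connA (s z) • fderiv ℝ m z +
      connB (s z) • (fderiv ℝ m z ∘L ContinuousLinearMap.mul ℝ ℂ I))

theorem frameForm_apply (z v : ℂ) : frameForm m s z v =
    m z * (connA (s z) • fderiv ℝ m z v + connB (s z) • fderiv ℝ m z (I * v)) := rfl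

/-- The obstruction to the flatness of the connection form. -/
def flatDefect (z : ℂ) : ℍ[ℝ] :=
  (2 * s z / (1 + s z ^ 2) ^ 2 * fderiv ℝ s z I +
      (1 - s z ^ 2) / (1 + s z ^ 2) ^ 2 * fderiv ℝ s z 1) • fderiv ℝ m z 1 +
    ((1 - s z ^ 2) / (1 + s z ^ 2) ^ 2 * fderiv ℝ s z I -
      2 * s z / (1 + s z ^ 2) ^ 2 * fderiv ℝ s z 1) • fderiv ℝ m z I +
    connB (s z) • (fderiv ℝ (fderiv ℝ m) z 1 1 + fderiv ℝ (fderiv ℝ m) z I I -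
      m z * (fderiv ℝ m z 1 * fderiv ℝ m z 1 + fderiv ℝ m z I * fderiv ℝ m z I))

variable {m s}

theorem contDiffAt_frameForm {z : ℂ} (hm : ContDiffAt ℝ ∞ m z) (hs : ContDiffAt ℝ ∞ s z) :
    ContDiffAt ℝ ∞ (frameForm m s) z := by
  have h1 : ContDiffAt ℝ ∞ (fderiv ℝ m) z := hm.fderiv_right (by simp)
  have ha : ContDiffAt ℝ ∞ (fun z => connA (s z)) z := contDiff_connA.contDiffAt.comp z hs
  have hb : ContDiffAt ℝ ∞ (fun z => connB (s z)) z := contDiff_connB.contDiffAt.comp z hs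
  exact contDiffAt_mul_comp_comb hm ha hb h1

theorem fderiv_frameForm {z : ℂ} (hm : ContDiffAt ℝ ∞ m z) (hs : ContDiffAt ℝ ∞ s z) (u v : ℂ) :
    fderiv ℝ (frameForm m s) z u v =
      fderiv ℝ m z u * (connA (s z) • fderiv ℝ m z v + connB (s z) • fderiv ℝ m z (I * v)) +
      m z * ((2 * s z / (1 + s z ^ 2) ^ 2 * fderiv ℝ s z u) • fderiv ℝ m z v +
        connA (s z) • fderiv ℝ (fderiv ℝ m) z u v +
        ((1 - s z ^ 2) / (1 + s z ^ 2) ^ 2 * fderiv ℝ s z u) • fderiv ℝ m z (I * v) +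
        connB (s z) • fderiv ℝ (fderiv ℝ m) z u (I * v)) := by
  have h0 : HasFDerivAt (frameForm m s) (fderiv ℝ (frameForm m s) z) z :=
    ((contDiffAt_frameForm hm hs).differentiableAt (by simp)).hasFDerivAt
  have h1 : HasFDerivAt (fun z => frameForm m s z v) _ z :=
    h0.clm_apply (hasFDerivAt_const v z)
  have hmd : HasFDerivAt m (fderiv ℝ m z) z := (hm.differentiableAt (by simp)).hasFDerivAt
  have hsd : HasFDerivAt s (fderiv ℝ s z) z := (hs.differentiableAt (by simp)).hasFDerivAt
  have hdm : HasFDerivAt (fderiv ℝ m) (fderiv ℝ (fderiv ℝ m) z) z :=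
    ((hm.fderiv_right (m := ∞) (by simp)).differentiableAt (by simp)).hasFDerivAt
  have ha := (hasDerivAt_connA (s z)).comp_hasFDerivAt z hsd
  have hb := (hasDerivAt_connB (s z)).comp_hasFDerivAt z hsd
  have h2 := hmd.mul' ((ha.smul (hdm.clm_apply (hasFDerivAt_const v z))).add
    (hb.smul (hdm.clm_apply (hasFDerivAt_const (I * v) z))))
  have h3 := congr_arg (fun L : ℂ →L[ℝ] ℍ[ℝ] => L u) (h1.unique h2)
  simp at h3
  rw [h3]
  simp only [mul_add, mul_smul_comm]
  abel

/-- The curvature of the connection form. -/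
theorem curvature_frameForm {z : ℂ} (hm : ContDiffAt ℝ ∞ m z) (hs : ContDiffAt ℝ ∞ s z)
    (hmm : m z * m z = -1) (hac : ∀ v, fderiv ℝ m z v * m z = -(m z * fderiv ℝ m z v)) :
    (fderiv ℝ (frameForm m s) z 1 I + frameForm m s z 1 * frameForm m s z I) -
      (fderiv ℝ (frameForm m s) z I 1 + frameForm m s z I * frameForm m s z 1) =
      -(m z * flatDefect m s z) := by
  have hsymm : fderiv ℝ (fderiv ℝ m) z 1 I = fderiv ℝ (fderiv ℝ m) z I 1 :=
    (hm.isSymmSndFDerivAt (by simpa using ENat.LEInfty.out)).eq 1 I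
  rw [fderiv_frameForm hm hs, fderiv_frameForm hm hs]
  simp only [frameForm_apply, flatDefect, mul_one, Complex.I_mul_I, map_neg]
  have hX := hac 1
  have hY := hac I
  have hab := connA_sq_add (s z)
  set n := m z
  set X := fderiv ℝ m z 1
  set Y := fderiv ℝ m z I
  set xx := fderiv ℝ (fderiv ℝ m) z 1 1
  set yy := fderiv ℝ (fderiv ℝ m) z I I
  rw [hsymm]
  set xy := fderiv ℝ (fderiv ℝ m) z I 1
  set a := connA (s z)
  set b := connB (s z)
  -- Moving `n` past `A` costs a sign, which `n² = -1` restores; hence the quadratic term of the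
  -- curvature no longer involves `n`.
  have e0 : ∀ A B : ℍ[ℝ], A * n = -(n * A) → n * A * (n * B) = A * B := by
    intro A B hA
    calc n * A * (n * B) = n * (A * n) * B := by noncomm_ring
      _ = -((n * n) * A * B) := by rw [hA]; noncomm_ring
      _ = A * B := by rw [hmm]; simp
  have e1 : (a • X + b • Y) * n = -(n * (a • X + b • Y)) := by
    rw [add_mul, smul_mul_assoc, smul_mul_assoc, hX, hY]
    simp only [mul_add, mul_smul_comm, smul_neg]; abel
  have e2 : (a • Y + b • -X) * n = -(n * (a • Y + b • -X)) := by
    rw [add_mul, smul_mul_assoc, smul_mul_assoc, neg_mul, hX, hY]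
    simp only [mul_add, mul_smul_comm, smul_neg, mul_neg]; abel
  rw [e0 _ _ e1, e0 _ _ e2]
  have e3 : (a • X + b • Y) * (a • Y + b • -X) - (a • Y + b • -X) * (a • X + b • Y) =
      (a ^ 2 + b ^ 2) • (X * Y - Y * X) := by
    simp only [add_mul, mul_add, smul_mul_smul_comm, mul_neg, neg_mul, smul_neg, smul_sub]
    module
  have e4 : ∀ W : ℍ[ℝ], n * (n * W) = -W := fun W => by rw [← mul_assoc, hmm]; simp
  -- Now the quadratic term is `-a(XY - YX)`, cancelling the commutator produced by differentiating
  -- the factor `n`.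
  rw [hab] at e3
  rw [← sub_eq_zero] at e3 ⊢
  simp only [mul_add, mul_sub, mul_smul_comm, mul_neg, smul_neg, e4, smul_add, smul_sub,
    smul_mul_assoc, neg_mul, add_mul] at e3 ⊢
  rw [← e3]
  module

/-- The curvature is an alternating form on a real plane, so the pair `(1, I)` decides, and `n` is
invertible. -/
theorem flat_iff_flatDefect {z : ℂ} (hm : ContDiffAt ℝ ∞ m z) (hs : ContDiffAt ℝ ∞ s z)
    (hmm : m z * m z = -1) (hac : ∀ v, fderiv ℝ m z v * m z = -(m z * fderiv ℝ m z v)) :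
    (∀ u v, fderiv ℝ (frameForm m s) z u v + frameForm m s z u * frameForm m s z v =
      fderiv ℝ (frameForm m s) z v u + frameForm m s z v * frameForm m s z u) ↔
      flatDefect m s z = 0 := by
  have hc := curvature_frameForm hm hs hmm hac
  constructor
  · intro h
    rw [h, sub_self] at hc
    have : m z * (m z * flatDefect m s z) = 0 := by
      rw [← neg_eq_zero, ← mul_neg, ← hc, mul_zero]
    rw [← mul_assoc, hmm] at this
    simpa using this
  · intro h u v
    rw [h, mul_zero, neg_zero, sub_eq_zero] at hc
    have hu : u = u.re • (1 : ℂ) + u.im • I := by simp [Complex.re_add_im]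
    have hv : v = v.re • (1 : ℂ) + v.im • I := by simp [Complex.re_add_im]
    generalize fderiv ℝ (frameForm m s) z = D at *
    generalize frameForm m s z = A at *
    rw [hu, hv]
    simp only [map_add, map_smul, add_apply, smul_apply, mul_add, add_mul, smul_mul_smul_comm,
      smul_add]
    have hc' : D 1 I = D I 1 + A I * A 1 - A 1 * A I := by rw [← hc]; abel
    rw [hc']
    module

end Curvature

/-! ### Stereographic coordinates on the sphere of imaginary units -/

section Stereographic

open Complex (I)
open Filter Topology

/-- The inverse of the stereographic projection from the north pole, for `ε = 1`, and its
composition with `w ↦ 1 / w`, for `ε = -1`. -/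
def sigmaMap (ε : ℝ) (w : ℂ) : ℍ[ℝ] :=
  ⟨0, 2 * w.re / (1 + w.re ^ 2 + w.im ^ 2), ε * (2 * w.im / (1 + w.re ^ 2 + w.im ^ 2)),
    ε * (1 - 2 / (1 + w.re ^ 2 + w.im ^ 2))⟩

/-- The differential of `sigmaMap`. -/
def dSigma (ε : ℝ) (w v : ℂ) : ℍ[ℝ] :=
  ⟨0, 2 * v.re / (1 + w.re ^ 2 + w.im ^ 2) -
      2 * w.re * (2 * (w.re * v.re + w.im * v.im)) / (1 + w.re ^ 2 + w.im ^ 2) ^ 2,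
    ε * (2 * v.im / (1 + w.re ^ 2 + w.im ^ 2) -
      2 * w.im * (2 * (w.re * v.re + w.im * v.im)) / (1 + w.re ^ 2 + w.im ^ 2) ^ 2),
    ε * (2 * (2 * (w.re * v.re + w.im * v.im)) / (1 + w.re ^ 2 + w.im ^ 2) ^ 2)⟩

theorem sigmaMap_re (ε : ℝ) (w : ℂ) : (sigmaMap ε w).re = 0 := rfl

theorem sigmaMap_imI (ε : ℝ) (w : ℂ) :
    (sigmaMap ε w).imI = 2 * w.re / (1 + w.re ^ 2 + w.im ^ 2) := rfl

theorem sigmaMap_imJ (ε : ℝ) (w : ℂ) :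
    (sigmaMap ε w).imJ = ε * (2 * w.im / (1 + w.re ^ 2 + w.im ^ 2)) := rfl

theorem sigmaMap_imK (ε : ℝ) (w : ℂ) :
    (sigmaMap ε w).imK = ε * (1 - 2 / (1 + w.re ^ 2 + w.im ^ 2)) := rfl

theorem dSigma_re (ε : ℝ) (w v : ℂ) : (dSigma ε w v).re = 0 := rfl

theorem dSigma_imI (ε : ℝ) (w v : ℂ) : (dSigma ε w v).imI =
    2 * v.re / (1 + w.re ^ 2 + w.im ^ 2) -
      2 * w.re * (2 * (w.re * v.re + w.im * v.im)) / (1 + w.re ^ 2 + w.im ^ 2) ^ 2 := rfl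

theorem dSigma_imJ (ε : ℝ) (w v : ℂ) : (dSigma ε w v).imJ =
    ε * (2 * v.im / (1 + w.re ^ 2 + w.im ^ 2) -
      2 * w.im * (2 * (w.re * v.re + w.im * v.im)) / (1 + w.re ^ 2 + w.im ^ 2) ^ 2) := rfl

theorem dSigma_imK (ε : ℝ) (w v : ℂ) : (dSigma ε w v).imK =
    ε * (2 * (2 * (w.re * v.re + w.im * v.im)) / (1 + w.re ^ 2 + w.im ^ 2) ^ 2) := rfl

theorem dSigma_add (ε : ℝ) (w u v : ℂ) : dSigma ε w (u + v) = dSigma ε w u + dSigma ε w v := by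
  ext <;> simp only [Quaternion.re_add, Quaternion.imI_add, Quaternion.imJ_add,
    Quaternion.imK_add, Complex.add_re, Complex.add_im, dSigma_re, dSigma_imI, dSigma_imJ,
    dSigma_imK] <;> ring

theorem dSigma_smul (ε : ℝ) (w : ℂ) (c : ℝ) (v : ℂ) : dSigma ε w (c • v) = c • dSigma ε w v := by
  ext <;> simp only [Quaternion.re_smul, Quaternion.imI_smul, Quaternion.imJ_smul,
    Quaternion.imK_smul, Complex.smul_re, Complex.smul_im, smul_eq_mul, dSigma_re, dSigma_imI, dSigma_imJ,
    dSigma_imK] <;> ring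

theorem norm_sigmaMap {ε : ℝ} (hε : ε ^ 2 = 1) (w : ℂ) : ‖sigmaMap ε w‖ = 1 := by
  apply Quaternion.norm_eq_one_of_sum_sq
  have h : 1 + w.re ^ 2 + w.im ^ 2 ≠ 0 := by positivity
  simp only [sigmaMap_re, sigmaMap_imI, sigmaMap_imJ, sigmaMap_imK, mul_pow, hε]
  field_simp
  ring

/-- Stereographic projection is conformal with factor `2/(1+|w|²)`, and the square of an imaginary
quaternion is minus its squared norm. -/
theorem dSigma_mul_self {ε : ℝ} (hε : ε ^ 2 = 1) (w v : ℂ) :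
    dSigma ε w v * dSigma ε w v =
      ((-(4 * (v.re ^ 2 + v.im ^ 2) / (1 + w.re ^ 2 + w.im ^ 2) ^ 2) : ℝ) : ℍ[ℝ]) := by
  have h : 1 + w.re ^ 2 + w.im ^ 2 ≠ 0 := by positivity
  have key : (dSigma ε w v).imI ^ 2 + (dSigma ε w v).imJ ^ 2 + (dSigma ε w v).imK ^ 2 =
      4 * (v.re ^ 2 + v.im ^ 2) / (1 + w.re ^ 2 + w.im ^ 2) ^ 2 := by
    simp only [dSigma_imI, dSigma_imJ, dSigma_imK, mul_pow, hε]
    field_simp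
    ring
  have h0 : (dSigma ε w v).re = 0 := rfl
  ext
  · simp only [Quaternion.re_mul, Quaternion.re_coe, h0]; linarith
  · simp only [Quaternion.imI_mul, Quaternion.imI_coe, h0]; ring
  · simp only [Quaternion.imJ_mul, Quaternion.imJ_coe, h0]; ring
  · simp only [Quaternion.imK_mul, Quaternion.imK_coe, h0]; ring

theorem dSigma_eq_zero {ε : ℝ} (hε : ε ^ 2 = 1) {w v : ℂ} (h : dSigma ε w v = 0) : v = 0 := by
  have h1 := dSigma_mul_self hε w v
  rw [h, mul_zero] at h1
  have h2 := congr_arg (fun q : ℍ[ℝ] => q.re) h1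
  have h3 : (1 + w.re ^ 2 + w.im ^ 2) ≠ 0 := by positivity
  simp only [Quaternion.re_zero, Quaternion.re_coe] at h2
  field_simp at h2
  have h4 : v.re ^ 2 + v.im ^ 2 = 0 := by linarith
  apply Complex.ext
  · simp only [Complex.zero_re]; nlinarith [sq_nonneg v.re, sq_nonneg v.im]
  · simp only [Complex.zero_im]; nlinarith [sq_nonneg v.re, sq_nonneg v.im]

/-- The minus sign is the orientation reversal of projection from the north pole; it is the reason
why (1) asks for a negative Jacobian. The sign `ε` does not matter, since `w ↦ 1/w` is holomorphic.
-/
theorem imTriple_sigmaMap {ε : ℝ} (hε : ε ^ 2 = 1) (w u v : ℂ) :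
    imTriple (sigmaMap ε w) (dSigma ε w u) (dSigma ε w v) =
      4 / (1 + w.re ^ 2 + w.im ^ 2) ^ 2 * -(u.re * v.im - u.im * v.re) := by
  have h : 1 + w.re ^ 2 + w.im ^ 2 ≠ 0 := by positivity
  rw [imTriple_eq]
  simp only [sigmaMap_imI, sigmaMap_imJ, sigmaMap_imK, dSigma_imI, dSigma_imJ, dSigma_imK]
  field_simp
  rw [← sub_eq_zero]
  ring_nf
  simp only [hε]
  ring

theorem hasDerivAt_quaternion {f : ℝ → ℍ[ℝ]} {f' : ℍ[ℝ]} {t : ℝ}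
    (h0 : HasDerivAt (fun t => (f t).re) f'.re t)
    (h1 : HasDerivAt (fun t => (f t).imI) f'.imI t)
    (h2 : HasDerivAt (fun t => (f t).imJ) f'.imJ t)
    (h3 : HasDerivAt (fun t => (f t).imK) f'.imK t) : HasDerivAt f f' t := by
  obtain ⟨i, hi⟩ : ∃ i : ℍ[ℝ], i.re = 0 ∧ i.imI = 1 ∧ i.imJ = 0 ∧ i.imK = 0 :=
    ⟨⟨0, 1, 0, 0⟩, rfl, rfl, rfl, rfl⟩
  obtain ⟨j, hj⟩ : ∃ i : ℍ[ℝ], i.re = 0 ∧ i.imI = 0 ∧ i.imJ = 1 ∧ i.imK = 0 :=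
    ⟨⟨0, 0, 1, 0⟩, rfl, rfl, rfl, rfl⟩
  obtain ⟨k, hk⟩ : ∃ i : ℍ[ℝ], i.re = 0 ∧ i.imI = 0 ∧ i.imJ = 0 ∧ i.imK = 1 :=
    ⟨⟨0, 0, 0, 1⟩, rfl, rfl, rfl, rfl⟩
  have key : ∀ q : ℍ[ℝ], q = q.re • (1 : ℍ[ℝ]) + q.imI • i + q.imJ • j + q.imK • k := fun q => by
    ext <;> simp [hi, hj, hk]
  have hf : f = fun t => (f t).re • (1 : ℍ[ℝ]) + (f t).imI • i + (f t).imJ • j +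
      (f t).imK • k := funext fun t => key (f t)
  rw [hf, key f']
  exact (((h0.smul_const _).add (h1.smul_const _)).add (h2.smul_const _)).add (h3.smul_const _)

theorem hasDerivAt_complex_re {w : ℝ → ℂ} {w' : ℂ} {t : ℝ} (h : HasDerivAt w w' t) :
    HasDerivAt (fun t => (w t).re) w'.re t :=
  Complex.reCLM.hasFDerivAt.comp_hasDerivAt t h

theorem hasDerivAt_complex_im {w : ℝ → ℂ} {w' : ℂ} {t : ℝ} (h : HasDerivAt w w' t) :
    HasDerivAt (fun t => (w t).im) w'.im t :=
  Complex.imCLM.hasFDerivAt.comp_hasDerivAt t h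

theorem hasDerivAt_sigmaMap (ε : ℝ) {w : ℝ → ℂ} {w' : ℂ} {t : ℝ} (h : HasDerivAt w w' t) :
    HasDerivAt (fun t => sigmaMap ε (w t)) (dSigma ε (w t) w') t := by
  have hp := hasDerivAt_complex_re h
  have hq := hasDerivAt_complex_im h
  have hh : 1 + (w t).re ^ 2 + (w t).im ^ 2 ≠ 0 := by positivity
  have hd := ((hp.fun_pow 2).const_add 1).fun_add (hq.fun_pow 2)
  refine hasDerivAt_quaternion (hasDerivAt_const t 0) ?_ ?_ ?_
  · refine ((hp.const_mul 2).fun_div hd hh).congr_deriv ?_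
    simp only [dSigma_imI]; field_simp; ring
  · refine (((hq.const_mul 2).fun_div hd hh).const_mul ε).congr_deriv ?_
    simp only [dSigma_imJ]; field_simp; ring
  · refine ((((hasDerivAt_const t (2 : ℝ)).fun_div hd hh).const_sub 1).const_mul ε).congr_deriv ?_
    simp only [dSigma_imK]; field_simp; ring

/-- This is the Gauss formula of the unit sphere. The tangential part is the covariant derivative of
the metric `4|dw|²/(1+|w|²)²`, with Christoffel coefficient `-2w̄/(1+|w|²)`; the normal part is
`-|dσ(v)|² σ`. -/
theorem hasDerivAt_dSigma (ε : ℝ) {w v : ℝ → ℂ} {v' : ℂ} {t : ℝ}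
    (h : HasDerivAt w (v t) t) (hv : HasDerivAt v v' t) :
    HasDerivAt (fun t => dSigma ε (w t) (v t))
      (dSigma ε (w t) (v' - 2 * (starRingEnd ℂ) (w t) * v t ^ 2 /
          ((1 + (w t).re ^ 2 + (w t).im ^ 2 : ℝ) : ℂ)) -
        (4 * ((v t).re ^ 2 + (v t).im ^ 2) / (1 + (w t).re ^ 2 + (w t).im ^ 2) ^ 2) •
          sigmaMap ε (w t)) t := by
  have hp := hasDerivAt_complex_re h
  have hq := hasDerivAt_complex_im h
  have hp1 := hasDerivAt_complex_re hv
  have hq1 := hasDerivAt_complex_im hv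
  have hh : 1 + (w t).re ^ 2 + (w t).im ^ 2 ≠ 0 := by positivity
  have hh2 : (1 + (w t).re ^ 2 + (w t).im ^ 2) ^ 2 ≠ 0 := by positivity
  have hd := ((hp.fun_pow 2).const_add 1).fun_add (hq.fun_pow 2)
  have hd2 := hd.fun_pow 2
  have hl := ((hp.fun_mul hp1).fun_add (hq.fun_mul hq1)).const_mul 2
  set c : ℂ := 2 * (starRingEnd ℂ) (w t) * v t ^ 2 /
          ((1 + (w t).re ^ 2 + (w t).im ^ 2 : ℝ) : ℂ) with hc
  have hcre : c.re = 2 * ((w t).re * ((v t).re ^ 2 - (v t).im ^ 2) +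
      2 * (w t).im * (v t).re * (v t).im) / (1 + (w t).re ^ 2 + (w t).im ^ 2) := by
    rw [hc, Complex.div_ofReal_re]
    congr 1
    simp [pow_two]; ring
  have hcim : c.im = 2 * (2 * (w t).re * (v t).re * (v t).im -
      (w t).im * ((v t).re ^ 2 - (v t).im ^ 2)) / (1 + (w t).re ^ 2 + (w t).im ^ 2) := by
    rw [hc, Complex.div_ofReal_im]
    congr 1
    simp [pow_two]; ring
  refine hasDerivAt_quaternion ((hasDerivAt_const t (0 : ℝ)).congr_deriv ?_) ?_ ?_ ?_
  · simp [dSigma_re, sigmaMap_re]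
  · refine (((hp1.const_mul 2).fun_div hd hh).fun_sub
      (((hp.const_mul 2).fun_mul hl).fun_div hd2 hh2)).congr_deriv ?_
    simp only [dSigma_imI, sigmaMap_imI, Quaternion.imI_sub, Quaternion.imI_smul, Complex.sub_re,
      Complex.sub_im, hcre, hcim, smul_eq_mul]
    field_simp; ring
  · refine ((((hq1.const_mul 2).fun_div hd hh).fun_sub
      (((hq.const_mul 2).fun_mul hl).fun_div hd2 hh2)).const_mul ε).congr_deriv ?_
    simp only [dSigma_imJ, sigmaMap_imJ, Quaternion.imJ_sub, Quaternion.imJ_smul, Complex.sub_re,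
      Complex.sub_im, hcre, hcim, smul_eq_mul]
    field_simp; ring
  · refine (((hl.const_mul 2).fun_div hd2 hh2).const_mul ε).congr_deriv ?_
    simp only [dSigma_imK, sigmaMap_imK, Quaternion.imK_sub, Quaternion.imK_smul, Complex.sub_re,
      Complex.sub_im, hcre, hcim, smul_eq_mul]
    field_simp; ring

theorem hasDerivAt_line {F : Type*} [NormedAddCommGroup F] [NormedSpace ℝ F] {f : ℂ → F} {z : ℂ}
    (hf : DifferentiableAt ℝ f z) (v : ℂ) :
    HasDerivAt (fun t : ℝ => f (z + t • v)) (fderiv ℝ f z v) 0 := by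
  have h1 : HasDerivAt (fun t : ℝ => z + t • v) v 0 := by
    simpa using ((hasDerivAt_id (0 : ℝ)).smul_const v).const_add z
  have h2 : HasFDerivAt f (fderiv ℝ f z) (z + (0 : ℝ) • v) := by simpa using hf.hasFDerivAt
  exact h2.comp_hasDerivAt 0 h1

theorem hasDerivAt_line_fderiv {F : Type*} [NormedAddCommGroup F] [NormedSpace ℝ F] {f : ℂ → F}
    {z : ℂ} (hf : ContDiffAt ℝ ∞ f z) (v : ℂ) :
    HasDerivAt (fun t : ℝ => fderiv ℝ f (z + t • v) v) (fderiv ℝ (fderiv ℝ f) z v v) 0 := by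
  have hdf : DifferentiableAt ℝ (fderiv ℝ f) z :=
    (hf.fderiv_right (m := ∞) (by simp)).differentiableAt (by simp)
  simpa using (hasDerivAt_line hdf v).clm_apply (hasDerivAt_const (0 : ℝ) v)

theorem eventually_differentiableAt {F : Type*} [NormedAddCommGroup F] [NormedSpace ℝ F]
    {f : ℂ → F} {z : ℂ} (hf : ContDiffAt ℝ ∞ f z) : ∀ᶠ y in 𝓝 z, DifferentiableAt ℝ f y :=
  ((hf.of_le (m := 1) ENat.LEInfty.out).eventually (by simp)).mono
    fun _ hy => hy.differentiableAt (by simp)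

theorem eventually_line {z : ℂ} (v : ℂ) {P : ℂ → Prop} (h : ∀ᶠ y in 𝓝 z, P y) :
    ∀ᶠ t : ℝ in 𝓝 0, P (z + t • v) := by
  have : ContinuousAt (fun t : ℝ => z + t • v) 0 := by fun_prop
  rw [ContinuousAt, zero_smul, add_zero] at this
  exact this.eventually h

variable {m : ℂ → ℍ[ℝ]} {w : ℂ → ℂ} {ε : ℝ} {z : ℂ}

theorem fderiv_of_eq_sigmaMap (hm : DifferentiableAt ℝ m z) (hw : DifferentiableAt ℝ w z)
    (h : ∀ᶠ y in 𝓝 z, m y = sigmaMap ε (w y)) (v : ℂ) :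
    fderiv ℝ m z v = dSigma ε (w z) (fderiv ℝ w z v) := by
  have h1 := hasDerivAt_line hm v
  have h2 := hasDerivAt_sigmaMap ε (hasDerivAt_line hw v)
  rw [zero_smul, add_zero] at h2
  exact h1.unique (h2.congr_of_eventuallyEq (eventually_line v h))

theorem fderiv_fderiv_of_eq_sigmaMap (hm : ContDiffAt ℝ ∞ m z) (hw : ContDiffAt ℝ ∞ w z)
    (h : ∀ᶠ y in 𝓝 z, m y = sigmaMap ε (w y)) (v : ℂ) :
    fderiv ℝ (fderiv ℝ m) z v v =
      dSigma ε (w z) (fderiv ℝ (fderiv ℝ w) z v v -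
        2 * (starRingEnd ℂ) (w z) * fderiv ℝ w z v ^ 2 /
          ((1 + (w z).re ^ 2 + (w z).im ^ 2 : ℝ) : ℂ)) -
        (4 * ((fderiv ℝ w z v).re ^ 2 + (fderiv ℝ w z v).im ^ 2) /
          (1 + (w z).re ^ 2 + (w z).im ^ 2) ^ 2) • sigmaMap ε (w z) := by
  have hev : ∀ᶠ y in 𝓝 z, fderiv ℝ m y v = dSigma ε (w y) (fderiv ℝ w y v) := by
    filter_upwards [eventually_differentiableAt hm, eventually_differentiableAt hw,
      h.eventually_nhds] with y h1 h2 h3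
    exact fderiv_of_eq_sigmaMap h1 h2 h3 v
  have h1 := hasDerivAt_line_fderiv hm v
  have h2 := hasDerivAt_line_fderiv hw v
  have h3 := hasDerivAt_line (hw.differentiableAt (by simp)) v
  have h3' : HasDerivAt (fun t : ℝ => w (z + t • v))
      ((fun t : ℝ => fderiv ℝ w (z + t • v) v) 0) 0 := by
    simpa using h3
  have h4 := hasDerivAt_dSigma ε h3' h2
  simp only [zero_smul, add_zero] at h4
  exact h1.unique (h4.congr_of_eventuallyEq (eventually_line v hev))

/-- The complex valued version of `flatDefect`, for a Gauss map read in a standard coordinate of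
the Riemann sphere. -/
def gaussDefect (w : ℂ → ℂ) (s : ℂ → ℝ) (z : ℂ) : ℂ :=
  (2 * s z / (1 + s z ^ 2) ^ 2 * fderiv ℝ s z I +
      (1 - s z ^ 2) / (1 + s z ^ 2) ^ 2 * fderiv ℝ s z 1) • fderiv ℝ w z 1 +
    ((1 - s z ^ 2) / (1 + s z ^ 2) ^ 2 * fderiv ℝ s z I -
      2 * s z / (1 + s z ^ 2) ^ 2 * fderiv ℝ s z 1) • fderiv ℝ w z I +
    connB (s z) • (fderiv ℝ (fderiv ℝ w) z 1 1 + fderiv ℝ (fderiv ℝ w) z I I -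
      2 * (starRingEnd ℂ) (w z) * (fderiv ℝ w z 1 ^ 2 + fderiv ℝ w z I ^ 2) /
        ((1 + (w z).re ^ 2 + (w z).im ^ 2 : ℝ) : ℂ))

/-- The normal parts of the second derivatives cancel against the term `n(n_x² + n_y²)`, so the
defect is tangent to the sphere and is the image of a complex number. Only the pure second
derivatives along `1` and `I` occur. -/
theorem flatDefect_eq_dSigma (hε : ε ^ 2 = 1) (s : ℂ → ℝ) (hm : ContDiffAt ℝ ∞ m z)
    (hw : ContDiffAt ℝ ∞ w z) (h : ∀ᶠ y in 𝓝 z, m y = sigmaMap ε (w y)) :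
    flatDefect m s z = dSigma ε (w z) (gaussDefect w s z) := by
  have hmd := hm.differentiableAt (by simp)
  have hwd := hw.differentiableAt (by simp)
  have hz := h.self_of_nhds
  have hsq : fderiv ℝ (fderiv ℝ m) z 1 1 + fderiv ℝ (fderiv ℝ m) z I I -
      m z * (fderiv ℝ m z 1 * fderiv ℝ m z 1 + fderiv ℝ m z I * fderiv ℝ m z I) =
      dSigma ε (w z) (fderiv ℝ (fderiv ℝ w) z 1 1 + fderiv ℝ (fderiv ℝ w) z I I -
      2 * (starRingEnd ℂ) (w z) * (fderiv ℝ w z 1 ^ 2 + fderiv ℝ w z I ^ 2) /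
        ((1 + (w z).re ^ 2 + (w z).im ^ 2 : ℝ) : ℂ)) := by
    rw [fderiv_fderiv_of_eq_sigmaMap hm hw h, fderiv_fderiv_of_eq_sigmaMap hm hw h,
      fderiv_of_eq_sigmaMap hmd hwd h, fderiv_of_eq_sigmaMap hmd hwd h, dSigma_mul_self hε,
      dSigma_mul_self hε, hz, ← Quaternion.coe_add, Quaternion.mul_coe_eq_smul]
    set D := ((1 + (w z).re ^ 2 + (w z).im ^ 2 : ℝ) : ℂ)
    set X := fderiv ℝ w z 1
    set Y := fderiv ℝ w z I
    set xx := fderiv ℝ (fderiv ℝ w) z 1 1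
    set yy := fderiv ℝ (fderiv ℝ w) z I I
    have : xx + yy - 2 * (starRingEnd ℂ) (w z) * (X ^ 2 + Y ^ 2) / D =
      (xx - 2 * (starRingEnd ℂ) (w z) * X ^ 2 / D) +
        (yy - 2 * (starRingEnd ℂ) (w z) * Y ^ 2 / D) := by ring
    rw [this, dSigma_add]
    module
  rw [flatDefect, hsq, gaussDefect, dSigma_add, dSigma_add, dSigma_smul, dSigma_smul, dSigma_smul,
    fderiv_of_eq_sigmaMap hmd hwd h, fderiv_of_eq_sigmaMap hmd hwd h]

end Stereographic

/-! ### Equation (2) as the vanishing of the defect -/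

section GaussEquation

open Complex (I)
open Filter Topology

/-- Here `x, y, d` stand for `w_x, w_y, Δw`, the letters `xb, yb, wb, db` for conjugates, `D` for `1
+ |w|²`, and `N` for the negative Jacobian. The left side is the difference of the two sides of (2).
The right side is a multiple of `w̄_z E - w_z Ē` with `E = A x + B y + b T`. Treating conjugates as
independent variables makes it a rational identity. -/
theorem gaussEquation_algebra {x y xb yb w wb d db D c N A B b T Tb Xi : ℂ}
    (hD : D ≠ 0) (hN : N ≠ 0) (hb : b ≠ 0)
    (hJ : xb * y - x * yb = -(2 * I * N))
    (hT : T = d - 2 * wb * (x ^ 2 + y ^ 2) / D) (hTb : Tb = db - 2 * w * (xb ^ 2 + yb ^ 2) / D)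
    (hc : c * Xi = (I * B - A) / (2 * b)) :
    c * Xi - 2 / N * ((xb - I * yb) / 2 * (d / 4) - (x - I * y) / 2 * (db / 4) +
        2 * ((x - I * y) / 2) * ((xb - I * yb) / 2) *
          ((w * ((xb + I * yb) / 2) - wb * ((x + I * y) / 2)) / D)) =
      -(1 / (4 * N * b)) * ((xb - I * yb) * (A * x + B * y + b * T) -
        (x - I * y) * (A * xb + B * yb + b * Tb)) := by
  have hI : I ^ 2 = -1 := Complex.I_sq
  have e1 : (xb - I * yb) / 2 * (d / 4) - (x - I * y) / 2 * (db / 4) +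
        2 * ((x - I * y) / 2) * ((xb - I * yb) / 2) *
          ((w * ((xb + I * yb) / 2) - wb * ((x + I * y) / 2)) / D) =
      ((xb - I * yb) * T - (x - I * y) * Tb) / 8 := by
    rw [hT, hTb]
    field_simp
    linear_combination (-(32 * w * (x - I * y) * yb ^ 2) + 32 * wb * (xb - I * yb) * y ^ 2) * hI
  have e2 : (xb - I * yb) * (A * x + B * y) - (x - I * y) * (A * xb + B * yb) =
      (-(2 * I * N)) * (B + I * A) := by
    rw [← hJ]; ring
  have e3 : (xb - I * yb) * (A * x + B * y + b * T) - (x - I * y) * (A * xb + B * yb + b * Tb) =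
      (-(2 * I * N)) * (B + I * A) + b * ((xb - I * yb) * T - (x - I * y) * Tb) := by
    rw [← e2]; ring
  rw [e1, e3, hc]
  field_simp
  linear_combination (-32 * N * A) * hI

/-- The two equations form a linear system in `E, Eb` with determinant `4N`. -/
theorem eq_zero_of_conj_eq {x y xb yb E Eb N : ℂ} (hN : N ≠ 0)
    (hJ : xb * y - x * yb = -(2 * I * N)) (h1 : (xb - I * yb) * E = (x - I * y) * Eb)
    (h2 : (x + I * y) * Eb = (xb + I * yb) * E) : E = 0 := by
  have hI : I ^ 2 = -1 := Complex.I_sq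
  have : (4 * N) * E = 0 := by
    linear_combination (x + I * y) * h1 + (x - I * y) * h2 - 2 * I * E * hJ + 4 * N * E * hI
  simpa [hN] using this

/-- With `s = √K` the argument is `(1 - is)²/s`, whose logarithmic derivative in `s` is `-2i/(1 -
is) - 1/s`. -/
theorem hasFDerivAt_logTerm {k : ℂ → ℝ} {z : ℂ} (hk : DifferentiableAt ℝ k z)
    (hpos : 0 < k z) (v : ℂ) :
    fderiv ℝ (fun y => Complex.log ((1 - (k y : ℂ) - 2 * I * (Real.sqrt (k y) : ℂ)) /
      (Real.sqrt (k y) : ℂ))) z v =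
      -((1 + I * (Real.sqrt (k z) : ℂ)) / ((Real.sqrt (k z) : ℂ) *
        (1 - I * (Real.sqrt (k z) : ℂ)))) *
        (fderiv ℝ (fun y => Real.sqrt (k y)) z v : ℂ) := by
  have hs : DifferentiableAt ℝ (fun y => Real.sqrt (k y)) z := hk.sqrt hpos.ne'
  have hsp : 0 < Real.sqrt (k z) := Real.sqrt_pos.2 hpos
  set s : ℂ → ℝ := fun y => Real.sqrt (k y) with hsdef
  have hszp : 0 < s z := hsp
  have hc : HasDerivAt (fun t : ℝ => (s (z + t • v) : ℂ)) ((fderiv ℝ s z v : ℝ) : ℂ) 0 :=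
    (hasDerivAt_line hs v).ofReal_comp
  have hsz : ((s z : ℝ) : ℂ) ≠ 0 := by exact_mod_cast hszp.ne'
  have hev : ∀ᶠ y in 𝓝 z, (1 - (k y : ℂ) - 2 * I * (Real.sqrt (k y) : ℂ)) /
      (Real.sqrt (k y) : ℂ) = ((s y : ℂ))⁻¹ - (s y : ℂ) - 2 * I := by
    filter_upwards [hk.continuousAt.eventually (lt_mem_nhds hpos)] with y hy
    have h1 : 0 < s y := Real.sqrt_pos.2 hy
    have h2 : ((s y : ℝ) : ℂ) ≠ 0 := by exact_mod_cast h1.ne'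
    have h3 : (k y : ℂ) = (s y : ℂ) ^ 2 := by
      rw [← Complex.ofReal_pow, hsdef, Real.sq_sqrt hy.le]
    rw [h3]
    change (1 - (s y : ℂ) ^ 2 - 2 * I * (s y : ℂ)) / (s y : ℂ) = _
    field_simp
  have hinner : HasDerivAt (fun t : ℝ => ((s (z + t • v) : ℂ))⁻¹ - (s (z + t • v) : ℂ) - 2 * I)
      (-((fderiv ℝ s z v : ℝ) : ℂ) / (s z : ℂ) ^ 2 - ((fderiv ℝ s z v : ℝ) : ℂ)) 0 := by
    have h0 : ((s (z + (0 : ℝ) • v) : ℝ) : ℂ) ≠ 0 := by simpa using hsz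
    have := ((hc.fun_inv h0).fun_sub hc).sub_const (2 * I)
    simpa using this
  -- The imaginary part is `-2`, which keeps the argument off the cut of the principal logarithm.
  have hslit : ((s (z + (0 : ℝ) • v) : ℂ))⁻¹ - (s (z + (0 : ℝ) • v) : ℂ) - 2 * I ∈
      Complex.slitPlane := by
    right
    rw [zero_smul, add_zero, ← Complex.ofReal_inv]
    simp
  have hlog := hinner.clog_real hslit
  have hdiff : DifferentiableAt ℝ (fun y => Complex.log ((s y : ℂ)⁻¹ - (s y : ℂ) - 2 * I)) z := by
    have hsc : DifferentiableAt ℝ (fun y => (s y : ℂ)) z :=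
      Complex.ofRealCLM.differentiableAt.comp z hs
    have hin : DifferentiableAt ℝ (fun y => (s y : ℂ)⁻¹ - (s y : ℂ) - 2 * I) z :=
      ((hsc.fun_inv hsz).fun_sub hsc).sub_const _
    refine DifferentiableAt.comp z
      ((Complex.differentiableAt_log ?_).restrictScalars ℝ) hin
    simpa using hslit
  have h1 := (hasDerivAt_line hdiff v).unique hlog
  rw [Filter.EventuallyEq.fderiv_eq (hev.mono fun y hy => by rw [hy]), h1]
  simp only [zero_smul, add_zero]
  change _ = -((1 + I * (s z : ℂ)) / ((s z : ℂ) * (1 - I * (s z : ℂ)))) * _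
  have h4 : (s z : ℂ)⁻¹ - (s z : ℂ) - 2 * I = (1 - I * (s z : ℂ)) ^ 2 / (s z : ℂ) := by
    field_simp
    linear_combination -(s z : ℂ) ^ 2 * Complex.I_sq
  have h5 : (1 - I * (s z : ℂ)) ≠ 0 := by
    intro h
    have := congr_arg Complex.re h
    simp at this
  rw [h4]
  obtain ⟨u, hu⟩ : ∃ u : ℂ, u = 1 - I * (s z : ℂ) := ⟨_, rfl⟩
  rw [← hu] at h5 ⊢
  field_simp
  rw [hu]
  linear_combination -(s z : ℂ) ^ 2 * ((fderiv ℝ s z v : ℝ) : ℂ) * Complex.I_sq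

variable {X : Type*} [TopologicalSpace X]

theorem negJacobian_eq (e : OpenPartialHomeomorph X ℂ) (g : X → ℂ) (p : X) :
    negJacobian e g p = -((coordD e g p 1).re * (coordD e g p I).im -
      (coordD e g p 1).im * (coordD e g p I).re) := by
  have h : ∀ z : ℂ, ‖z / 2‖ ^ 2 = (z.re ^ 2 + z.im ^ 2) / 4 := fun z => by
    rw [norm_div, div_pow, Complex.sq_norm, Complex.normSq_apply]
    norm_num; ring
  rw [negJacobian, dZbar, dZ, h, h]
  simp
  ring

theorem gaussEquationAt_iff {e : OpenPartialHomeomorph X ℂ} {p : X} (hp : p ∈ e.source)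
    {g : X → ℂ} {K : X → ℝ} (hw : ContDiffAt ℝ ∞ (fun z => g (e.symm z)) (e p))
    (hK : DifferentiableAt ℝ (fun z => K (e.symm z)) (e p)) (hpos : 0 < K p)
    (hJ : 0 < negJacobian e g p) :
    GaussEquationAt e g K p ↔
      gaussDefect (fun z => g (e.symm z)) (fun z => Real.sqrt (K (e.symm z))) (e p) = 0 := by
  have hep : e.symm (e p) = p := e.left_inv hp
  have hk0 : 0 < K (e.symm (e p)) := by rwa [hep]
  set w : ℂ → ℂ := fun z => g (e.symm z) with hwdef
  set s : ℂ → ℝ := fun z => Real.sqrt (K (e.symm z)) with hsdef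
  have hs0 : 0 < s (e p) := Real.sqrt_pos.2 hk0
  have hwd : DifferentiableAt ℝ w (e p) := hw.differentiableAt (by simp)
  have hdw : DifferentiableAt ℝ (fderiv ℝ w) (e p) :=
    (hw.fderiv_right (m := ∞) (by simp)).differentiableAt (by simp)
  have hsymm : fderiv ℝ (fderiv ℝ w) (e p) 1 I = fderiv ℝ (fderiv ℝ w) (e p) I 1 :=
    (hw.isSymmSndFDerivAt (by simpa using ENat.LEInfty.out)).eq 1 I
  have hconj : ∀ y, DifferentiableAt ℝ w y → ∀ v,
      fderiv ℝ (fun z => (starRingEnd ℂ) (w z)) y v = (starRingEnd ℂ) (fderiv ℝ w y v) := by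
    intro y hy v
    have := (Complex.conjCLE.toContinuousLinearMap.hasFDerivAt.comp y hy.hasFDerivAt).fderiv
    have h2 := congr_arg (fun L : ℂ →L[ℝ] ℂ => L v) this
    simpa [Function.comp_def] using h2
  have c1 : ∀ v, coordD e g p v = fderiv ℝ w (e p) v := fun v => rfl
  have c2 : ∀ v, coordD e (conjFun g) p v = (starRingEnd ℂ) (fderiv ℝ w (e p) v) := fun v =>
    hconj _ hwd v
  have hright : ∀ᶠ y in 𝓝 (e p), e (e.symm y) = y :=
    Filter.mem_of_superset (e.open_target.mem_nhds (e.map_source hp)) fun y hy => e.right_inv hy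
  have hdir : ∀ v u, HasDerivAt (fun t : ℝ => fderiv ℝ w (e p + t • v) u)
      (fderiv ℝ (fderiv ℝ w) (e p) v u) 0 := fun v u => by
    simpa using (hasDerivAt_line hdw v).clm_apply (hasDerivAt_const (0 : ℝ) u)
  have hdu : ∀ u, DifferentiableAt ℝ (fun y => fderiv ℝ w y u) (e p) := fun u =>
    hdw.clm_apply (differentiableAt_const u)
  have d1 : ∀ v, coordD e (dZbar e g) p v =
      (fderiv ℝ (fderiv ℝ w) (e p) v 1 + I * fderiv ℝ (fderiv ℝ w) (e p) v I) / 2 := by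
    intro v
    have h1 : (fun y => dZbar e g (e.symm y)) =ᶠ[𝓝 (e p)]
        fun y => (fderiv ℝ w y 1 + I * fderiv ℝ w y I) / 2 := by
      filter_upwards [hright] with y hy
      simp only [dZbar, coordD, hy, hwdef]
    rw [coordD, h1.fderiv_eq]
    have hd : DifferentiableAt ℝ (fun y => (fderiv ℝ w y 1 + I * fderiv ℝ w y I) / 2) (e p) := by
      simp only [div_eq_mul_inv]
      exact ((hdu 1).fun_add ((hdu I).const_mul I)).mul_const _
    exact (hasDerivAt_line hd v).unique
      (((hdir v 1).fun_add ((hdir v I).const_mul I)).div_const (2 : ℂ))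
  have d2 : ∀ v, coordD e (dZbar e (conjFun g)) p v =
      ((starRingEnd ℂ) (fderiv ℝ (fderiv ℝ w) (e p) v 1) +
        I * (starRingEnd ℂ) (fderiv ℝ (fderiv ℝ w) (e p) v I)) / 2 := by
    intro v
    have h1 : (fun y => dZbar e (conjFun g) (e.symm y)) =ᶠ[𝓝 (e p)]
        fun y => ((starRingEnd ℂ) (fderiv ℝ w y 1) +
          I * (starRingEnd ℂ) (fderiv ℝ w y I)) / 2 := by
      filter_upwards [hright, eventually_differentiableAt hw] with y hy hd
      rw [← hconj y hd, ← hconj y hd]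
      simp only [dZbar, coordD, hy, hwdef, conjFun]
    rw [coordD, h1.fderiv_eq]
    have hcd : ∀ u, DifferentiableAt ℝ (fun y => (starRingEnd ℂ) (fderiv ℝ w y u)) (e p) := fun u =>
      Complex.conjCLE.toContinuousLinearMap.differentiableAt.comp (e p) (hdu u)
    have hcdir : ∀ u, HasDerivAt (fun t : ℝ => (starRingEnd ℂ) (fderiv ℝ w (e p + t • v) u))
        ((starRingEnd ℂ) (fderiv ℝ (fderiv ℝ w) (e p) v u)) 0 := fun u =>
      Complex.conjCLE.toContinuousLinearMap.hasFDerivAt.comp_hasDerivAt 0 (hdir v u)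
    have hd : DifferentiableAt ℝ (fun y => ((starRingEnd ℂ) (fderiv ℝ w y 1) +
          I * (starRingEnd ℂ) (fderiv ℝ w y I)) / 2) (e p) := by
      simp only [div_eq_mul_inv]
      exact ((hcd 1).fun_add ((hcd I).const_mul I)).mul_const _
    exact (hasDerivAt_line hd v).unique
      (((hcdir 1).fun_add ((hcdir I).const_mul I)).div_const (2 : ℂ))
  have d3 : ∀ v, coordD e (logTerm K) p v =
      -((1 + I * (s (e p) : ℂ)) / ((s (e p) : ℂ) * (1 - I * (s (e p) : ℂ)))) *
        (fderiv ℝ s (e p) v : ℂ) := fun v => hasFDerivAt_logTerm hK hk0 v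
  have hN := negJacobian_eq e g p
  set x := fderiv ℝ w (e p) 1 with hx
  set y := fderiv ℝ w (e p) I with hy
  set xx := fderiv ℝ (fderiv ℝ w) (e p) 1 1 with hxx
  set yy := fderiv ℝ (fderiv ℝ w) (e p) I I with hyy
  set xy := fderiv ℝ (fderiv ℝ w) (e p) I 1 with hxy
  set S := s (e p) with hS
  set sx := fderiv ℝ s (e p) 1 with hsx
  set sy := fderiv ℝ s (e p) I with hsy
  rw [c1, c1] at hN
  set N := negJacobian e g p with hNdef
  have hN0 : (N : ℂ) ≠ 0 := by exact_mod_cast hJ.ne'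
  have hI : I ^ 2 = -1 := Complex.I_sq
  have hJc : (starRingEnd ℂ) x * y - x * (starRingEnd ℂ) y = -(2 * I * (N : ℂ)) := by
    rw [hN]
    apply Complex.ext
    · simp [mul_comm]
    · simp; ring
  have hgp : g p = w (e p) := by simp only [hwdef, hep]
  have hcg : conjFun g p = (starRingEnd ℂ) (w (e p)) := by rw [conjFun, hgp]
  have hnorm : (1 + (‖g p‖ ^ 2 : ℝ) : ℂ) =
      ((1 + (w (e p)).re ^ 2 + (w (e p)).im ^ 2 : ℝ) : ℂ) := by
    rw [hgp, Complex.sq_norm, Complex.normSq_apply]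
    push_cast; ring
  have hD0 : ((1 + (w (e p)).re ^ 2 + (w (e p)).im ^ 2 : ℝ) : ℂ) ≠ 0 := by
    have : (1 + (w (e p)).re ^ 2 + (w (e p)).im ^ 2 : ℝ) ≠ 0 := by positivity
    exact_mod_cast this
  set D := ((1 + (w (e p)).re ^ 2 + (w (e p)).im ^ 2 : ℝ) : ℂ) with hDdef
  set A : ℝ := 2 * S / (1 + S ^ 2) ^ 2 * sy + (1 - S ^ 2) / (1 + S ^ 2) ^ 2 * sx with hA
  set B : ℝ := (1 - S ^ 2) / (1 + S ^ 2) ^ 2 * sy - 2 * S / (1 + S ^ 2) ^ 2 * sx with hB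
  have hb0 : (connB S : ℂ) ≠ 0 := by
    have : connB S ≠ 0 := by rw [connB]; positivity
    exact_mod_cast this
  have hS0 : (S : ℂ) ≠ 0 := by exact_mod_cast hs0.ne'
  have hone : (1 - I * (S : ℂ)) ≠ 0 := by
    intro h
    have := congr_arg Complex.re h
    simp at this
  have hone' : (1 + (S : ℂ) ^ 2) ≠ 0 := by
    have : (1 + S ^ 2 : ℝ) ≠ 0 := by positivity
    exact_mod_cast this
  -- The coefficients of `w_x, w_y` in the defect combine into the `z`-derivative of the logarithm,
  -- through `1 + s² = (1 + is)(1 - is)`.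
  have hc : -((1 + I * (S : ℂ)) / ((S : ℂ) * (1 - I * (S : ℂ)))) *
      (((sx : ℂ) - I * (sy : ℂ)) / 2) = (I * (B : ℂ) - (A : ℂ)) / (2 * (connB S : ℂ)) := by
    have h1 : (1 + (S : ℂ) ^ 2) = (1 + I * S) * (1 - I * S) := by
      linear_combination (S : ℂ) ^ 2 * hI
    have hone2 : (1 + I * (S : ℂ)) ≠ 0 := fun h => hone' (by rw [h1, h, zero_mul])
    rw [hA, hB, connB]
    push_cast
    have h2 : I * ((1 - (S : ℂ) ^ 2) / (1 + (S : ℂ) ^ 2) ^ 2 * sy -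
        2 * S / (1 + (S : ℂ) ^ 2) ^ 2 * sx) - (2 * S / (1 + (S : ℂ) ^ 2) ^ 2 * sy +
        (1 - (S : ℂ) ^ 2) / (1 + (S : ℂ) ^ 2) ^ 2 * sx) =
        -((1 + I * S) ^ 2 / (1 + (S : ℂ) ^ 2) ^ 2) * (sx - I * sy) := by
      field_simp
      linear_combination (-(S : ℂ) ^ 2 * I * sy + (S : ℂ) ^ 2 * sx - 2 * S * sy) * hI
    rw [h2, h1]
    field_simp
  set T := xx + yy - 2 * (starRingEnd ℂ) (w (e p)) * (x ^ 2 + y ^ 2) / D with hT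
  have hTb : (starRingEnd ℂ) T = (starRingEnd ℂ) xx + (starRingEnd ℂ) yy -
      2 * w (e p) * ((starRingEnd ℂ) x ^ 2 + (starRingEnd ℂ) y ^ 2) / D := by
    rw [hT, hDdef]
    simp only [map_sub, map_add, map_div₀, map_mul, map_pow, Complex.conj_conj,
      Complex.conj_ofReal, map_ofNat]
  have hdefect : gaussDefect w s (e p) = (A : ℂ) * x + (B : ℂ) * y + (connB S : ℂ) * T := by
    simp only [gaussDefect, Complex.real_smul]
    rfl
  have hmain := gaussEquation_algebra (x := x) (y := y) (xb := (starRingEnd ℂ) x)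
    (yb := (starRingEnd ℂ) y) (w := w (e p)) (wb := (starRingEnd ℂ) (w (e p)))
    hD0 hN0 hb0 hJc hT hTb hc
  have hG : GaussEquationAt e g K p ↔
      -((1 + I * (S : ℂ)) / ((S : ℂ) * (1 - I * (S : ℂ)))) * (((sx : ℂ) - I * (sy : ℂ)) / 2) -
      2 / (N : ℂ) * (((starRingEnd ℂ) x - I * (starRingEnd ℂ) y) / 2 * ((xx + yy) / 4) -
        (x - I * y) / 2 * (((starRingEnd ℂ) xx + (starRingEnd ℂ) yy) / 4) +
        2 * ((x - I * y) / 2) * (((starRingEnd ℂ) x - I * (starRingEnd ℂ) y) / 2) *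
          ((w (e p) * (((starRingEnd ℂ) x + I * (starRingEnd ℂ) y) / 2) -
            (starRingEnd ℂ) (w (e p)) * ((x + I * y) / 2)) / D)) = 0 := by
    rw [GaussEquationAt, ← sub_eq_zero]
    have z1 : dZ e (dZbar e g) p = (xx + yy) / 4 := by
      rw [dZ, d1, d1, hsymm]
      linear_combination (-(yy / 4)) * hI
    have z2 : dZ e (dZbar e (conjFun g)) p = ((starRingEnd ℂ) xx + (starRingEnd ℂ) yy) / 4 := by
      rw [dZ, d2, d2, hsymm]
      linear_combination (-((starRingEnd ℂ) yy / 4)) * hI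
    have z3 : dZ e (logTerm K) p = -((1 + I * (S : ℂ)) / ((S : ℂ) * (1 - I * (S : ℂ)))) *
        (((sx : ℂ) - I * (sy : ℂ)) / 2) := by
      rw [dZ, d3, d3]; ring
    rw [z1, z2, z3, hcg, hnorm, hgp]
    simp only [dZ, dZbar, c1, c2]
    rfl
  rw [hG, hmain, hdefect]
  have hk : -(1 / (4 * (N : ℂ) * (connB S : ℂ))) ≠ 0 := by
    simp [hN0, hb0]
  rw [mul_eq_zero, or_iff_right hk]
  set E := (A : ℂ) * x + (B : ℂ) * y + (connB S : ℂ) * T with hE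
  have hEb : (starRingEnd ℂ) E = (A : ℂ) * (starRingEnd ℂ) x + (B : ℂ) * (starRingEnd ℂ) y +
      (connB S : ℂ) * (starRingEnd ℂ) T := by
    rw [hE]
    simp only [map_add, map_mul, Complex.conj_ofReal]
  rw [← hEb]
  constructor
  · intro h
    rw [sub_eq_zero] at h
    refine eq_zero_of_conj_eq hN0 hJc h ?_
    have := congr_arg (starRingEnd ℂ) h
    simpa using this
  · intro h
    simp [h]

end GaussEquation

/-! ### The Gauss map as a map into the imaginary units -/

section GaussMap

open Complex (I)
open Filter Topology

/-- The inverse of the stereographic projection from the north pole, with values in the unit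
imaginary quaternions. -/
def invStereo (x : OnePoint ℂ) : ℍ[ℝ] :=
  match x with
  | none => ⟨0, 0, 0, 1⟩
  | some w => sigmaMap 1 w

theorem invStereo_coe (w : ℂ) : invStereo (w : OnePoint ℂ) = sigmaMap 1 w := rfl

theorem invStereo_infty : invStereo OnePoint.infty = ⟨0, 0, 0, 1⟩ := rfl

theorem invStereo_re (x : OnePoint ℂ) : (invStereo x).re = 0 := by
  induction x using OnePoint.rec <;> rfl

theorem norm_invStereo (x : OnePoint ℂ) : ‖invStereo x‖ = 1 := by
  induction x using OnePoint.rec with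
  | infty => rw [invStereo_infty]; exact Quaternion.norm_eq_one_of_sum_sq (by simp)
  | coe w => rw [invStereo_coe]; exact norm_sigmaMap (by norm_num) w

theorem stereoNorth_invStereo (x : OnePoint ℂ) : stereoNorth (invStereo x) = x := by
  induction x using OnePoint.rec with
  | infty => exact if_pos rfl
  | coe w =>
    have h : 0 < 1 + w.re ^ 2 + w.im ^ 2 := by positivity
    rw [invStereo_coe, stereoNorth, sigmaMap_imK, sigmaMap_imI, sigmaMap_imJ, if_neg]
    · congr 1
      rw [one_mul, one_mul, sub_sub_cancel]
      apply Complex.ext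
      · rw [Complex.div_ofReal_re]; field_simp
      · rw [Complex.div_ofReal_im]; field_simp
    · rw [one_mul, sub_eq_self]
      positivity

theorem invStereo_stereoNorth {n : ℍ[ℝ]} (h0 : n.re = 0) (hn : ‖n‖ = 1) :
    invStereo (stereoNorth n) = n := by
  have hs := Quaternion.sum_sq_eq_one hn
  rw [h0] at hs
  rw [stereoNorth]
  split_ifs with h
  · have h1 : n.imI = 0 := by
      rw [h] at hs; nlinarith [sq_nonneg n.imI, sq_nonneg n.imJ]
    have h2 : n.imJ = 0 := by
      rw [h] at hs; nlinarith [sq_nonneg n.imI, sq_nonneg n.imJ]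
    rw [invStereo_infty]
    ext
    · exact h0.symm
    · exact h1.symm
    · exact h2.symm
    · exact h.symm
  · have hk : 1 - n.imK ≠ 0 := fun h' => h (by linarith)
    rw [invStereo_coe]
    have hre : ((⟨n.imI, n.imJ⟩ : ℂ) / ((1 - n.imK : ℝ) : ℂ)).re = n.imI / (1 - n.imK) := by
      rw [Complex.div_ofReal_re]
    have him : ((⟨n.imI, n.imJ⟩ : ℂ) / ((1 - n.imK : ℝ) : ℂ)).im = n.imJ / (1 - n.imK) := by
      rw [Complex.div_ofReal_im]
    have hd : 1 + (n.imI / (1 - n.imK)) ^ 2 + (n.imJ / (1 - n.imK)) ^ 2 = 2 / (1 - n.imK) := by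
      field_simp
      linear_combination hs
    ext
    · rw [sigmaMap_re, h0]
    · rw [sigmaMap_imI, hre, him, hd]; field_simp
    · rw [sigmaMap_imJ, hre, him, hd]; field_simp
    · rw [sigmaMap_imK, hre, him, hd]; field_simp; ring

variable {X : Type*}

/-- The sign `ε` for which `invStereo ∘ g` is `sigmaMap ε ∘ sphereRep g p` near `p`. -/
def repSign (g : X → OnePoint ℂ) (p : X) : ℝ :=
  open Classical in if g p = OnePoint.infty then -1 else 1

theorem repSign_sq (g : X → OnePoint ℂ) (p : X) : repSign g p ^ 2 = 1 := by
  rw [repSign]; split_ifs <;> norm_num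

theorem sigmaMap_neg_one_inv {w : ℂ} (hw : w ≠ 0) : sigmaMap (-1) w⁻¹ = sigmaMap 1 w := by
  have h : 1 + w.re ^ 2 + w.im ^ 2 ≠ 0 := by positivity
  have hn : w.re ^ 2 + w.im ^ 2 ≠ 0 := by
    have := Complex.normSq_pos.2 hw
    rw [Complex.normSq_apply] at this
    nlinarith
  have hre : (w⁻¹).re = w.re / (w.re ^ 2 + w.im ^ 2) := by
    rw [Complex.inv_re, Complex.normSq_apply]; ring
  have him : (w⁻¹).im = -w.im / (w.re ^ 2 + w.im ^ 2) := by
    rw [Complex.inv_im, Complex.normSq_apply]; ring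
  have hd : 1 + (w.re / (w.re ^ 2 + w.im ^ 2)) ^ 2 + (-w.im / (w.re ^ 2 + w.im ^ 2)) ^ 2 =
      (1 + w.re ^ 2 + w.im ^ 2) / (w.re ^ 2 + w.im ^ 2) := by
    field_simp; ring
  ext
  · rfl
  · rw [sigmaMap_imI, sigmaMap_imI, hre, him, hd]; field_simp
  · rw [sigmaMap_imJ, sigmaMap_imJ, hre, him, hd]; field_simp
  · rw [sigmaMap_imK, sigmaMap_imK, hre, him, hd]; field_simp; ring

theorem invStereo_eventuallyEq [TopologicalSpace X] {g : X → OnePoint ℂ} (hg : Continuous g)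
    (p : X) : ∀ᶠ q in 𝓝 p, invStereo (g q) = sigmaMap (repSign g p) (sphereRep g p q) := by
  by_cases hp : g p = OnePoint.infty
  · have h1 : ∀ᶠ q in 𝓝 p, g q ≠ ((0 : ℂ) : OnePoint ℂ) :=
      hg.continuousAt.eventually_ne (by rw [hp]; exact OnePoint.infty_ne_coe _)
    filter_upwards [h1] with q hq
    simp only [repSign, sphereRep, if_pos hp]
    generalize g q = x at hq
    induction x using OnePoint.rec with
    | infty =>
      rw [invStereo_infty]
      change _ = sigmaMap (-1) 0
      ext
      · rfl
      · rw [sigmaMap_imI]; simp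
      · rw [sigmaMap_imJ]; simp
      · rw [sigmaMap_imK]; norm_num
    | coe w =>
      have hw : w ≠ 0 := fun h => hq (by rw [h])
      exact (sigmaMap_neg_one_inv hw).symm
  · have h1 : ∀ᶠ q in 𝓝 p, g q ≠ OnePoint.infty := hg.continuousAt.eventually_ne hp
    filter_upwards [h1] with q hq
    simp only [repSign, sphereRep, if_neg hp]
    generalize g q = x at hq
    induction x using OnePoint.rec with
    | infty => exact absurd rfl hq
    | coe w => rfl

theorem contDiff_sigmaMap (ε : ℝ) : ContDiff ℝ ∞ (sigmaMap ε) := by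
  obtain ⟨i, hi⟩ : ∃ i : ℍ[ℝ], i.re = 0 ∧ i.imI = 1 ∧ i.imJ = 0 ∧ i.imK = 0 :=
    ⟨⟨0, 1, 0, 0⟩, rfl, rfl, rfl, rfl⟩
  obtain ⟨j, hj⟩ : ∃ i : ℍ[ℝ], i.re = 0 ∧ i.imI = 0 ∧ i.imJ = 1 ∧ i.imK = 0 :=
    ⟨⟨0, 0, 1, 0⟩, rfl, rfl, rfl, rfl⟩
  obtain ⟨k, hk⟩ : ∃ i : ℍ[ℝ], i.re = 0 ∧ i.imI = 0 ∧ i.imJ = 0 ∧ i.imK = 1 :=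
    ⟨⟨0, 0, 0, 1⟩, rfl, rfl, rfl, rfl⟩
  have key : sigmaMap ε = fun w => (2 * w.re / (1 + w.re ^ 2 + w.im ^ 2)) • i +
      (ε * (2 * w.im / (1 + w.re ^ 2 + w.im ^ 2))) • j +
      (ε * (1 - 2 / (1 + w.re ^ 2 + w.im ^ 2))) • k := by
    funext w
    ext
    · simp [sigmaMap_re, hi, hj, hk]
    · simp [sigmaMap_imI, hi, hj, hk]
    · simp [sigmaMap_imJ, hi, hj, hk]
    · simp [sigmaMap_imK, hi, hj, hk]
  have hre : ContDiff ℝ ∞ (fun w : ℂ => w.re) := Complex.reCLM.contDiff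
  have him : ContDiff ℝ ∞ (fun w : ℂ => w.im) := Complex.imCLM.contDiff
  have hd : ContDiff ℝ ∞ (fun w : ℂ => 1 + w.re ^ 2 + w.im ^ 2) :=
    (contDiff_const.add (hre.pow 2)).add (him.pow 2)
  have hne : ∀ w : ℂ, 1 + w.re ^ 2 + w.im ^ 2 ≠ 0 := fun w => by positivity
  rw [key]
  exact ((((contDiff_const.mul hre).div hd hne).smul contDiff_const).add
    ((contDiff_const.mul ((contDiff_const.mul him).div hd hne)).smul contDiff_const)).add
    ((contDiff_const.mul (contDiff_const.sub (contDiff_const.div hd hne))).smul contDiff_const)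

variable [TopologicalSpace X] [ChartedSpace ℂ X]

theorem SmoothToSphere.contMDiff_invStereo {g : X → OnePoint ℂ} (hg : SmoothToSphere g) :
    ContMDiff 𝓘(ℝ, ℂ) 𝓘(ℝ, ℍ[ℝ]) ∞ (fun q => invStereo (g q)) := fun p =>
  ((contDiff_sigmaMap (repSign g p)).contMDiff.contMDiffAt.comp p (hg.2 p)).congr_of_eventuallyEq
    (invStereo_eventuallyEq hg.1 p)

end GaussMap

/-! ### Frames of the connection form, local and global -/

section Frames

open Complex (I)
open Filter Topology

/-- Bootstrapping: if `F` is of class C^k, so is `dF = F α`, and then `F` is of class C^(k+1). -/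
theorem contDiffOn_of_frame {V H : Type*} [NormedAddCommGroup V] [NormedSpace ℝ V]
    [NormedRing H] [NormedAlgebra ℝ H] {F : V → H} {α : V → V →L[ℝ] H} {U : Set V}
    (hU : IsOpen U) (hα : ContDiffOn ℝ ∞ α U)
    (hF : ∀ z ∈ U, HasFDerivAt F (ContinuousLinearMap.mul ℝ H (F z) ∘L α z) z) :
    ContDiffOn ℝ ∞ F U := by
  rw [contDiffOn_infty]
  intro k
  induction k with
  | zero =>
    rw [Nat.cast_zero, contDiffOn_zero]
    exact fun z hz => (hF z hz).continuousAt.continuousWithinAt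
  | succ k ih =>
    rw [Nat.cast_succ, contDiffOn_succ_iff_fderiv_of_isOpen hU]
    refine ⟨fun z hz => (hF z hz).differentiableAt.differentiableWithinAt, by simp, ?_⟩
    have h1 : ContDiffOn ℝ k (fun z => ContinuousLinearMap.mul ℝ H (F z) ∘L α z) U :=
      ((ContinuousLinearMap.mul ℝ H).contDiff.comp_contDiffOn ih).clm_comp
        (hα.of_le (by exact_mod_cast le_top))
    exact h1.congr fun z hz => (hF z hz).fderiv

variable {X : Type*} [TopologicalSpace X]

/-- The connection form of a Gauss map, in a local coordinate. -/
def coordFrameForm (n : X → ℍ[ℝ]) (s : X → ℝ) (e : OpenPartialHomeomorph X ℂ) (z : ℂ) :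
    ℂ →L[ℝ] ℍ[ℝ] :=
  frameForm (fun z => n (e.symm z)) (fun z => s (e.symm z)) z

theorem coordFrameForm_apply {n : X → ℍ[ℝ]} {s : X → ℝ} {e : OpenPartialHomeomorph X ℂ} {p : X}
    (hp : p ∈ e.source) (v : ℂ) : coordFrameForm n s e (e p) v =
    n p * (connA (s p) • coordD e n p v + connB (s p) • coordD e n p (I * v)) := by
  rw [coordFrameForm, frameForm_apply, e.left_inv hp]
  rfl

variable [ChartedSpace ℂ X]

/-- A smooth map into the unit imaginary quaternions. -/
structure IsSphereMap (n : X → ℍ[ℝ]) : Prop where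
  smooth : ContMDiff 𝓘(ℝ, ℂ) 𝓘(ℝ, ℍ[ℝ]) ∞ n
  re : ∀ p, (n p).re = 0
  norm : ∀ p, ‖n p‖ = 1

theorem SmoothToSphere.isSphereMap {g : X → OnePoint ℂ} (hg : SmoothToSphere g) :
    IsSphereMap (fun q => invStereo (g q)) :=
  ⟨hg.contMDiff_invStereo, fun p => invStereo_re (g p), fun p => norm_invStereo (g p)⟩

theorem hasFDerivAt_re {V : Type*} [NormedAddCommGroup V] [NormedSpace ℝ V] {f : V → ℍ[ℝ]}
    {L : V →L[ℝ] ℍ[ℝ]} {z : V} (hf : HasFDerivAt f L z) (h : ∀ᶠ y in 𝓝 z, (f y).re = 0) (v : V) :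
    (L v).re = 0 := by
  have h1 : HasFDerivAt (fun y => inner ℝ (f y) (1 : ℍ[ℝ])) _ z :=
    hf.inner ℝ (hasFDerivAt_const (1 : ℍ[ℝ]) z)
  have h2 : HasFDerivAt (fun y => inner ℝ (f y) (1 : ℍ[ℝ])) (0 : V →L[ℝ] ℝ) z := by
    refine (hasFDerivAt_const (0 : ℝ) z).congr_of_eventuallyEq (h.mono fun y hy => ?_)
    simp [Quaternion.inner_eq_sum, hy]
  have h3 := congr_arg (fun L : V →L[ℝ] ℝ => L v) (h1.unique h2)
  simpa [Quaternion.inner_eq_sum] using h3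

theorem inner_fderiv_of_norm {V : Type*} [NormedAddCommGroup V] [NormedSpace ℝ V] {f : V → ℍ[ℝ]}
    {L : V →L[ℝ] ℍ[ℝ]} {z : V} (hf : HasFDerivAt f L z) (h : ∀ᶠ y in 𝓝 z, ‖f y‖ = 1) (v : V) :
    inner ℝ (f z) (L v) = 0 := by
  have h1 : HasFDerivAt (fun y => inner ℝ (f y) (f y)) _ z := hf.inner ℝ hf
  have h2 : HasFDerivAt (fun y => inner ℝ (f y) (f y)) (0 : V →L[ℝ] ℝ) z := by
    refine (hasFDerivAt_const (1 : ℝ) z).congr_of_eventuallyEq (h.mono fun y hy => ?_)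
    simp [hy]
  have h3 := congr_arg (fun L : V →L[ℝ] ℝ => L v) (h1.unique h2)
  simp [real_inner_comm] at h3
  linarith

/-- The conjugation of quaternions, as a continuous real linear map. -/
def Quaternion.starCLM : ℍ[ℝ] →L[ℝ] ℍ[ℝ] := LinearMap.toContinuousLinearMap
  { toFun := star, map_add' := star_add, map_smul' := fun r q => Quaternion.star_smul r q }

/-- An imaginary `α` satisfies `star α = -α`, so the two terms of the product rule cancel. With `F =
G` this preserves the norm of a frame; in general it compares two frames. -/
theorem hasFDerivAt_mul_star_of_frame {V : Type*} [NormedAddCommGroup V] [NormedSpace ℝ V]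
    {F G : V → ℍ[ℝ]} {α : V →L[ℝ] ℍ[ℝ]} {z : V} (hα : ∀ v, (α v).re = 0)
    (hF : HasFDerivAt F (ContinuousLinearMap.mul ℝ ℍ[ℝ] (F z) ∘L α) z)
    (hG : HasFDerivAt G (ContinuousLinearMap.mul ℝ ℍ[ℝ] (G z) ∘L α) z) :
    HasFDerivAt (fun y => F y * star (G y)) (0 : V →L[ℝ] ℍ[ℝ]) z := by
  have hG' : HasFDerivAt (fun y => star (G y))
      (Quaternion.starCLM ∘L (ContinuousLinearMap.mul ℝ ℍ[ℝ] (G z) ∘L α)) z :=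
    Quaternion.starCLM.hasFDerivAt.comp z hG
  refine (hF.mul' hG').congr_fderiv ?_
  ext1 v
  have h1 : star (α v) = -α v := Quaternion.star_eq_neg.2 (hα v)
  change F z * star (G z * α v) + F z * α v * star (G z) = 0
  rw [star_mul, h1]
  noncomm_ring

variable {n : X → ℍ[ℝ]} {s : X → ℝ} {e : OpenPartialHomeomorph X ℂ} {p : X}

/-- `ψ⁻¹ dψ` is the connection form of the Gauss map `n` at the point `p`. -/
def IsFrameAt (ψ n : X → ℍ[ℝ]) (s : X → ℝ) (p : X) : Prop :=
  ∀ e : OpenPartialHomeomorph X ℂ, IsHolCoord e → p ∈ e.source →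
    HasFDerivAt (fun z => ψ (e.symm z))
      (ContinuousLinearMap.mul ℝ ℍ[ℝ] (ψ p) ∘L coordFrameForm n s e (e p)) (e p)

theorem IsFrameAt.coordD_eq {ψ : X → ℍ[ℝ]} (h : IsFrameAt ψ n s p) (he : IsHolCoord e)
    (hp : p ∈ e.source) (v : ℂ) : coordD e ψ p v = ψ p * coordFrameForm n s e (e p) v := by
  rw [coordD, (h e he hp).fderiv]
  rfl

theorem IsFrameAt.congr {ψ φ : X → ℍ[ℝ]} (c : ℍ[ℝ]) (h : IsFrameAt ψ n s p)
    (hφ : ∀ᶠ q in 𝓝 p, φ q = c * ψ q) : IsFrameAt φ n s p := by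
  intro e he hp
  have h1 := ((ContinuousLinearMap.mul ℝ ℍ[ℝ] c).hasFDerivAt.comp (e p) (h e he hp))
  refine (h1.congr_of_eventuallyEq
    ((eventually_nhds_coord hp hφ).mono fun z hz => hz.2)).congr_fderiv ?_
  ext1 v
  change c * (ψ p * coordFrameForm n s e (e p) v) = φ p * coordFrameForm n s e (e p) v
  rw [hφ.self_of_nhds, mul_assoc]

variable [IsManifold 𝓘(ℂ) ω X]

theorem IsSphereMap.contDiffAt (hn : IsSphereMap n) (he : IsHolCoord e) (hp : p ∈ e.source) :
    ContDiffAt ℝ ∞ (fun z => n (e.symm z)) (e p) := he.contDiffAt_comp_symm hp (hn.smooth p)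

theorem IsSphereMap.hasFDerivAt (hn : IsSphereMap n) (he : IsHolCoord e) (hp : p ∈ e.source) :
    HasFDerivAt (fun z => n (e.symm z)) (coordD e n p) (e p) :=
  ((hn.contDiffAt he hp).differentiableAt (by simp)).hasFDerivAt

theorem IsSphereMap.re_coordD (hn : IsSphereMap n) (he : IsHolCoord e) (hp : p ∈ e.source)
    (v : ℂ) : (coordD e n p v).re = 0 :=
  hasFDerivAt_re (hn.hasFDerivAt he hp) (Eventually.of_forall fun _ => hn.re _) v

theorem IsSphereMap.inner_coordD (hn : IsSphereMap n) (he : IsHolCoord e) (hp : p ∈ e.source)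
    (v : ℂ) : inner ℝ (n p) (coordD e n p v) = 0 := by
  have := inner_fderiv_of_norm (hn.hasFDerivAt he hp) (Eventually.of_forall fun _ => hn.norm _) v
  rwa [e.left_inv hp] at this

/-- A change of holomorphic coordinate acts on differentials by a complex factor, which commutes
with multiplication by `I`. The connection form is thus independent of the coordinate, and one chart
suffices. -/
theorem IsFrameAt.of_coord {ψ : X → ℍ[ℝ]} (hn : IsSphereMap n) {e' : OpenPartialHomeomorph X ℂ}
    (he' : IsHolCoord e') (hp' : p ∈ e'.source)
    (h : HasFDerivAt (fun z => ψ (e'.symm z))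
      (ContinuousLinearMap.mul ℝ ℍ[ℝ] (ψ p) ∘L coordFrameForm n s e' (e' p)) (e' p)) :
    IsFrameAt ψ n s p := by
  intro e he hp
  obtain ⟨c, hc⟩ := he.exists_transition he' hp hp'
  refine (hc ψ _ h).congr_fderiv ?_
  have h1 : ∀ v, coordD e n p v = coordD e' n p (c * v) := fun v => by
    rw [coordD, (hc n _ (hn.hasFDerivAt he' hp')).fderiv]
    rfl
  ext1 v
  change ψ p * coordFrameForm n s e' (e' p) (c * v) = ψ p * coordFrameForm n s e (e p) v
  rw [coordFrameForm_apply hp', coordFrameForm_apply hp, h1, h1, mul_left_comm c I v]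

theorem IsSphereMap.re_coordFrameForm (hn : IsSphereMap n) (he : IsHolCoord e)
    (hp : p ∈ e.source) (v : ℂ) : (coordFrameForm n s e (e p) v).re = 0 := by
  rw [coordFrameForm_apply hp, mul_add, mul_smul_comm, mul_smul_comm, Quaternion.re_add,
    Quaternion.re_smul, Quaternion.re_smul, re_mul_of_inner (hn.re p) (hn.inner_coordD he hp _),
    re_mul_of_inner (hn.re p) (hn.inner_coordD he hp _)]
  simp

/-- A function on a Riemann surface with vanishing differential is locally constant. -/
theorem eventually_eq_of_hasFDerivAt_zero {f : X → ℍ[ℝ]}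
    (h : ∀ᶠ q in 𝓝 p, ∀ e : OpenPartialHomeomorph X ℂ, IsHolCoord e → q ∈ e.source →
      HasFDerivAt (fun z => f (e.symm z)) (0 : ℂ →L[ℝ] ℍ[ℝ]) (e q)) :
    ∀ᶠ q in 𝓝 p, f q = f p := by
  set e := chartAt ℂ p with he
  have hp : p ∈ e.source := mem_chart_source ℂ p
  obtain ⟨r, hr, hball⟩ := Metric.eventually_nhds_iff_ball.1 (eventually_nhds_coord hp h)
  have hder : ∀ z ∈ Metric.ball (e p) r,
      HasFDerivAt (fun z => f (e.symm z)) (0 : ℂ →L[ℝ] ℍ[ℝ]) z := fun z hz => by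
    have := (hball z hz).2 e (isHolCoord_chartAt p) (e.map_target (hball z hz).1)
    rwa [e.right_inv (hball z hz).1] at this
  have hconst : ∀ z ∈ Metric.ball (e p) r, f (e.symm z) = f p := by
    intro z hz
    have := (convex_ball (e p) r).norm_image_sub_le_of_norm_hasFDerivWithin_le
      (f := fun z => f (e.symm z)) (f' := fun _ => 0) (C := 0)
      (fun x hx => (hder x hx).hasFDerivWithinAt) (by simp) (Metric.mem_ball_self hr) hz
    rw [zero_mul, norm_le_zero_iff, sub_eq_zero, e.left_inv hp] at this
    exact this
  filter_upwards [e.open_source.mem_nhds hp,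
    (e.continuousAt hp).eventually_mem (Metric.ball_mem_nhds (e p) hr)] with q hq hq'
  have := hconst (e q) hq'
  rwa [e.left_inv hq] at this

/-- Two frames of the same form differ locally by a constant left factor. This serves both the
gluing of local frames and uniqueness. -/
theorem eventually_mul_star_eq (hn : IsSphereMap n) {φ ψ : X → ℍ[ℝ]}
    (hφ : ∀ᶠ q in 𝓝 p, IsFrameAt φ n s q) (hψ : ∀ᶠ q in 𝓝 p, IsFrameAt ψ n s q) :
    ∀ᶠ q in 𝓝 p, φ q * star (ψ q) = φ p * star (ψ p) := by
  refine eventually_eq_of_hasFDerivAt_zero (f := fun q => φ q * star (ψ q)) ?_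
  filter_upwards [hφ, hψ] with q h1 h2 e he hq
  have h3 := h1 e he hq
  have h4 := h2 e he hq
  refine hasFDerivAt_mul_star_of_frame (F := fun z => φ (e.symm z)) (G := fun z => ψ (e.symm z))
    (hn.re_coordFrameForm he hq (s := s)) ?_ ?_
  · rwa [e.left_inv hq]
  · rwa [e.left_inv hq]

theorem contMDiff_of_isFrameAt (hn : IsSphereMap n)
    (hs : ContMDiff 𝓘(ℝ, ℂ) 𝓘(ℝ, ℝ) ∞ s) {ψ : X → ℍ[ℝ]} (h : ∀ p, IsFrameAt ψ n s p) :
    ContMDiff 𝓘(ℝ, ℂ) 𝓘(ℝ, ℍ[ℝ]) ∞ ψ := by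
  intro p
  set e := chartAt ℂ p with he
  have hhol : IsHolCoord e := isHolCoord_chartAt p
  have hp : p ∈ e.source := mem_chart_source ℂ p
  refine hhol.contMDiffAt_of_comp_symm hp ?_
  refine (contDiffOn_of_frame (α := coordFrameForm n s e) e.open_target ?_ ?_).contDiffAt
    (e.open_target.mem_nhds (e.map_source hp))
  · intro z hz
    have hq := e.map_target hz
    have h1 := hn.contDiffAt hhol hq
    have h2 := hhol.contDiffAt_comp_symm hq (hs (e.symm z))
    rw [e.right_inv hz] at h1 h2
    exact (contDiffAt_frameForm h1 h2).contDiffWithinAt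
  · intro z hz
    have := h (e.symm z) e hhol (e.map_target hz)
    rwa [e.right_inv hz] at this

/-- A flat connection form has local frames. -/
theorem exists_isFrameAt_local (hn : IsSphereMap n)
    (hs : ContMDiff 𝓘(ℝ, ℂ) 𝓘(ℝ, ℝ) ∞ s)
    (hflat : ∀ e : OpenPartialHomeomorph X ℂ, IsHolCoord e → ∀ p ∈ e.source,
      flatDefect (fun z => n (e.symm z)) (fun z => s (e.symm z)) (e p) = 0) (p : X) :
    ∃ U : Set X, IsOpen U ∧ p ∈ U ∧ ∃ ψ : X → UnitQuaternions,
      ∀ q ∈ U, IsFrameAt (fun x => (ψ x : ℍ[ℝ])) n s q := by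
  set e := chartAt ℂ p with he
  have hhol : IsHolCoord e := isHolCoord_chartAt p
  have hp : p ∈ e.source := mem_chart_source ℂ p
  have hsm : ∀ z ∈ e.target, ContDiffAt ℝ ∞ (fun z => n (e.symm z)) z ∧
      ContDiffAt ℝ ∞ (fun z => s (e.symm z)) z := fun z hz => by
    have hq := e.map_target hz
    have h1 := hn.contDiffAt hhol hq
    have h2 := hhol.contDiffAt_comp_symm hq (hs (e.symm z))
    rw [e.right_inv hz] at h1 h2
    exact ⟨h1, h2⟩
  have hept := e.map_source hp
  obtain ⟨r, hr, F, hF0, hF⟩ := exists_local_frame (coordFrameForm n s e) (e p)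
    ((contDiffAt_frameForm (hsm _ hept).1 (hsm _ hept).2).of_le ENat.LEInfty.out) (by
      filter_upwards [e.open_target.mem_nhds hept] with z hz
      have hq := e.map_target hz
      refine (flat_iff_flatDefect (hsm z hz).1 (hsm z hz).2
        (mul_self_eq_neg_one (hn.norm _) (hn.re _)) fun v => ?_).2 ?_
      · have h1 := hn.re_coordD hhol hq v
        have h2 := hn.inner_coordD hhol hq v
        rw [coordD, e.right_inv hz] at h1 h2
        exact anticommute_of_inner (hn.re _) h1 h2
      · have := hflat e hhol _ hq
        rwa [e.right_inv hz] at this)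
  obtain ⟨r', hr', hball⟩ := Metric.nhds_basis_ball.mem_iff.1
    (Filter.inter_mem (e.open_target.mem_nhds hept) (Metric.ball_mem_nhds (e p) hr))
  have hre : ∀ z ∈ e.target, ∀ v, (coordFrameForm n s e z v).re = 0 := fun z hz v => by
    have := hn.re_coordFrameForm hhol (e.map_target hz) v (s := s)
    rwa [e.right_inv hz] at this
  -- `F * star F` has zero derivative and equals `1` at the centre.
  have hFn : ∀ z ∈ Metric.ball (e p) r', ‖F z‖ = 1 := by
    intro z hz
    have h1 := (convex_ball (e p) r').norm_image_sub_le_of_norm_hasFDerivWithin_le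
      (f := fun z => F z * star (F z)) (f' := fun _ => 0) (C := 0)
      (fun x hx => (hasFDerivAt_mul_star_of_frame (hre x (hball hx).1) (hF x (hball hx).2)
        (hF x (hball hx).2)).hasFDerivWithinAt) (by simp) (Metric.mem_ball_self hr') hz
    rw [zero_mul, norm_le_zero_iff, sub_eq_zero, hF0, star_one, one_mul] at h1
    have h2 := congr_arg norm h1
    rw [norm_mul, norm_star, norm_one] at h2
    nlinarith [norm_nonneg (F z)]
  classical
  -- The value `1` where `F` fails to be a unit only makes the map total; it is not taken on the
  -- chosen open set.
  refine ⟨e.source ∩ e ⁻¹' Metric.ball (e p) r', e.isOpen_inter_preimage Metric.isOpen_ball,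
    ⟨hp, Metric.mem_ball_self hr'⟩,
    fun q => if h : ‖F (e q)‖ = 1 then ⟨F (e q), by simp [h]⟩ else ⟨1, by simp⟩, ?_⟩
  rintro q ⟨hq, hq'⟩
  refine IsFrameAt.of_coord hn hhol hq ?_
  have hval : ∀ z ∈ Metric.ball (e p) r',
      (((if h : ‖F (e (e.symm z))‖ = 1 then ⟨F (e (e.symm z)), by simp [h]⟩ else ⟨1, by simp⟩ :
        UnitQuaternions)) : ℍ[ℝ]) = F z := fun z hz => by
    have h1 : e (e.symm z) = z := e.right_inv (hball hz).1
    have h2 : ‖F (e (e.symm z))‖ = 1 := by rw [h1]; exact hFn z hz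
    rw [dif_pos h2]
    change F (e (e.symm z)) = F z
    rw [h1]
  have hvq := hval (e q) hq'
  rw [e.left_inv hq] at hvq
  refine HasFDerivAt.congr_of_eventuallyEq ?_
    (Filter.mem_of_superset (Metric.isOpen_ball.mem_nhds hq') hval)
  beta_reduce
  rw [hvq]
  exact hF _ (hball hq').2

/-- A flat connection form on a simply connected surface has a global frame. -/
theorem exists_isFrameAt [SimplyConnectedSpace X] (hn : IsSphereMap n)
    (hs : ContMDiff 𝓘(ℝ, ℂ) 𝓘(ℝ, ℝ) ∞ s)
    (hflat : ∀ e : OpenPartialHomeomorph X ℂ, IsHolCoord e → ∀ p ∈ e.source,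
      flatDefect (fun z => n (e.symm z)) (fun z => s (e.symm z)) (e p) = 0) :
    ∃ ψ : X → UnitQuaternions, ∀ p, IsFrameAt (fun x => (ψ x : ℍ[ℝ])) n s p := by
  have : LocallyPathConnectedSpace X := ChartedSpace.locallyPathConnectedSpace ℂ X
  choose U hU hmem ψ hψ using exists_isFrameAt_local hn hs hflat
  have hinv : ∀ q : UnitQuaternions, ((q⁻¹ : UnitQuaternions) : ℍ[ℝ]) = star (q : ℍ[ℝ]) :=
    fun q => inv_eq_star_of_norm (by simp)
  obtain ⟨Ψ, hΨ⟩ := exists_glue_of_locally_constant_quotients U hU hmem ψ (by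
    intro i j x hx
    have h1 := eventually_mul_star_eq hn (s := s) (p := x)
      (φ := fun x => (ψ i x : ℍ[ℝ])) (ψ := fun x => (ψ j x : ℍ[ℝ]))
      (Filter.mem_of_superset ((hU i).mem_nhds hx.1) fun q hq => hψ i q hq)
      (Filter.mem_of_superset ((hU j).mem_nhds hx.2) fun q hq => hψ j q hq)
    filter_upwards [h1] with y hy
    apply Subtype.ext
    change (ψ i y : ℍ[ℝ]) * (((ψ j y)⁻¹ : UnitQuaternions) : ℍ[ℝ]) =
      (ψ i x : ℍ[ℝ]) * (((ψ j x)⁻¹ : UnitQuaternions) : ℍ[ℝ])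
    rw [hinv, hinv]
    exact hy)
  refine ⟨Ψ, fun p => ?_⟩
  obtain ⟨g, hg⟩ := hΨ p
  refine (hψ p p (hmem p)).congr (g : ℍ[ℝ]) (hg.mono fun y hy => ?_)
  rw [hy]
  rfl

end Frames

/-! ### The shape operator and its determinant -/

section ShapeOperator

open Complex (I)

/-- The Gram determinant of `P, Q`: their cross product is the determinant times the unit vector
`n`. -/
theorem imTriple_sq {n P Q : ℍ[ℝ]} (h : OrientedTriple n P Q) :
    imTriple P Q n ^ 2 = inner ℝ P P * inner ℝ Q Q - inner ℝ P Q ^ 2 := by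
  have h1 := h.nP
  have h2 := h.nQ
  have h3 := Quaternion.sum_sq_eq_one h.n_norm
  simp only [Quaternion.inner_eq_sum, h.n_re, h.P_re, h.Q_re, imTriple_eq] at *
  linear_combination
    ((P.imI * P.imI + P.imJ * P.imJ + P.imK * P.imK) *
      (Q.imI * Q.imI + Q.imJ * Q.imJ + Q.imK * Q.imK) -
        (P.imI * Q.imI + P.imJ * Q.imJ + P.imK * Q.imK) ^ 2) * h3 -
    ((Q.imI * Q.imI + Q.imJ * Q.imJ + Q.imK * Q.imK) *
      (n.imI * P.imI + n.imJ * P.imJ + n.imK * P.imK)) * h1 +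
    (2 * (P.imI * Q.imI + P.imJ * Q.imJ + P.imK * Q.imK) *
      (n.imI * P.imI + n.imJ * P.imJ + n.imK * P.imK) -
     (P.imI * P.imI + P.imJ * P.imJ + P.imK * P.imK) *
      (n.imI * Q.imI + n.imJ * Q.imJ + n.imK * Q.imK)) * h2

/-- The rotation by `n` of the orthogonal complement of `n`, in the basis `P, Q`. -/
theorem imTriple_smul_mul {n P Q : ℍ[ℝ]} (h : OrientedTriple n P Q) :
    imTriple P Q n • (n * P) = inner ℝ P P • Q - inner ℝ P Q • P ∧
      imTriple P Q n • (n * Q) = inner ℝ P Q • Q - inner ℝ Q Q • P := by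
  have hsq := imTriple_sq h
  constructor
  · rw [← sub_eq_zero]
    refine eq_zero_of_inner_eq_zero h ?_ ?_ ?_ ?_
    · simp only [Quaternion.re_sub, Quaternion.re_smul, re_mul_of_inner h.n_re h.nP, h.P_re, h.Q_re]
      simp
    · simp only [inner_sub_right, inner_smul_right, inner_self_mul _ h.n_re h.P_re, h.nP, h.nQ]
      simp
    · simp only [inner_sub_right, inner_smul_right, inner_mul_self _ h.n_re h.P_re]
      ring
    · simp only [inner_sub_right, inner_smul_right,
        inner_mul_eq_imTriple h.n_re h.P_re h.Q_re, real_inner_comm P Q]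
      linear_combination hsq
  · rw [← sub_eq_zero]
    refine eq_zero_of_inner_eq_zero h ?_ ?_ ?_ ?_
    · simp only [Quaternion.re_sub, Quaternion.re_smul, re_mul_of_inner h.n_re h.nQ, h.P_re, h.Q_re]
      simp
    · simp only [inner_sub_right, inner_smul_right, inner_self_mul _ h.n_re h.Q_re, h.nP, h.nQ]
      simp
    · simp only [inner_sub_right, inner_smul_right,
        inner_mul_eq_neg_imTriple h.n_re h.P_re h.Q_re]
      linear_combination -hsq
    · simp only [inner_sub_right, inner_smul_right, inner_mul_self _ h.n_re h.Q_re,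
        real_inner_comm P Q]
      ring

theorem eq_zero_of_smul_add_smul {n P Q : ℍ[ℝ]} (h : OrientedTriple n P Q) {x y : ℝ}
    (hxy : x • P + y • Q = 0) : x = 0 ∧ y = 0 := by
  have h1 := congr_arg (fun X => inner ℝ X (n * P)) hxy
  have h2 := congr_arg (fun X => inner ℝ X (n * Q)) hxy
  simp only [inner_add_left, real_inner_smul_left, inner_mul_self _ h.n_re h.P_re,
    inner_mul_self _ h.n_re h.Q_re, inner_mul_eq_imTriple h.n_re h.P_re h.Q_re,
    inner_mul_eq_neg_imTriple h.n_re h.P_re h.Q_re, inner_zero_left] at h1 h2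
  have := h.pos.ne'
  constructor
  · simpa [this] using h2
  · simpa [this] using h1

theorem clm_complex_apply {F : Type*} [NormedAddCommGroup F] [NormedSpace ℝ F] (L : ℂ →L[ℝ] F)
    (v : ℂ) : L v = v.re • L 1 + v.im • L I := by
  rw [← map_smul, ← map_smul, ← map_add]
  congr 1
  apply Complex.ext <;> simp

/-- The shape operator of a surface with second fundamental form of the conformal type. -/
theorem exists_shapeOperator {n : ℍ[ℝ]} {α : ℂ →L[ℝ] ℍ[ℝ]} (h : OrientedTriple n (α 1) (α I))
    (s : ℝ) : ∃ A : ℂ →ₗ[ℝ] ℂ,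
      (∀ v, α (A v) = -(s • (n * α (I * v)))) ∧ LinearMap.det A = s ^ 2 := by
  set P := α 1 with hP
  set Q := α I with hQ
  set δ := imTriple P Q n with hδ
  have hne : δ ≠ 0 := h.pos.ne'
  obtain ⟨h1, h2⟩ := imTriple_smul_mul h
  have hsq := imTriple_sq h
  rw [← hδ] at h1 h2 hsq
  have hnP : n * P = δ⁻¹ • (inner ℝ P P • Q - inner ℝ P Q • P) := by
    rw [← h1, inv_smul_smul₀ hne]
  have hnQ : n * Q = δ⁻¹ • (inner ℝ P Q • Q - inner ℝ Q Q • P) := by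
    rw [← h2, inv_smul_smul₀ hne]
  -- This is the matrix of `v ↦ -s n α(Iv)` pulled back by `α`, read off from the rotation formulas
  -- for `n P` and `n Q`. Its determinant is `s²` times the Gram determinant divided by `δ²`.
  let M : Matrix (Fin 2) (Fin 2) ℝ :=
    !![s * δ⁻¹ * inner ℝ Q Q, -(s * δ⁻¹ * inner ℝ P Q);
      -(s * δ⁻¹ * inner ℝ P Q), s * δ⁻¹ * inner ℝ P P]
  let A := Matrix.toLin Complex.basisOneI Complex.basisOneI M
  have hA1 : A 1 = (s * δ⁻¹ * inner ℝ Q Q : ℝ) • (1 : ℂ) +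
      (-(s * δ⁻¹ * inner ℝ P Q) : ℝ) • I := by
    have := Matrix.toLin_self Complex.basisOneI Complex.basisOneI M 0
    simpa [Complex.coe_basisOneI, A, M] using this
  have hAI : A I = (-(s * δ⁻¹ * inner ℝ P Q) : ℝ) • (1 : ℂ) +
      (s * δ⁻¹ * inner ℝ P P : ℝ) • I := by
    have := Matrix.toLin_self Complex.basisOneI Complex.basisOneI M 1
    simpa [Complex.coe_basisOneI, A, M] using this
  refine ⟨A, fun v => ?_, ?_⟩
  · have e1 : α (A 1) = -(s • (n * Q)) := by
      rw [hA1, map_add, map_smul, map_smul, hnQ, ← hP, ← hQ]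
      module
    have e2 : α (A I) = s • (n * P) := by
      rw [hAI, map_add, map_smul, map_smul, hnP, ← hP, ← hQ]
      module
    have hv : v = v.re • (1 : ℂ) + v.im • I := by apply Complex.ext <;> simp
    have hIv : I * v = v.re • I - v.im • (1 : ℂ) := by apply Complex.ext <;> simp
    rw [hIv]
    conv_lhs => rw [hv]
    rw [map_add, map_smul, map_smul, map_add, map_smul, map_smul, e1, e2, map_sub, map_smul,
      map_smul, ← hP, ← hQ, mul_sub, mul_smul_comm, mul_smul_comm]
    module
  · rw [LinearMap.det_toLin, Matrix.det_fin_two_of]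
    field_simp
    rw [hsq]
    ring

end ShapeOperator

/-! ### From a frame to an immersion -/

section Surfaces

open Complex (I)
open Filter Topology

variable {X : Type*} [TopologicalSpace X]

/-- The structure equation is built into the form and uses only `n² = -1`; flatness plays no part.
-/
theorem coordFrameForm_structure {n : X → ℍ[ℝ]} {s : X → ℝ} {e : OpenPartialHomeomorph X ℂ}
    {p : X} (hp : p ∈ e.source) (hn : n p * n p = -1) (v : ℂ) : coordD e n p v =
      n p * (coordFrameForm n s e (e p) v + s p • coordFrameForm n s e (e p) (I * v)) := by
  have h := (structure_eq_of_conn hn (s p) (u := coordD e n p v) (v := coordD e n p (I * v))).1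
  have hI : coordD e n p (I * (I * v)) = -coordD e n p v := by
    rw [← mul_assoc, Complex.I_mul_I, neg_one_mul, map_neg]
  rw [coordFrameForm_apply hp, coordFrameForm_apply hp, hI, smul_neg, ← sub_eq_add_neg]
  exact h

variable [ChartedSpace ℂ X]

theorem IsSphereMap.mul_self {n : X → ℍ[ℝ]} (hn : IsSphereMap n) (p : X) : n p * n p = -1 :=
  mul_self_eq_neg_one (hn.norm p) (hn.re p)

variable [IsManifold 𝓘(ℂ) ω X] {n : X → ℍ[ℝ]} {s : X → ℝ}
  {e : OpenPartialHomeomorph X ℂ} {p : X}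

theorem IsSphereMap.inner_coordFrameForm (hn : IsSphereMap n) (he : IsHolCoord e)
    (hp : p ∈ e.source) (v : ℂ) : inner ℝ (n p) (coordFrameForm n s e (e p) v) = 0 := by
  rw [coordFrameForm_apply hp]
  refine inner_self_mul _ (hn.re p) ?_
  rw [Quaternion.re_add, Quaternion.re_smul, Quaternion.re_smul, hn.re_coordD he hp,
    hn.re_coordD he hp]
  simp

theorem IsSphereMap.orientedTriple (hn : IsSphereMap n) (he : IsHolCoord e) (hp : p ∈ e.source)
    (hpos : 0 < imTriple (n p) (coordD e n p 1) (coordD e n p I)) :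
    OrientedTriple (n p) (coordFrameForm n s e (e p) 1) (coordFrameForm n s e (e p) I) where
  n_re := hn.re p
  n_norm := hn.norm p
  P_re := hn.re_coordFrameForm he hp 1
  Q_re := hn.re_coordFrameForm he hp I
  nP := hn.inner_coordFrameForm he hp 1
  nQ := hn.inner_coordFrameForm he hp I
  pos := by
    have hI : coordFrameForm n s e (e p) (I * I) = -coordFrameForm n s e (e p) 1 := by
      rw [Complex.I_mul_I, map_neg]
    rw [coordFrameForm_structure hp (hn.mul_self p) (s := s) 1,
      coordFrameForm_structure hp (hn.mul_self p) (s := s) I, mul_one, hI, smul_neg,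
      ← sub_eq_add_neg, imTriple_rotate (s p) (hn.re p) (hn.norm p)
        (hn.re_coordFrameForm he hp 1) (hn.re_coordFrameForm he hp I)] at hpos
    exact (mul_pos_iff_of_pos_left (by positivity)).1 hpos

/-- The differential of the unit normal `ψ n` of a frame. -/
theorem IsFrameAt.coordD_mul {ψ : X → ℍ[ℝ]} (h : IsFrameAt ψ n s p) (hn : IsSphereMap n)
    (he : IsHolCoord e) (hp : p ∈ e.source) (v : ℂ) : coordD e (fun q => ψ q * n q) p v =
      ψ p * (s p • (n p * coordFrameForm n s e (e p) (I * v))) := by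
  have h1 := (h e he hp).mul' (hn.hasFDerivAt he hp)
  refine (congr_arg (fun L : ℂ →L[ℝ] ℍ[ℝ] => L v) h1.fderiv).trans ?_
  change ψ (e.symm (e p)) * coordD e n p v + ψ p * coordFrameForm n s e (e p) v * n (e.symm (e p)) = _
  rw [e.left_inv hp, coordFrameForm_structure hp (hn.mul_self p) (s := s) v, mul_assoc,
    anticommute_of_inner (hn.re p) (hn.re_coordFrameForm he hp v)
      (hn.inner_coordFrameForm he hp v), ← mul_add, mul_add (n p), mul_smul_comm]
  congr 1
  abel

/-- Everything follows from `dψ = ψα` and `d(ψn) = s ψ n (α∘J)`, as left multiplication by the unit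
quaternion `ψ` is an isometry. -/
theorem hasGaussMap_of_isFrameAt {g : X → OnePoint ℂ} (hg : SmoothToSphere g)
    (hs : ContMDiff 𝓘(ℝ, ℂ) 𝓘(ℝ, ℝ) ∞ s) (hs0 : ∀ p, 0 < s p)
    (hpos : ∀ e : OpenPartialHomeomorph X ℂ, IsHolCoord e → ∀ p ∈ e.source,
      0 < imTriple (invStereo (g p)) (coordD e (fun q => invStereo (g q)) p 1)
        (coordD e (fun q => invStereo (g q)) p I))
    {ψ : X → UnitQuaternions}
    (h : ∀ p, IsFrameAt (fun x => (ψ x : ℍ[ℝ])) (fun q => invStereo (g q)) s p) :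
    HasGaussMapAndConformalStructure ψ (fun q => (ψ q : ℍ[ℝ]) * invStereo (g q)) g ∧
      IsExtrinsicCurvature ψ (fun q => (ψ q : ℍ[ℝ]) * invStereo (g q)) (fun q => s q ^ 2) := by
  have hn := hg.isSphereMap
  set n : X → ℍ[ℝ] := fun q => invStereo (g q) with hndef
  have hψ : ∀ p, ‖(ψ p : ℍ[ℝ])‖ = 1 := fun p => by simp
  have hsm := contMDiff_of_isFrameAt hn hs h
  have hinv : ∀ (p : X) (q : ℍ[ℝ]), (ψ p : ℍ[ℝ])⁻¹ * ((ψ p : ℍ[ℝ]) * q) = q := fun p q => by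
    rw [inv_eq_star_of_norm (hψ p), ← mul_assoc, star_mul_self_of_norm (hψ p), one_mul]
  have hT := fun e he p hp => hn.orientedTriple (s := s) he hp (hpos e he p hp)
  have hD := fun e he p hp v => (h p).coordD_eq (e := e) he hp v
  have hDN := fun e he p hp v => (h p).coordD_mul (e := e) hn he hp v
  refine ⟨⟨⟨hsm, fun e he p hp => ?_⟩, ⟨?_, fun p => ?_, fun p => ?_, fun e he p hp v => ?_,
    fun e he p hp => ?_⟩, fun p => ?_, fun e he p hp => ?_⟩, fun e he p hp => ?_⟩
  · rw [injective_iff_map_eq_zero]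
    intro v hv
    rw [hD e he p hp, mul_eq_zero, clm_complex_apply] at hv
    have hv' := hv.resolve_left (norm_ne_zero_iff.1 (by rw [hψ]; norm_num))
    obtain ⟨h1, h2⟩ := eq_zero_of_smul_add_smul (hT e he p hp) hv'
    exact Complex.ext h1 h2
  · exact fun p => (isHolCoord_chartAt p).contMDiffAt_of_comp_symm (mem_chart_source ℂ p)
      (((isHolCoord_chartAt p).contDiffAt_comp_symm (mem_chart_source ℂ p) (hsm p)).mul
        (hn.contDiffAt (isHolCoord_chartAt p) (mem_chart_source ℂ p)))
  · rw [norm_mul, hψ, hn.norm, one_mul]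
  · have := inner_mul_left_of_norm (hψ p) (n p) 1
    rw [mul_one] at this
    rw [this, Quaternion.inner_eq_sum, hn.re]
    simp
  · rw [hD e he p hp, inner_mul_left_of_norm (hψ p)]
    exact hn.inner_coordFrameForm he hp v
  · rw [hD e he p hp, hD e he p hp, hinv, hinv, hinv]
    exact (hT e he p hp).pos
  · rw [hinv, stereoNorth_invStereo]
  · have ht := hT e he p hp
    -- The value comes from `II(1, 1) = -s⟨n α(I), α(1)⟩`, which is `s` times the determinant and
    -- must equal `2ρ`.
    refine ⟨s p * imTriple (coordFrameForm n s e (e p) 1) (coordFrameForm n s e (e p) I) (n p) / 2,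
      half_pos (mul_pos (hs0 p) ht.pos), fun v w => ?_⟩
    rw [secondFundamentalForm, hDN e he p hp, hD e he p hp, ← mul_neg,
      inner_mul_left_of_norm (hψ p), inner_neg_left, real_inner_smul_left,
      clm_complex_apply _ (I * v), clm_complex_apply _ w, mul_add, mul_smul_comm, mul_smul_comm]
    simp only [inner_add_left, inner_add_right, real_inner_smul_left, real_inner_smul_right]
    rw [real_inner_comm, inner_mul_self _ ht.n_re ht.P_re,
      real_inner_comm _ (n p * coordFrameForm n s e (e p) I),
      inner_mul_eq_neg_imTriple ht.n_re ht.P_re ht.Q_re,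
      real_inner_comm _ (n p * coordFrameForm n s e (e p) 1),
      inner_mul_eq_imTriple ht.n_re ht.P_re ht.Q_re,
      real_inner_comm _ (n p * coordFrameForm n s e (e p) I),
      inner_mul_self _ ht.n_re ht.Q_re, Complex.inner]
    simp
    ring
  · obtain ⟨A, hA, hdet⟩ := exists_shapeOperator (hT e he p hp) (s p)
    refine ⟨A, fun v => ?_, hdet.symm⟩
    rw [hD e he p hp, hDN e he p hp, hA, mul_neg]

/-- Injectivity of `dψ` determines the shape operator. -/
theorem IsExtrinsicCurvature.unique {ψ : X → UnitQuaternions} {N : X → ℍ[ℝ]} {K K' : X → ℝ}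
    (hψ : IsSmoothImmersion ψ) (h : IsExtrinsicCurvature ψ N K)
    (h' : IsExtrinsicCurvature ψ N K') : K = K' := by
  funext p
  obtain ⟨A, hA, hK⟩ := h _ (isHolCoord_chartAt p) p (mem_chart_source ℂ p)
  obtain ⟨B, hB, hK'⟩ := h' _ (isHolCoord_chartAt p) p (mem_chart_source ℂ p)
  have : A = B := LinearMap.ext fun v =>
    hψ.injective _ (isHolCoord_chartAt p) p (mem_chart_source ℂ p) ((hA v).trans (hB v).symm)
  rw [hK, hK', this]

end Surfaces

/-! ### From an immersion to a flat form -/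

section Necessity

open Complex (I)
open Filter Topology

variable {X : Type*} [TopologicalSpace X] {ψ : X → UnitQuaternions}
  {e : OpenPartialHomeomorph X ℂ} {p : X}

/-- The left translate to the identity of the differential of a map into the sphere. -/
def leftForm (ψ : X → UnitQuaternions) (e : OpenPartialHomeomorph X ℂ) (p : X) (v : ℂ) : ℍ[ℝ] :=
  star (ψ p : ℍ[ℝ]) * coordD e (fun q => (ψ q : ℍ[ℝ])) p v

theorem mul_leftForm (v : ℂ) :
    (ψ p : ℍ[ℝ]) * leftForm ψ e p v = coordD e (fun q => (ψ q : ℍ[ℝ])) p v := by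
  rw [leftForm, ← mul_assoc, mul_star_self_of_norm (by simp), one_mul]

variable [ChartedSpace ℂ X] {g : X → OnePoint ℂ} {N : X → ℍ[ℝ]}

/-- `ψ⁻¹N` is an imaginary unit, hence recovered from its stereographic projection. -/
theorem HasGaussMapAndConformalStructure.eq_mul (H : HasGaussMapAndConformalStructure ψ N g) :
    N = fun q => (ψ q : ℍ[ℝ]) * invStereo (g q) := by
  funext p
  have hψ : ‖(ψ p : ℍ[ℝ])‖ = 1 := by simp
  have hinv := inv_eq_star_of_norm hψ
  have h1 : ((ψ p : ℍ[ℝ])⁻¹ * N p).re = 0 := by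
    rw [hinv, re_star_mul, real_inner_comm, H.unitNormal.tangent]
  have h2 : ‖(ψ p : ℍ[ℝ])⁻¹ * N p‖ = 1 := by
    rw [norm_mul, norm_inv, hψ, H.unitNormal.unit]; norm_num
  rw [H.gaussMap p, invStereo_stereoNorth h1 h2, ← mul_assoc, hinv, mul_star_self_of_norm hψ,
    one_mul]

theorem IsFrameAt.leftForm_eq {n : X → ℍ[ℝ]} {s : X → ℝ}
    (h : IsFrameAt (fun x => (ψ x : ℍ[ℝ])) n s p) (he : IsHolCoord e) (hp : p ∈ e.source) (v : ℂ) :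
    leftForm ψ e p v = coordFrameForm n s e (e p) v := by
  rw [leftForm, h.coordD_eq he hp, ← mul_assoc, star_mul_self_of_norm (by simp), one_mul]

variable [IsManifold 𝓘(ℂ) ω X]

theorem IsSmoothImmersion.contDiffAt (hψ : IsSmoothImmersion ψ) (he : IsHolCoord e)
    (hp : p ∈ e.source) : ContDiffAt ℝ ∞ (fun z => (ψ (e.symm z) : ℍ[ℝ])) (e p) :=
  he.contDiffAt_comp_symm hp (hψ.smooth p)

theorem HasGaussMapAndConformalStructure.orientedTriple (hg : SmoothToSphere g)
    (H : HasGaussMapAndConformalStructure ψ N g) (he : IsHolCoord e) (hp : p ∈ e.source) :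
    OrientedTriple (invStereo (g p)) (leftForm ψ e p 1) (leftForm ψ e p I) := by
  have hn := hg.isSphereMap
  have hψ : ‖(ψ p : ℍ[ℝ])‖ = 1 := by simp
  have hN : N p = ψ p * invStereo (g p) := congr_fun H.eq_mul p
  have hre : ∀ v, (leftForm ψ e p v).re = 0 := fun v => by
    have h1 : HasFDerivAt (fun z => (ψ (e.symm z) : ℍ[ℝ])) (coordD e (fun q => (ψ q : ℍ[ℝ])) p)
        (e p) := ((H.immersion.contDiffAt he hp).differentiableAt (by simp)).hasFDerivAt
    have h2 := inner_fderiv_of_norm h1 (Eventually.of_forall fun _ => by simp) v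
    rw [e.left_inv hp] at h2
    rw [leftForm, re_star_mul, h2]
  have hin : ∀ v, inner ℝ (invStereo (g p)) (leftForm ψ e p v) = 0 := fun v => by
    rw [← inner_mul_left_of_norm hψ, mul_leftForm, ← hN]
    exact H.unitNormal.normal e he p hp v
  refine ⟨hn.re p, hn.norm p, hre 1, hre I, hin 1, hin I, ?_⟩
  have := H.unitNormal.oriented e he p hp
  rw [hN, inv_eq_star_of_norm hψ, ← mul_assoc, star_mul_self_of_norm hψ, one_mul] at this
  exact this

theorem HasGaussMapAndConformalStructure.exists_structure_eq (hg : SmoothToSphere g)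
    (H : HasGaussMapAndConformalStructure ψ N g) (he : IsHolCoord e) (hp : p ∈ e.source) :
    ∃ s : ℝ, 0 < s ∧
      coordD e (fun q => invStereo (g q)) p 1 =
        invStereo (g p) * (leftForm ψ e p 1 + s • leftForm ψ e p I) ∧
      coordD e (fun q => invStereo (g q)) p I =
        invStereo (g p) * (leftForm ψ e p I - s • leftForm ψ e p 1) := by
  have hn := hg.isSphereMap
  have hψ : ‖(ψ p : ℍ[ℝ])‖ = 1 := by simp
  have hT := H.orientedTriple hg he hp
  obtain ⟨ρ, hρ, hII⟩ := H.conformal e he p hp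
  have hDN : ∀ v, coordD e N p v = ψ p * (coordD e (fun q => invStereo (g q)) p v +
      leftForm ψ e p v * invStereo (g p)) := fun v => by
    have h1 := (((H.immersion.contDiffAt he hp).differentiableAt (by simp)).hasFDerivAt).mul'
      (hn.hasFDerivAt he hp)
    rw [H.eq_mul]
    refine (congr_arg (fun L : ℂ →L[ℝ] ℍ[ℝ] => L v) h1.fderiv).trans ?_
    change (ψ (e.symm (e p)) : ℍ[ℝ]) * coordD e (fun q => invStereo (g q)) p v +
      coordD e (fun q => (ψ q : ℍ[ℝ])) p v * invStereo (g (e.symm (e p))) = _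
    rw [e.left_inv hp, mul_add, ← mul_assoc _ (leftForm ψ e p v), mul_leftForm]
  have hII' : ∀ v w, inner ℝ (-(coordD e (fun q => invStereo (g q)) p v +
      leftForm ψ e p v * invStereo (g p))) (leftForm ψ e p w) = 2 * ρ * inner ℝ v w :=
    fun v w => by
      rw [← hII v w, secondFundamentalForm, hDN, ← mul_leftForm, ← mul_neg,
        inner_mul_left_of_norm hψ]
  refine ⟨2 * ρ / imTriple (leftForm ψ e p 1) (leftForm ψ e p I) (invStereo (g p)),
    div_pos (by positivity) hT.pos, structure_eq_of_conformal hT (hn.re_coordD he hp 1)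
      (hn.re_coordD he hp I) (hn.inner_coordD he hp 1) (hn.inner_coordD he hp I) ?_ ?_ ?_ ?_⟩
  all_goals rw [hII', Complex.inner]; simp

theorem HasGaussMapAndConformalStructure.exists_isFrameAt (hg : SmoothToSphere g)
    (H : HasGaussMapAndConformalStructure ψ N g) :
    ∃ s : X → ℝ, (∀ p, 0 < s p) ∧
      ∀ p, IsFrameAt (fun x => (ψ x : ℍ[ℝ])) (fun q => invStereo (g q)) s p := by
  have hn := hg.isSphereMap
  choose s hs0 hu hv using fun p =>
    H.exists_structure_eq hg (isHolCoord_chartAt p) (mem_chart_source ℂ p)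
  refine ⟨s, hs0, fun p => ?_⟩
  have he := isHolCoord_chartAt (X := X) p
  have hp := mem_chart_source ℂ p
  refine IsFrameAt.of_coord hn he hp
    (((H.immersion.contDiffAt he hp).differentiableAt (by simp)).hasFDerivAt.congr_fderiv ?_)
  obtain ⟨h1, h2⟩ := mul_conn_eq (P := leftForm ψ (chartAt ℂ p) p 1)
    (Q := leftForm ψ (chartAt ℂ p) p I) (hn.mul_self p) (s p)
  rw [← hu p, ← hv p] at h1 h2
  have hI : coordD (chartAt ℂ p) (fun q => invStereo (g q)) p (I * I) =
      -coordD (chartAt ℂ p) (fun q => invStereo (g q)) p 1 := by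
    rw [Complex.I_mul_I, map_neg]
  ext1 v
  change coordD (chartAt ℂ p) (fun q => (ψ q : ℍ[ℝ])) p v =
    (ψ p : ℍ[ℝ]) * coordFrameForm (fun q => invStereo (g q)) s (chartAt ℂ p) (chartAt ℂ p p) v
  rw [clm_complex_apply, clm_complex_apply (coordFrameForm _ _ _ _), coordFrameForm_apply hp,
    coordFrameForm_apply hp, mul_one, hI, smul_neg, ← sub_eq_add_neg, h1, h2, mul_add,
    mul_smul_comm, mul_smul_comm, mul_leftForm, mul_leftForm]

theorem HasGaussMapAndConformalStructure.imTriple_pos (hg : SmoothToSphere g)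
    (H : HasGaussMapAndConformalStructure ψ N g) (he : IsHolCoord e) (hp : p ∈ e.source) :
    0 < imTriple (invStereo (g p)) (coordD e (fun q => invStereo (g q)) p 1)
      (coordD e (fun q => invStereo (g q)) p I) := by
  obtain ⟨s, -, h1, h2⟩ := H.exists_structure_eq hg he hp
  have hT := H.orientedTriple hg he hp
  rw [h1, h2, imTriple_rotate s hT.n_re hT.n_norm hT.P_re hT.Q_re]
  exact mul_pos (by positivity) hT.pos

/-- The number `s` was obtained point by point, so smoothness must be shown. Pairing `n_x = n(P +
sQ)` with `P` yields `s = -⟨P, n_x⟩/⟨Q, nP⟩`, a quotient of smooth functions with nonvanishing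
denominator. -/
theorem contMDiff_of_hasGaussMap (hg : SmoothToSphere g)
    (H : HasGaussMapAndConformalStructure ψ N g) {s : X → ℝ}
    (hs : ∀ p, IsFrameAt (fun x => (ψ x : ℍ[ℝ])) (fun q => invStereo (g q)) s p) :
    ContMDiff 𝓘(ℝ, ℂ) 𝓘(ℝ, ℝ) ∞ s := by
  have hn := hg.isSphereMap
  intro p
  set e := chartAt ℂ p with he_def
  have he : IsHolCoord e := isHolCoord_chartAt p
  have hp : p ∈ e.source := mem_chart_source ℂ p
  have key : ∀ q ∈ e.source, s q =
      -inner ℝ (leftForm ψ e q 1) (coordD e (fun q => invStereo (g q)) q 1) *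
        (inner ℝ (leftForm ψ e q I) (invStereo (g q) * leftForm ψ e q 1))⁻¹ := by
    intro q hq
    have hT := H.orientedTriple hg he hq
    have h1 := coordFrameForm_structure (n := fun q => invStereo (g q)) (s := s) hq (hn.mul_self q) 1
    rw [← (hs q).leftForm_eq he hq, ← (hs q).leftForm_eq he hq, mul_one] at h1
    rw [h1, inner_mul_eq_imTriple hT.n_re hT.P_re hT.Q_re, mul_add, mul_smul_comm,
      inner_add_right, real_inner_smul_right, inner_mul_self _ hT.n_re hT.P_re,
      inner_mul_eq_neg_imTriple hT.n_re hT.P_re hT.Q_re]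
    have := hT.pos.ne'
    field_simp
    ring
  refine he.contMDiffAt_of_comp_symm hp ?_
  have hn1 := hn.contDiffAt he hp
  have hψ1 := H.immersion.contDiffAt he hp
  have hdn : ∀ v, ContDiffAt ℝ ∞ (fun z => fderiv ℝ (fun z => invStereo (g (e.symm z))) z v) (e p) :=
    fun v => (hn1.fderiv_right (m := ∞) (by simp)).clm_apply contDiffAt_const
  have hdψ : ∀ v, ContDiffAt ℝ ∞ (fun z => star (ψ (e.symm z) : ℍ[ℝ]) *
      fderiv ℝ (fun z => (ψ (e.symm z) : ℍ[ℝ])) z v) (e p) :=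
    fun v => (Quaternion.starCLM.contDiff.contDiffAt.comp (e p) hψ1).mul
      ((hψ1.fderiv_right (m := ∞) (by simp)).clm_apply contDiffAt_const)
  have hne : inner ℝ (leftForm ψ e p I) (invStereo (g p) * leftForm ψ e p 1) ≠ 0 := by
    have hT := H.orientedTriple hg he hp
    rw [inner_mul_eq_imTriple hT.n_re hT.P_re hT.Q_re]
    exact hT.pos.ne'
  have hden := (hdψ I).inner ℝ (hn1.mul (hdψ 1))
  have hnum := ((hdψ 1).inner ℝ (hdn 1)).neg
  refine (hnum.mul (hden.inv ?_)).congr_of_eventuallyEq ?_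
  · change inner ℝ (star (ψ (e.symm (e p)) : ℍ[ℝ]) * coordD e (fun q => (ψ q : ℍ[ℝ])) p I)
      (invStereo (g (e.symm (e p))) *
        (star (ψ (e.symm (e p)) : ℍ[ℝ]) * coordD e (fun q => (ψ q : ℍ[ℝ])) p 1)) ≠ 0
    rw [e.left_inv hp]
    exact hne
  · filter_upwards [e.open_target.mem_nhds (e.map_source hp)] with z hz
    have h := key _ (e.map_target hz)
    rw [leftForm, leftForm, coordD, coordD, e.right_inv hz] at h
    exact h

/-- Flatness is the symmetry of the second derivative of `F`, after cancelling `F` from the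
derivative of `F α`. -/
theorem symmetric_of_frame {V H : Type*} [NormedAddCommGroup V] [NormedSpace ℝ V]
    [NormedRing H] [NormedAlgebra ℝ H] {F : V → H} {α : V → V →L[ℝ] H} {z : V}
    (hα : DifferentiableAt ℝ α z) (hF0 : ∀ x y, F z * x = F z * y → x = y)
    (hF : ∀ᶠ y in 𝓝 z, HasFDerivAt F (ContinuousLinearMap.mul ℝ H (F y) ∘L α y) y) (u v : V) :
    fderiv ℝ α z u v + α z u * α z v = fderiv ℝ α z v u + α z v * α z u := by
  have h1 : HasFDerivAt (fun y => ContinuousLinearMap.mul ℝ H (F y)) _ z :=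
    (ContinuousLinearMap.mul ℝ H).hasFDerivAt.comp z hF.self_of_nhds
  have h2 := second_derivative_symmetric_of_eventually hF (h1.clm_comp hα.hasFDerivAt) u v
  apply hF0
  simpa [mul_add, mul_assoc] using h2

theorem flatDefect_eq_zero_of_isFrameAt {n : X → ℍ[ℝ]} {s : X → ℝ} (hn : IsSphereMap n)
    (hs : ContMDiff 𝓘(ℝ, ℂ) 𝓘(ℝ, ℝ) ∞ s)
    (h : ∀ p, IsFrameAt (fun x => (ψ x : ℍ[ℝ])) n s p) (he : IsHolCoord e) (hp : p ∈ e.source) :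
    flatDefect (fun z => n (e.symm z)) (fun z => s (e.symm z)) (e p) = 0 := by
  have h1 := hn.contDiffAt he hp
  have h2 := he.contDiffAt_comp_symm hp (hs p)
  refine (flat_iff_flatDefect h1 h2 (hn.mul_self _) fun v => ?_).1
    (symmetric_of_frame (F := fun z => (ψ (e.symm z) : ℍ[ℝ]))
      ((contDiffAt_frameForm h1 h2).differentiableAt (by simp)) (fun x y hxy => ?_) ?_)
  · have h3 := hn.inner_coordD he hp v
    have h4 := hn.re_coordD he hp v
    rw [e.left_inv hp]
    exact anticommute_of_inner (hn.re _) h4 h3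
  · exact mul_left_cancel₀ (norm_ne_zero_iff.1 (by simp)) hxy
  · filter_upwards [e.open_target.mem_nhds (e.map_source hp)] with z hz
    have := h (e.symm z) e he (e.map_target hz)
    rwa [e.right_inv hz] at this

end Necessity

/-! ### Translation into conditions (1) and (2) -/

section GaussEquation

open Complex (I)
open Filter Topology

variable {X : Type*} [TopologicalSpace X] [ChartedSpace ℂ X]
  {g : X → OnePoint ℂ} {e : OpenPartialHomeomorph X ℂ} {p : X}

theorem eventually_invStereo_coord (hg : SmoothToSphere g) (hp : p ∈ e.source) :
    ∀ᶠ z in 𝓝 (e p),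
      invStereo (g (e.symm z)) = sigmaMap (repSign g p) (sphereRep g p (e.symm z)) :=
  (eventually_nhds_coord hp (invStereo_eventuallyEq hg.1 p)).mono fun _ hz => hz.2

theorem contMDiff_sqrt {K : X → ℝ} (hK : ContMDiff 𝓘(ℝ, ℂ) 𝓘(ℝ, ℝ) ∞ K) (hpos : ∀ p, 0 < K p) :
    ContMDiff 𝓘(ℝ, ℂ) 𝓘(ℝ, ℝ) ∞ (fun p => Real.sqrt (K p)) := fun p =>
  (Real.contDiffAt_sqrt (hpos p).ne').contMDiffAt.comp p (hK p)

theorem contMDiff_of_sqrt {K : X → ℝ} (hpos : ∀ p, 0 < K p)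
    (hs : ContMDiff 𝓘(ℝ, ℂ) 𝓘(ℝ, ℝ) ∞ fun p => Real.sqrt (K p)) :
    ContMDiff 𝓘(ℝ, ℂ) 𝓘(ℝ, ℝ) ∞ K := by
  have h : K = (fun t : ℝ => t ^ 2) ∘ fun p => Real.sqrt (K p) :=
    funext fun p => (Real.sq_sqrt (hpos p).le).symm
  have h2 : ContDiff ℝ ∞ (fun t : ℝ => t ^ 2) := by fun_prop
  rw [h]
  exact h2.contMDiff.comp hs

variable [IsManifold 𝓘(ℂ) ω X]

theorem SmoothToSphere.contDiffAt_sphereRep (hg : SmoothToSphere g) (he : IsHolCoord e)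
    (hp : p ∈ e.source) : ContDiffAt ℝ ∞ (fun z => sphereRep g p (e.symm z)) (e p) :=
  he.contDiffAt_comp_symm hp (hg.2 p)

theorem imTriple_pos_iff (hg : SmoothToSphere g) (he : IsHolCoord e) (hp : p ∈ e.source) :
    0 < imTriple (invStereo (g p)) (coordD e (fun q => invStereo (g q)) p 1)
      (coordD e (fun q => invStereo (g q)) p I) ↔ 0 < negJacobian e (sphereRep g p) p := by
  have hw := (hg.contDiffAt_sphereRep he hp).differentiableAt (by simp)
  have hm := (hg.isSphereMap.contDiffAt he hp).differentiableAt (by simp)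
  have h := eventually_invStereo_coord hg hp
  have hd : ∀ v, coordD e (fun q => invStereo (g q)) p v =
      dSigma (repSign g p) (sphereRep g p p) (coordD e (sphereRep g p) p v) := fun v => by
    have := fderiv_of_eq_sigmaMap hm hw h v
    rwa [e.left_inv hp] at this
  rw [(invStereo_eventuallyEq hg.1 p).self_of_nhds, hd, hd, imTriple_sigmaMap (repSign_sq g p),
    negJacobian_eq]
  exact mul_pos_iff_of_pos_left (by positivity)

theorem flatDefect_eq_zero_iff (hg : SmoothToSphere g) {K : X → ℝ}
    (hK : ContMDiff 𝓘(ℝ, ℂ) 𝓘(ℝ, ℝ) ∞ K) (hpos : 0 < K p) (he : IsHolCoord e)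
    (hp : p ∈ e.source) (hJ : 0 < negJacobian e (sphereRep g p) p) :
    flatDefect (fun z => invStereo (g (e.symm z))) (fun z => Real.sqrt (K (e.symm z))) (e p) = 0 ↔
      GaussEquationAt e (sphereRep g p) K p := by
  have hw := hg.contDiffAt_sphereRep he hp
  have hm := hg.isSphereMap.contDiffAt he hp
  rw [gaussEquationAt_iff hp hw ((he.contDiffAt_comp_symm hp (hK p)).differentiableAt (by simp))
    hpos hJ, flatDefect_eq_dSigma (repSign_sq g p) _ hm hw (eventually_invStereo_coord hg hp)]
  refine ⟨dSigma_eq_zero (repSign_sq g p), fun h => ?_⟩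
  rw [h]
  simpa using dSigma_smul (repSign g p) (sphereRep g p (e.symm (e p))) 0 0

end GaussEquation

/-! ### Existence, necessity and uniqueness -/

section Main

open Complex (I)
open Filter Topology

variable {X : Type*} [TopologicalSpace X] [ChartedSpace ℂ X] [IsManifold 𝓘(ℂ) ω X]
  {g : X → OnePoint ℂ} {ψ : X → UnitQuaternions} {N : X → ℍ[ℝ]} {K : X → ℝ}

theorem exists_immersion_of_solvesGaussEquation [SimplyConnectedSpace X] (hg : SmoothToSphere g)
    (hJ : NegJacobianPos g) (hK : SolvesGaussEquation g K) :
    ∃ (ψ : X → UnitQuaternions) (N : X → ℍ[ℝ]),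
      HasGaussMapAndConformalStructure ψ N g ∧ IsExtrinsicCurvature ψ N K := by
  have hs := contMDiff_sqrt hK.smooth hK.pos
  obtain ⟨ψ, hψ⟩ := exists_isFrameAt hg.isSphereMap hs fun e he p hp =>
    (flatDefect_eq_zero_iff hg hK.smooth (hK.pos p) he hp (hJ e he p hp)).2 (hK.eqn e he p hp)
  have h := hasGaussMap_of_isFrameAt hg hs (fun p => Real.sqrt_pos.2 (hK.pos p))
    (fun e he p hp => (imTriple_pos_iff hg he hp).2 (hJ e he p hp)) hψ
  simp only [Real.sq_sqrt (hK.pos _).le] at h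
  exact ⟨ψ, _, h⟩

theorem HasGaussMapAndConformalStructure.negJacobianPos (hg : SmoothToSphere g)
    (H : HasGaussMapAndConformalStructure ψ N g) : NegJacobianPos g := fun _ he _ hp =>
  (imTriple_pos_iff hg he hp).1 (H.imTriple_pos hg he hp)

theorem HasGaussMapAndConformalStructure.isExtrinsicCurvature_sq (hg : SmoothToSphere g)
    (H : HasGaussMapAndConformalStructure ψ N g) {s : X → ℝ} (hs0 : ∀ p, 0 < s p)
    (hs : ∀ p, IsFrameAt (fun x => (ψ x : ℍ[ℝ])) (fun q => invStereo (g q)) s p) :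
    IsExtrinsicCurvature ψ N (fun q => s q ^ 2) := by
  rw [H.eq_mul]
  exact (hasGaussMap_of_isFrameAt hg (contMDiff_of_hasGaussMap hg H hs) hs0
    (fun e he p hp => H.imTriple_pos hg he hp) hs).2

/-- The curvature is `s²` for the positive `s` of the structure equation, so `s = √K` and the form
depends only on `g` and `K`. -/
theorem HasGaussMapAndConformalStructure.isFrameAt_sqrt (hg : SmoothToSphere g)
    (H : HasGaussMapAndConformalStructure ψ N g) (hK : IsExtrinsicCurvature ψ N K) :
    (∀ p, 0 < K p) ∧ ∀ p, IsFrameAt (fun x => (ψ x : ℍ[ℝ])) (fun q => invStereo (g q))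
      (fun q => Real.sqrt (K q)) p := by
  obtain ⟨s, hs0, hs⟩ := H.exists_isFrameAt hg
  rw [hK.unique H.immersion (H.isExtrinsicCurvature_sq hg hs0 hs)]
  refine ⟨fun p => pow_pos (hs0 p) 2, ?_⟩
  simpa only [Real.sqrt_sq (hs0 _).le] using hs

theorem HasGaussMapAndConformalStructure.solvesGaussEquation (hg : SmoothToSphere g)
    (H : HasGaussMapAndConformalStructure ψ N g) (hK : IsExtrinsicCurvature ψ N K) :
    SolvesGaussEquation g K := by
  obtain ⟨hpos, hfr⟩ := H.isFrameAt_sqrt hg hK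
  have hs := contMDiff_of_hasGaussMap hg H hfr
  have hsm := contMDiff_of_sqrt hpos hs
  refine ⟨hsm, hpos, fun e he p hp => ?_⟩
  have h1 := flatDefect_eq_zero_of_isFrameAt hg.isSphereMap hs hfr he hp
  exact (flatDefect_eq_zero_iff hg hsm (hpos p) he hp (H.negJacobianPos hg e he p hp)).1 h1

/-- `ψ₂ ψ₁⁻¹` is locally constant, hence constant on a connected surface. -/
theorem exists_left_translation [PreconnectedSpace X] [Nonempty X] {n : X → ℍ[ℝ]} {s : X → ℝ}
    (hn : IsSphereMap n) {ψ₁ ψ₂ : X → UnitQuaternions}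
    (h₁ : ∀ p, IsFrameAt (fun x => (ψ₁ x : ℍ[ℝ])) n s p)
    (h₂ : ∀ p, IsFrameAt (fun x => (ψ₂ x : ℍ[ℝ])) n s p) :
    ∃ c : UnitQuaternions, ∀ p, ψ₂ p = c * ψ₁ p := by
  have hloc : IsLocallyConstant fun q => (ψ₂ q : ℍ[ℝ]) * star (ψ₁ q : ℍ[ℝ]) :=
    (IsLocallyConstant.iff_eventually_eq _).2 fun p =>
      eventually_mul_star_eq hn (φ := fun x => (ψ₂ x : ℍ[ℝ])) (ψ := fun x => (ψ₁ x : ℍ[ℝ]))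
        (Eventually.of_forall h₂) (Eventually.of_forall h₁)
  obtain ⟨p₀⟩ := ‹Nonempty X›
  refine ⟨⟨(ψ₂ p₀ : ℍ[ℝ]) * star (ψ₁ p₀ : ℍ[ℝ]), by simp⟩, fun p => Subtype.ext ?_⟩
  change (ψ₂ p : ℍ[ℝ]) = (ψ₂ p₀ : ℍ[ℝ]) * star (ψ₁ p₀ : ℍ[ℝ]) * ψ₁ p
  rw [← hloc.apply_eq_of_preconnectedSpace p p₀, mul_assoc, star_mul_self_of_norm (by simp),
    mul_one]

end Main

end

theorem corollary3p9 {X : Type*} [TopologicalSpace X] [T2Space X] [SimplyConnectedSpace X]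
    [ChartedSpace ℂ X] [IsManifold 𝓘(ℂ) ω X]
    (g : X → OnePoint ℂ) (hg : SmoothToSphere g) :
    -- existence
    ((∃ (ψ : X → UnitQuaternions) (N : X → ℍ[ℝ]), HasGaussMapAndConformalStructure ψ N g) ↔
      (NegJacobianPos g ∧ ∃ K : X → ℝ, SolvesGaussEquation g K)) ∧
    -- the solutions are exactly the extrinsic curvatures of these immersions
    (∀ K : X → ℝ,
      (∃ (ψ : X → UnitQuaternions) (N : X → ℍ[ℝ]),
        HasGaussMapAndConformalStructure ψ N g ∧ IsExtrinsicCurvature ψ N K) ↔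
      (NegJacobianPos g ∧ SolvesGaussEquation g K)) ∧
    -- uniqueness up to left translations
    (∀ (K : X → ℝ) (ψ₁ ψ₂ : X → UnitQuaternions) (N₁ N₂ : X → ℍ[ℝ]),
      HasGaussMapAndConformalStructure ψ₁ N₁ g → IsExtrinsicCurvature ψ₁ N₁ K →
      HasGaussMapAndConformalStructure ψ₂ N₂ g → IsExtrinsicCurvature ψ₂ N₂ K →
      ∃ c : UnitQuaternions, ∀ p, ψ₂ p = c * ψ₁ p) := by
  refine ⟨⟨?_, ?_⟩, fun K => ⟨?_, ?_⟩, ?_⟩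
  · rintro ⟨ψ, N, H⟩
    obtain ⟨s, hs0, hs⟩ := H.exists_isFrameAt hg
    exact ⟨H.negJacobianPos hg, _,
      H.solvesGaussEquation hg (H.isExtrinsicCurvature_sq hg hs0 hs)⟩
  · rintro ⟨hJ, K, hK⟩
    obtain ⟨ψ, N, H, -⟩ := exists_immersion_of_solvesGaussEquation hg hJ hK
    exact ⟨ψ, N, H⟩
  · rintro ⟨ψ, N, H, hK⟩
    exact ⟨H.negJacobianPos hg, H.solvesGaussEquation hg hK⟩
  · rintro ⟨hJ, hK⟩
    exact exists_immersion_of_solvesGaussEquation hg hJ hK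
  · intro K ψ₁ ψ₂ N₁ N₂ H₁ hK₁ H₂ hK₂
    exact exists_left_translation hg.isSphereMap (H₁.isFrameAt_sqrt hg hK₁).2
      (H₂.isFrameAt_sqrt hg hK₂).2
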